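/- Let $n\in\mathbb N=\{1,2,\dots\}$. Cubes $Q\subset\mathbb R^n$ have finite positive edge length and edges parallel to the axes, and may or may not contain parts of their boundary. For a measurable $p:\mathbb R^n\to(0,\infty)$ and a measurable $f$, put $\|f\|_{L^{p(\cdot)}}:=\inf\{\lambda>0:\int_{\mathbb R^n}(|f(x)|/\lambda)^{p(x)}\,dx\le 1\}$ (with $\inf\emptyset=\infty$). Write $p_-:=\operatorname{ess\,inf}p$ and $p_+:=\operatorname{ess\,sup}p$. The class $\mathcal P_0\cap LH$ consists of those $p$ with $p_->0$ for which there are positive constants $C_0,C_\infty,p_\infty$ such that $|p(x)-p(y)|\le -C_0/\log|x-y|$ whenever $|x-y|<\frac12$, and $|p(x)-p_\infty|\le C_\infty/\log(e+|x|)$ for all $x$. Let $m\in\mathbb N$ and let $\|\cdot\|$ be the operator norm on the space $M_m$ of complex $m\times m$ matrices, acting on $\mathbb C^m$ with the Euclidean norm. A matrix weight is a map $W:\mathbb R^n\to M_m$ with locally integrable entries such that $W(x)$ is nonnegative definite and invertible for almost every $x$. It belongs to $\mathscr A_{p(\cdot),\infty}$ if $$[W]_{\mathscr A_{p(\cdot),\infty}}:=\sup_Q\exp\left(\frac1{|Q|}\int_Q\log\left(\frac{\big\|\,\|W(\cdot)W^{-1}(y)\|\mathbf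 1_Q\big\|_{L^{p(\cdot)}}}{\|\mathbf 1_Q\|_{L^{p(\cdot)}}}\right)dy\right)<\infty,$$ where the supremum is taken over all cubes $Q$. **Theorem.** There exist positive constants $C,C_1,C_2,A,A_1$, depending only on $n$ and on $p(\cdot)$ through $p_-,p_+,p_\infty,C_0,C_\infty$ (in particular, neither on $m$ nor on $W$), such that the following holds for every $p(\cdot)\in\mathcal P_0\cap LH$ with these parameters, every $m\in\mathbb N$ and every $m\times m$ matrix weight $W\in\mathscr A_{p(\cdot),\infty}$. Let $$r_W:=1+\frac1{C_1[W]_{\mathscr A_{p(\cdot),\infty}}^{A_1}2^{C_2[W]_{\mathscr A_{p(\cdot),\infty}}}}.$$ Then, for every $r\in(1,r_W]$, every cube $Q\subset\mathbb R^n$ and every $M\in M_m$, $$\frac{\big\|\,\|W(\cdot)M\|\mathbf 1_Q\big\|_{L^{rp(\cdot)}}}{\|\mathbf 1_Q\|_{L^{rp(\cdot)}}}\le C[W]_{\mathscr A_{p(\cdot),\infty}}^{A}\,\frac{\big\|\,\|W(\cdot)M\|\mathbf 1_Q\big\|_{L^{p(\cdot)}}}{\|\mathbf 1_Q\|_{L^{p(\cdot)}}}.$$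 -/

import Mathlib

open MeasureTheory Set
open scoped ENNReal ComplexOrder

noncomputable section

/-- The Euclidean space `ℝⁿ`. -/
abbrev RSpace (n : ℕ) : Type := EuclideanSpace ℝ (Fin n)

/-- Cubes of `ℝⁿ`: products of `n` bounded intervals of the same length `l > 0`, where each endpoint
may or may not belong to its interval. -/
def IsCube {n : ℕ} (Q : Set (RSpace n)) : Prop :=
  ∃ (a : Fin n → ℝ) (l : ℝ) (I : Fin n → Set ℝ), 0 < l ∧
    (∀ i, Ioo (a i) (a i + l) ⊆ I i ∧ I i ⊆ Icc (a i) (a i + l)) ∧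
    Q = {x | ∀ i, x i ∈ I i}

/-- Real-valued exponents of class `𝒫₀`: measurable, positive, with positive essential infimum. -/
structure IsExponent {n : ℕ} (p : RSpace n → ℝ) : Prop where
  measurable : Measurable p
  pos : ∀ x, 0 < p x
  essInf_pos : 0 < essInf p volume

/-- Local log-Hölder continuity with constant `C₀`. (At `x = y` both sides are `0`.) -/
def LocalLogHolder {n : ℕ} (C₀ : ℝ) (p : RSpace n → ℝ) : Prop :=
  0 < C₀ ∧ ∀ x y : RSpace n, ‖x - y‖ < 1 / 2 → |p x - p y| ≤ -C₀ / Real.log ‖x - y‖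

/-- Log-Hölder continuity at infinity with limit `pinf` and constant `Cinf`. -/
def LogHolderAtInfty {n : ℕ} (pinf Cinf : ℝ) (p : RSpace n → ℝ) : Prop :=
  0 < pinf ∧ 0 < Cinf ∧
    ∀ x : RSpace n, |p x - pinf| ≤ Cinf / Real.log (Real.exp 1 + ‖x‖)

/-- The modular `∫ |f(x) / t|^{p(x)} dx`, for `t > 0`. -/
def modular {n : ℕ} (p : RSpace n → ℝ) (f : RSpace n → ℝ) (t : ℝ) : ℝ≥0∞ :=
  ∫⁻ x, ENNReal.ofReal ((|f x| / t) ^ p x)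

/-- The Luxemburg (quasi-)norm of the variable Lebesgue space `L^{p(·)}`, with value `∞` on the
functions that do not belong to the space. -/
def varNorm {n : ℕ} (p : RSpace n → ℝ) (f : RSpace n → ℝ) : ℝ≥0∞ :=
  ⨅ (t : ℝ) (_ : 0 < t) (_ : modular p f t ≤ 1), ENNReal.ofReal t

/-- The ratio `‖f 1_Q‖_{L^{p(·)}} / ‖1_Q‖_{L^{p(·)}}`. -/
def normRatio {n : ℕ} (p : RSpace n → ℝ) (Q : Set (RSpace n)) (f : RSpace n → ℝ) : ℝ≥0∞ :=
  varNorm p (Q.indicator f) / varNorm p (Q.indicator fun _ => (1 : ℝ))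

/-- The operator norm of a complex `m × m` matrix acting on `ℂᵐ` with its Euclidean norm. -/
def matNorm {m : ℕ} (A : Matrix (Fin m) (Fin m) ℂ) : ℝ :=
  ‖Matrix.toEuclideanCLM (n := Fin m) (𝕜 := ℂ) A‖

/-- Matrix weights. -/
structure IsMatrixWeight {n m : ℕ} (W : RSpace n → Matrix (Fin m) (Fin m) ℂ) : Prop where
  posSemidef : ∀ᵐ x, (W x).PosSemidef
  isUnit : ∀ᵐ x, IsUnit (W x)
  locallyIntegrable : ∀ i j, LocallyIntegrable (fun x => W x i j)

/-- The extended-real mean `⨍_Q log φ(y) dy` of a function `φ` with values in `[0, ∞]`: the mean of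
the positive part of `log φ` minus the mean of its negative part. -/
def logMean {n : ℕ} (Q : Set (RSpace n)) (φ : RSpace n → ℝ≥0∞) : EReal :=
  ((laverage (volume.restrict Q) fun y => (ENNReal.log (φ y)).toENNReal : ℝ≥0∞) : EReal) -
    ((laverage (volume.restrict Q) fun y => (-ENNReal.log (φ y)).toENNReal : ℝ≥0∞) : EReal)

/-- The constant `[W]` of the class `𝒜_{p(·),∞}`:
`sup_Q exp (⨍_Q log (‖ ‖W(·) W⁻¹(y)‖ 1_Q ‖_{L^{p(·)}} / ‖1_Q‖_{L^{p(·)}}) dy)`.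
For a matrix weight and `m ≥ 1` the negative part of the logarithm is integrable over `Q`, because
`‖W(x) W⁻¹(y)‖ ≥ ‖W(x)‖ / ‖W(y)‖`, so that the mean is well defined in `(-∞, ∞]`. -/
def matrixApConst {n m : ℕ} (p : RSpace n → ℝ) (W : RSpace n → Matrix (Fin m) (Fin m) ℂ) : ℝ≥0∞ :=
  ⨆ (Q : Set (RSpace n)) (_ : IsCube Q),
    EReal.exp (logMean Q fun y => normRatio p Q fun x => matNorm (W x * (W y)⁻¹))

/-- Matrix `𝒜_{p(·),∞}` weights. -/
def IsMatrixApWeight {n m : ℕ} (p : RSpace n → ℝ)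
    (W : RSpace n → Matrix (Fin m) (Fin m) ℂ) : Prop :=
  IsMatrixWeight W ∧ matrixApConst p W < ∞

end

/-! The problem reduces to scalar weights. For `M ≠ 0` put `w = ‖W(·)M‖`. Since `‖W(x)M‖ ≤
‖W(x)W⁻¹(y)‖ ‖W(y)M‖`, taking logarithms and averaging in `y` gives `‖w 1_Q‖ ≤ [W] exp(⨍_Q log w)
‖1_Q‖` on every box, with no loss depending on `m` (`IsMatrixApWeight.exists_scalar`). What remains
is a reverse Hölder inequality for such `w` (`exists_scalar_reverse_holder`).

For a constant exponent one would run a Gehring argument on `w ^ p`. For a variable exponent `w ^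
p(x)` does not scale uniformly, so it is replaced by a gauge adapted to two regimes. The box is cut
into dyadic cells of edge between `1/2` and `1` (or left whole if its edge is at most `1`). With `m`
the normalized norm of `w` on such a cell and `u = max (w / m) 1`, the gauge is `v = m ^ p∞ * u ^
p(x)`. Inside a cell, local log-Hölder continuity allows the exponent to be frozen at a point,
because the numbers raised to it are controlled by powers of the edge length (`rpow_le_of_mem_box`).
Across cells, the decay condition exchanges `p(x)` for `p∞` at the price of an error proportional to
`(e + |x|)^{-(n+1)}`, which is integrable (`rpow_compare`).

The hypothesis on `w` bounds the mean of `v` on every dyadic cell, small or large, by a multiple of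
a geometric mean. Hence `v` exceeds `γ` times its mean on at least half of each cell, where `γ` is
comparable to `K ^ (-2P)` (`measure_le_two_mul_of_log_mean_le`, `exists_cellGauge_good`). A
stopping-time and layer-cake argument then yields higher integrability of `v` for `r - 1 ≲ γ²`
(`gehring`), and the two exponent comparisons, applied to `r p(·)`, convert this back into a norm
inequality.

The range obtained for `r - 1` is a power of `1 / [W]`. The exponential factor in the statement is
at least `1` and only shrinks that range. -/

/-! ### Boxes and their volumes. -/

/-- The half-open box with lower corner `a` and edge length `l`. -/
def box {n : ℕ} (a : Fin n → ℝ) (l : ℝ) : Set (RSpace n) := {x | ∀ i, x i ∈ Ico (a i) (a i + l)}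

theorem isCube_box {n : ℕ} (a : Fin n → ℝ) {l : ℝ} (hl : 0 < l) : IsCube (box a l) :=
  ⟨a, l, fun i => Ico (a i) (a i + l), hl,
    fun _ => ⟨Ioo_subset_Ico_self, Ico_subset_Icc_self⟩, rfl⟩

theorem measurableSet_box {n : ℕ} (a : Fin n → ℝ) (l : ℝ) : MeasurableSet (box a l) := by
  have : box a l = ⋂ i, (fun x : RSpace n => x i) ⁻¹' Ico (a i) (a i + l) := by
    ext x; simp [box]
  rw [this]
  exact MeasurableSet.iInter fun i => (by fun_prop : Measurable fun x : RSpace n => x i)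
    measurableSet_Ico

theorem volume_coord_set {n : ℕ} (s : Fin n → Set ℝ) (hs : ∀ i, MeasurableSet (s i)) :
    volume {x : RSpace n | ∀ i, x i ∈ s i} = ∏ i, volume (s i) := by
  have h := (PiLp.volume_preserving_ofLp (Fin n)).measure_preimage
    (s := univ.pi s) (MeasurableSet.univ_pi hs).nullMeasurableSet
  rw [volume_pi_pi] at h
  rw [← h]
  congr 1
  ext x
  simp

theorem volume_box {n : ℕ} (a : Fin n → ℝ) {l : ℝ} (hl : 0 < l) :
    volume (box a l) = ENNReal.ofReal (l ^ n) := by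
  rw [box, volume_coord_set _ fun _ => measurableSet_Ico]
  simp [Real.volume_Ico, ENNReal.ofReal_pow hl.le]

theorem volume_coord_Icc {n : ℕ} (a : Fin n → ℝ) {l : ℝ} (hl : 0 < l) :
    volume {x : RSpace n | ∀ i, x i ∈ Icc (a i) (a i + l)} = ENNReal.ofReal (l ^ n) := by
  rw [volume_coord_set _ fun _ => measurableSet_Icc]
  simp [Real.volume_Icc, ENNReal.ofReal_pow hl.le]

theorem volume_coord_Ioo {n : ℕ} (a : Fin n → ℝ) {l : ℝ} (hl : 0 < l) :
    volume {x : RSpace n | ∀ i, x i ∈ Ioo (a i) (a i + l)} = ENNReal.ofReal (l ^ n) := by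
  rw [volume_coord_set _ fun _ => measurableSet_Ioo]
  simp [Real.volume_Ioo, ENNReal.ofReal_pow hl.le]

theorem volume_box_ne_top {n : ℕ} (a : Fin n → ℝ) {l : ℝ} (hl : 0 < l) :
    volume (box a l) ≠ ⊤ := by
  rw [volume_box a hl]; exact ENNReal.ofReal_ne_top

theorem volume_box_ne_zero {n : ℕ} (a : Fin n → ℝ) {l : ℝ} (hl : 0 < l) :
    volume (box a l) ≠ 0 := by
  rw [volume_box a hl]; simpa using pow_pos hl n

/-- Every cube coincides almost everywhere with a half-open box. -/
theorem IsCube.ae_eq_box {n : ℕ} {Q : Set (RSpace n)} (hQ : IsCube Q) :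
    ∃ (a : Fin n → ℝ) (l : ℝ), 0 < l ∧ Q =ᵐ[volume] box a l := by
  obtain ⟨a, l, I, hl, hI, rfl⟩ := hQ
  refine ⟨a, l, hl, ?_⟩
  have hoo : MeasurableSet {x : RSpace n | ∀ i, x i ∈ Ioo (a i) (a i + l)} := by
    have : {x : RSpace n | ∀ i, x i ∈ Ioo (a i) (a i + l)}
        = ⋂ i, (fun x : RSpace n => x i) ⁻¹' Ioo (a i) (a i + l) := by
      ext x; simp
    rw [this]
    exact MeasurableSet.iInter fun i => (by fun_prop : Measurable fun x : RSpace n => x i)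
      measurableSet_Ioo
  have key : ∀ S : Set (RSpace n), {x : RSpace n | ∀ i, x i ∈ Ioo (a i) (a i + l)} ⊆ S →
      S ⊆ {x : RSpace n | ∀ i, x i ∈ Icc (a i) (a i + l)} →
      {x : RSpace n | ∀ i, x i ∈ Ioo (a i) (a i + l)} =ᵐ[volume] S := by
    intro S h1 h2
    have hle : volume S ≤ ENNReal.ofReal (l ^ n) :=
      (measure_mono h2).trans (volume_coord_Icc a hl).le
    exact ae_eq_of_subset_of_measure_ge h1 (by rw [volume_coord_Ioo a hl]; exact hle)
      hoo.nullMeasurableSet (ne_top_of_le_ne_top ENNReal.ofReal_ne_top hle)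
  exact (key _ (fun x hx i => (hI i).1 (hx i)) (fun x hx i => (hI i).2 (hx i))).symm.trans
    (key _ (fun x hx i => Ioo_subset_Ico_self (hx i))
      (fun x hx i => Ico_subset_Icc_self (hx i)))

/-! ### Dyadic cells and differentiation along them. -/

/-- The cell of generation `k` containing `x` in the dyadic grid with origin `a` and unit `L`. -/
def dyadic {n : ℕ} (a : Fin n → ℝ) (L : ℝ) (k : ℕ) (x : RSpace n) : Set (RSpace n) :=
  box (fun i => a i + ⌊(x i - a i) / (L / 2 ^ k)⌋ * (L / 2 ^ k)) (L / 2 ^ k)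

section Dyadic

variable {n : ℕ} {a : Fin n → ℝ} {L : ℝ} {k : ℕ} {x y : RSpace n}

theorem mem_dyadic (hL : 0 < L) :
    y ∈ dyadic a L k x ↔
      ∀ i, ⌊(y i - a i) / (L / 2 ^ k)⌋ = ⌊(x i - a i) / (L / 2 ^ k)⌋ := by
  have h : 0 < L / 2 ^ k := by positivity
  refine forall_congr' fun i => ?_
  rw [Int.floor_eq_iff, le_div_iff₀ h, div_lt_iff₀ h, mem_Ico]
  constructor
  · rintro ⟨h1, h2⟩; constructor <;> linarith
  · rintro ⟨h1, h2⟩; constructor <;> linarith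

theorem self_mem_dyadic (hL : 0 < L) : x ∈ dyadic a L k x := (mem_dyadic hL).2 fun _ => rfl

theorem dyadic_eq_of_mem (hL : 0 < L) (h : y ∈ dyadic a L k x) :
    dyadic a L k y = dyadic a L k x := by
  rw [mem_dyadic hL] at h
  simp only [dyadic, h]

theorem dyadic_succ_subset (hL : 0 < L) : dyadic a L (k + 1) x ⊆ dyadic a L k x := by
  intro y hy
  rw [mem_dyadic hL] at hy ⊢
  intro i
  -- The parent's index is the integer half of the child's, so equal indices in generation `k + 1`
  -- force equal indices in generation `k`.
  have key : ∀ t : ℝ, ⌊t / (L / 2 ^ k)⌋ = ⌊t / (L / 2 ^ (k + 1))⌋ / 2 := by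
    intro t
    have h1 : t / (L / 2 ^ k) = (t / (L / 2 ^ (k + 1))) / ((2 : ℕ) : ℝ) := by
      field_simp; push_cast; ring
    rw [h1, Int.floor_div_natCast]; rfl
  rw [key, key, hy i]

theorem dyadic_subset (hL : 0 < L) {j : ℕ} (hkj : k ≤ j) : dyadic a L j x ⊆ dyadic a L k x := by
  induction j, hkj using Nat.le_induction with
  | base => exact subset_rfl
  | succ j _ ih => exact (dyadic_succ_subset hL).trans ih

theorem dyadic_zero (hL : 0 < L) (hx : x ∈ box a L) : dyadic a L 0 x = box a L := by
  have : ∀ i, ⌊(x i - a i) / (L / 2 ^ 0)⌋ = 0 := by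
    intro i
    have := hx i
    rw [Int.floor_eq_zero_iff, mem_Ico]
    simp only [mem_Ico, pow_zero, div_one] at this ⊢
    exact ⟨by apply div_nonneg <;> linarith, by rw [div_lt_one hL]; linarith⟩
  simp only [dyadic, this]
  simp

theorem measurableSet_dyadic : MeasurableSet (dyadic a L k x) := measurableSet_box _ _

theorem volume_dyadic (hL : 0 < L) :
    volume (dyadic a L k x) = ENNReal.ofReal ((L / 2 ^ k) ^ n) :=
  volume_box _ (by positivity)

theorem volume_dyadic_ne_top (hL : 0 < L) : volume (dyadic a L k x) ≠ ⊤ :=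
  volume_box_ne_top _ (by positivity)

theorem volume_dyadic_ne_zero (hL : 0 < L) : volume (dyadic a L k x) ≠ 0 :=
  volume_box_ne_zero _ (by positivity)

theorem volume_dyadic_eq_mul_succ (hL : 0 < L) :
    volume (dyadic a L k x) = 2 ^ n * volume (dyadic a L (k + 1) x) := by
  rw [volume_dyadic hL, volume_dyadic hL]
  have : (2 : ℝ≥0∞) ^ n = ENNReal.ofReal (2 ^ n) := by
    rw [ENNReal.ofReal_pow (by norm_num)]; norm_num
  rw [this, ← ENNReal.ofReal_mul (by positivity), ← mul_pow]
  congr 2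
  field_simp; ring

theorem countable_range_dyadic : (range fun x : RSpace n => dyadic a L k x).Countable := by
  refine (countable_range fun z : Fin n → ℤ =>
    (box (fun i => a i + z i * (L / 2 ^ k)) (L / 2 ^ k) : Set (RSpace n))).mono ?_
  rintro _ ⟨x, rfl⟩
  exact ⟨fun i => ⌊(x i - a i) / (L / 2 ^ k)⌋, rfl⟩

theorem dist_le_of_mem_coord_Icc {b : Fin n → ℝ} {l : ℝ} (hl : 0 ≤ l)
    (hx : ∀ i, x i ∈ Icc (b i) (b i + l)) (hy : ∀ i, y i ∈ Icc (b i) (b i + l)) :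
    dist x y ≤ √n * l := by
  rw [EuclideanSpace.dist_eq]
  have : ∑ i, dist (x i) (y i) ^ 2 ≤ n * l ^ 2 := by
    calc ∑ i, dist (x i) (y i) ^ 2 ≤ ∑ _i : Fin n, l ^ 2 := by
          refine Finset.sum_le_sum fun i _ => ?_
          have h1 := hx i
          have h2 := hy i
          rw [mem_Icc] at h1 h2
          gcongr
          rw [Real.dist_eq, abs_le]
          constructor <;> linarith
      _ = n * l ^ 2 := by simp
  calc √(∑ i, dist (x i) (y i) ^ 2) ≤ √(n * l ^ 2) := Real.sqrt_le_sqrt this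
    _ = √n * l := by rw [Real.sqrt_mul (by positivity), Real.sqrt_sq hl]

/-- The Lebesgue differentiation theorem for dyadic cells. -/
theorem ae_tendsto_dyadic_average (hL : 0 < L) {f : RSpace n → ℝ≥0∞} (hf : AEMeasurable f)
    (hfin : ∫⁻ y, f y ≠ ⊤) :
    ∀ᵐ x, Filter.Tendsto
      (fun k => (∫⁻ y in dyadic a L k x, f y) / volume (dyadic a L k x))
      Filter.atTop (nhds (f x)) := by
  set ω : NNReal := (volume (Metric.ball (0 : RSpace n) 1)).toNNReal with hω
  have hω' : volume (Metric.ball (0 : RSpace n) 1) = ω :=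
    (ENNReal.coe_toNNReal measure_ball_lt_top.ne).symm
  -- The first summand is the doubling constant of balls. The second compares a cube with the ball
  -- of three times the radius `√n` times its edge, as regularity in the Vitali family demands.
  set C : NNReal := 3 ^ n + (3 * (√n).toNNReal) ^ n * ω with hC
  have hball : ∀ (x : RSpace n) (r : ℝ), 0 ≤ r → volume (Metric.closedBall x r)
      = ENNReal.ofReal (r ^ n) * ω := by
    intro x r hr
    rw [Measure.addHaar_closedBall _ _ hr, hω']; simp
  have h3 : ∀ x : RSpace n, ∃ᶠ r in nhdsWithin 0 (Ioi 0),
      volume (Metric.closedBall x (3 * r)) ≤ C * volume (Metric.closedBall x r) := by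
    intro x
    refine Filter.Eventually.frequently ?_
    filter_upwards [self_mem_nhdsWithin] with r hr
    have hr : (0 : ℝ) < r := hr
    rw [hball _ _ (by positivity), hball _ _ hr.le, mul_pow,
      ENNReal.ofReal_mul (by positivity), mul_assoc]
    gcongr
    rw [hC, ENNReal.ofReal_pow (by norm_num)]
    push_cast
    refine le_trans ?_ le_self_add
    norm_num
  let F := Vitali.vitaliFamily (volume : Measure (RSpace n)) C h3
  filter_upwards [F.ae_tendsto_lintegral_div hf hfin] with x hx
  let c : ℕ → Fin n → ℝ := fun k i => a i + ⌊(x i - a i) / (L / 2 ^ k)⌋ * (L / 2 ^ k)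
  -- A Vitali family consists of closed sets, so the half-open cells are replaced by their closed
  -- versions, which differ by null sets.
  let S : ℕ → Set (RSpace n) := fun k => {y | ∀ i, y i ∈ Icc (c k i) (c k i + L / 2 ^ k)}
  have hpos : ∀ k : ℕ, 0 < L / 2 ^ k := fun k => by positivity
  have hsub : ∀ k, dyadic a L k x ⊆ S k := fun k y hy i => Ico_subset_Icc_self (hy i)
  have hxS : ∀ k, x ∈ S k := fun k => hsub k (self_mem_dyadic hL)
  have hae : ∀ k, dyadic a L k x =ᵐ[volume] S k := fun k =>
    ae_eq_of_subset_of_measure_ge (hsub k)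
      (by rw [volume_dyadic hL]; exact (volume_coord_Icc _ (hpos k)).le)
      measurableSet_dyadic.nullMeasurableSet
      (by rw [volume_coord_Icc _ (hpos k)]; exact ENNReal.ofReal_ne_top)
  have hball' : ∀ k, S k ⊆ Metric.closedBall x (√n * (L / 2 ^ k)) := fun k y hy =>
    dist_le_of_mem_coord_Icc (hpos k).le hy (hxS k)
  have hlim : Filter.Tendsto S Filter.atTop (F.filterAt x) := by
    rw [VitaliFamily.tendsto_filterAt_iff]
    constructor
    · refine Filter.Eventually.of_forall fun k => ⟨?_, ?_, √n * (L / 2 ^ k), hball' k, ?_⟩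
      · have : S k = ⋂ i, (fun y : RSpace n => y i) ⁻¹' Icc (c k i) (c k i + L / 2 ^ k) := by
          ext y; simp [S]
        rw [this]
        exact isClosed_iInter fun i => isClosed_Icc.preimage (by fun_prop)
      · have ho : IsOpen {y : RSpace n | ∀ i, y i ∈ Ioo (c k i) (c k i + L / 2 ^ k)} := by
          have : {y : RSpace n | ∀ i, y i ∈ Ioo (c k i) (c k i + L / 2 ^ k)}
              = ⋂ i, (fun y : RSpace n => y i) ⁻¹' Ioo (c k i) (c k i + L / 2 ^ k) := by
            ext y; simp
          rw [this]
          exact isOpen_iInter_of_finite fun i => isOpen_Ioo.preimage (by fun_prop)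
        refine Nonempty.mono (interior_maximal
          (fun y (hy : ∀ i, y i ∈ Ioo _ _) i => Ioo_subset_Icc_self (hy i)) ho) ?_
        refine ⟨WithLp.toLp 2 fun i => c k i + L / 2 ^ k / 2, fun i => ?_⟩
        have := hpos k
        simp only [mem_Ioo]
        constructor <;> linarith
      · rw [hball _ _ (by have := hpos k; positivity), volume_coord_Icc _ (hpos k),
          ← mul_assoc, mul_pow, ENNReal.ofReal_mul (by positivity), mul_right_comm]
        gcongr
        rw [ENNReal.ofReal_pow (by positivity), ENNReal.ofReal_mul (by norm_num), hC]
        push_cast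
        refine le_trans (le_of_eq ?_) le_add_self
        congr 2
        norm_num [ENNReal.ofReal]
    · intro ε hε
      have ht : Filter.Tendsto (fun k : ℕ => √n * (L / 2 ^ k)) Filter.atTop (nhds 0) := by
        have := (tendsto_pow_atTop_nhds_zero_of_lt_one (r := (1 / 2 : ℝ)) (by norm_num)
          (by norm_num)).const_mul (√n * L)
        simp only [mul_zero] at this
        refine this.congr fun k => ?_
        rw [div_pow, one_pow]; ring
      filter_upwards [ht.eventually (gt_mem_nhds hε)] with k hk
      exact (hball' k).trans (Metric.closedBall_subset_closedBall hk.le)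
  refine (hx.comp hlim).congr fun k => ?_
  simp only [Function.comp_apply]
  rw [setLIntegral_congr (hae k), measure_congr (hae k)]

end Dyadic

/-! ### Self-improvement of integrability by stopping times. -/

section Gehring

variable {n : ℕ} {a : Fin n → ℝ} {L : ℝ} {k : ℕ} {x₀ : RSpace n}

/-- The mean of `v` over the dyadic cell of generation `j` around `x`. -/
noncomputable def dyadicMean (a : Fin n → ℝ) (L : ℝ) (v : RSpace n → ℝ≥0∞) (j : ℕ) (x : RSpace n) :
    ℝ≥0∞ :=
  (∫⁻ y in dyadic a L j x, v y) / volume (dyadic a L j x)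

theorem dyadicMean_congr (hL : 0 < L) {v : RSpace n → ℝ≥0∞} {j : ℕ} {x y : RSpace n}
    (h : y ∈ dyadic a L j x) : dyadicMean a L v j y = dyadicMean a L v j x := by
  simp only [dyadicMean, dyadic_eq_of_mem hL h]

/-- The level set estimate obtained from the maximal dyadic cells on which the mean exceeds `t`. -/
theorem setLIntegral_gt_le_of_good (hL : 0 < L) {v : RSpace n → ℝ≥0∞} (hv : Measurable v)
    (hfin : ∫⁻ y in dyadic a L k x₀, v y ≠ ⊤) {γ : ℝ≥0∞}
    (hgood : ∀ j, k ≤ j → ∀ x ∈ dyadic a L k x₀, volume (dyadic a L j x) ≤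
      2 * volume {y ∈ dyadic a L j x | γ * dyadicMean a L v j x < v y})
    {t : ℝ≥0∞} (ht : dyadicMean a L v k x₀ ≤ t) :
    ∫⁻ y in dyadic a L k x₀ ∩ {y | t < v y}, v y ≤
      2 ^ (n + 1) * t * volume (dyadic a L k x₀ ∩ {y | γ * t < v y}) := by
  classical
  set Q := dyadic a L k x₀ with hQ
  have hQm : MeasurableSet Q := measurableSet_dyadic
  have hsubQ : ∀ j, k ≤ j → ∀ x ∈ Q, dyadic a L j x ⊆ Q := fun j hj x hx =>
    (dyadic_subset hL hj).trans (dyadic_eq_of_mem hL hx).subset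
  -- Calderón–Zygmund stopping cells: the first generation, counted from `k`, in which the mean
  -- exceeds `t`.
  let T : Set (Set (RSpace n)) := {S | ∃ j, k ≤ j ∧ ∃ x ∈ Q, S = dyadic a L j x ∧
    t < dyadicMean a L v j x ∧ ∀ i, k ≤ i → i < j → dyadicMean a L v i x ≤ t}
  have hTc : T.Countable := by
    refine (countable_iUnion fun j => countable_range_dyadic (a := a) (L := L) (k := j)).mono ?_
    rintro S ⟨j, -, x, -, rfl, -⟩
    exact mem_iUnion.2 ⟨j, x, rfl⟩
  have hTm : ∀ S ∈ T, MeasurableSet S := by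
    rintro S ⟨j, -, x, -, rfl, -⟩; exact measurableSet_dyadic
  have hTQ : ∀ S ∈ T, S ⊆ Q := by
    rintro S ⟨j, hj, x, hx, rfl, -⟩; exact hsubQ j hj x hx
  have haux : ∀ j x j' x' z, k ≤ j → j < j' → z ∈ dyadic a L j x → z ∈ dyadic a L j' x' →
      t < dyadicMean a L v j x → (∀ i, k ≤ i → i < j' → dyadicMean a L v i x' ≤ t) → False := by
    intro j x j' x' z hkj hjj hz hz' h1 h2
    have h3 : dyadicMean a L v j x = dyadicMean a L v j x' := by
      rw [← dyadicMean_congr hL hz, dyadicMean_congr hL (dyadic_subset hL hjj.le hz')]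
    exact absurd (h2 j hkj hjj) (not_le.2 (h3 ▸ h1))
  have hTd : T.PairwiseDisjoint id := by
    rintro S ⟨j, hj, x, hx, rfl, h1, h2⟩ S' ⟨j', hj', x', hx', rfl, h1', h2'⟩ hne
    rw [Function.onFun, Set.disjoint_left]
    intro z hz hz'
    simp only [id] at hz hz'
    rcases lt_trichotomy j j' with h | h | h
    · exact haux j x j' x' z hj h hz hz' h1 h2'
    · subst h
      exact hne (by rw [← dyadic_eq_of_mem hL hz, dyadic_eq_of_mem hL hz'])
    · exact haux j' x' j x z hj' h hz' hz h1' h2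
  -- At almost every point where `v > t`, dyadic means converge to `v` and so eventually exceed `t`;
  -- the first such generation supplies a stopping cell.
  have hcover : ∀ᵐ x, x ∈ Q ∩ {y | t < v y} → x ∈ ⋃ S ∈ T, S := by
    have hfi : ∫⁻ y, Q.indicator v y ≠ ⊤ := by rwa [lintegral_indicator hQm]
    filter_upwards [ae_tendsto_dyadic_average (a := a) hL (hv.indicator hQm).aemeasurable hfi]
      with x hx hxQ
    obtain ⟨hxQ, hxt⟩ := hxQ
    rw [indicator_of_mem hxQ] at hx
    have hev := (hx.eventually (lt_mem_nhds hxt)).and (Filter.eventually_ge_atTop k)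
    obtain ⟨j, hj, hkj⟩ := hev.exists
    have hj' : t < dyadicMean a L v j x := by
      rw [setLIntegral_indicator hQm,
        inter_eq_self_of_subset_right (hsubQ j hkj x hxQ)] at hj
      exact hj
    have hex : ∃ j, k ≤ j ∧ t < dyadicMean a L v j x := ⟨j, hkj, hj'⟩
    refine mem_biUnion (x := dyadic a L (Nat.find hex) x)
      ⟨Nat.find hex, (Nat.find_spec hex).1, x, hxQ, rfl, (Nat.find_spec hex).2, ?_⟩
      (self_mem_dyadic hL)
    intro i hki hi
    by_contra hcon
    exact Nat.find_min hex hi ⟨hki, not_le.1 hcon⟩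
  have hS : ∀ S ∈ T, ∫⁻ y in S, v y ≤
      2 ^ (n + 1) * t * volume (S ∩ {y | γ * t < v y}) := by
    rintro S ⟨j, hj, x, hx, rfl, h1, h2⟩
    -- The cell `Q` itself is never stopped, since its mean is at most `t`. Every stopped cell thus
    -- has a parent inside `Q` with mean at most `t`, which costs `2 ^ n`; the density hypothesis
    -- costs the other factor `2`.
    rcases hj.eq_or_lt with rfl | hlt
    · rw [dyadicMean_congr hL hx] at h1
      exact absurd ht (not_le.2 h1)
    · obtain ⟨i, rfl⟩ : ∃ i, j = i + 1 := ⟨j - 1, by omega⟩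
      have hi := h2 i (by omega) (by omega)
      have hle : ∫⁻ y in dyadic a L i x, v y ≤ t * volume (dyadic a L i x) := by
        rwa [dyadicMean, ENNReal.div_le_iff (volume_dyadic_ne_zero hL)
          (volume_dyadic_ne_top hL)] at hi
      calc ∫⁻ y in dyadic a L (i + 1) x, v y
          ≤ ∫⁻ y in dyadic a L i x, v y := lintegral_mono_set (dyadic_succ_subset hL)
        _ ≤ t * volume (dyadic a L i x) := hle
        _ = t * (2 ^ n * volume (dyadic a L (i + 1) x)) := by
          rw [volume_dyadic_eq_mul_succ hL]
        _ ≤ t * (2 ^ n * (2 * volume (dyadic a L (i + 1) x ∩ {y | γ * t < v y}))) := by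
          gcongr
          refine (hgood (i + 1) (by omega) x hx).trans ?_
          gcongr
          intro y hy
          refine ⟨hy.1, lt_of_le_of_lt ?_ hy.2⟩
          gcongr
        _ = _ := by rw [pow_succ]; ring
  calc ∫⁻ y in Q ∩ {y | t < v y}, v y
      ≤ ∫⁻ y in ⋃ S ∈ T, S, v y := lintegral_mono_set' hcover
    _ = ∑' S : T, ∫⁻ y in (S : Set (RSpace n)), v y :=
        lintegral_biUnion hTc hTm hTd _
    _ ≤ ∑' S : T, 2 ^ (n + 1) * t * volume ((S : Set (RSpace n)) ∩ {y | γ * t < v y}) :=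
        ENNReal.tsum_le_tsum fun S => hS S S.2
    _ = 2 ^ (n + 1) * t * volume (⋃ S ∈ T, S ∩ {y | γ * t < v y}) := by
        rw [ENNReal.tsum_mul_left, measure_biUnion hTc]
        · exact hTd.mono fun S => inter_subset_left
        · exact fun S hS => (hTm S hS).inter (measurableSet_lt measurable_const hv)
    _ ≤ _ := by
        gcongr
        exact iUnion₂_subset fun S hS => inter_subset_inter_left _ (hTQ S hS)

/-- A reverse Hölder inequality of Gehring type on dyadic cells. -/
theorem gehring (hL : 0 < L) {v : RSpace n → ℝ} (hv : Measurable v) (hv0 : ∀ x, 0 ≤ v x)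
    (hfin : ∫⁻ y in dyadic a L k x₀, ENNReal.ofReal (v y) ≠ ⊤) {γ : ℝ} (hγ : 0 < γ) (hγ1 : γ ≤ 1)
    (hgood : ∀ j, k ≤ j → ∀ x ∈ dyadic a L k x₀, volume (dyadic a L j x) ≤
      2 * volume {y ∈ dyadic a L j x | ENNReal.ofReal γ *
        dyadicMean a L (fun y => ENNReal.ofReal (v y)) j x < ENNReal.ofReal (v y)})
    {δ : ℝ} (hδ : 0 < δ) (hδ1 : δ ≤ 1) (hδγ : δ * 2 ^ (n + 2) ≤ γ ^ 2) :
    ∫⁻ y in dyadic a L k x₀, ENNReal.ofReal (v y ^ (1 + δ)) ≤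
      2 * (dyadicMean a L (fun y => ENNReal.ofReal (v y)) k x₀) ^ δ *
        ∫⁻ y in dyadic a L k x₀, ENNReal.ofReal (v y) := by
  set Q := dyadic a L k x₀ with hQ
  have hQm : MeasurableSet Q := measurableSet_dyadic
  set vE : RSpace n → ℝ≥0∞ := fun y => ENNReal.ofReal (v y) with hvE
  have hvEm : Measurable vE := hv.ennreal_ofReal
  set A := dyadicMean a L vE k x₀ with hA
  have hAtop : A ≠ ⊤ := ENNReal.div_ne_top hfin (volume_dyadic_ne_zero hL)
  have hlevel : ∀ t : ℝ≥0∞, A ≤ t → ∫⁻ y in Q ∩ {y | t < vE y}, vE y ≤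
      2 ^ (n + 1) * t * volume (Q ∩ {y | ENNReal.ofReal γ * t < vE y}) := fun t ht =>
    setLIntegral_gt_le_of_good hL hvEm hfin hgood ht
  set μ := (volume : Measure (RSpace n)).restrict Q with hμ
  set ν := μ.withDensity vE with hν
  have hνu : ν univ = ∫⁻ y in Q, vE y := by
    rw [hν, withDensity_apply _ MeasurableSet.univ, Measure.restrict_univ]
  set r := A.toReal with hr
  have hr0 : 0 ≤ r := ENNReal.toReal_nonneg
  -- Truncation makes the left side finite, so that half of it can be absorbed later; monotone
  -- convergence removes it at the end.
  have htrunc : ∀ N : ℕ, ∫⁻ y, ENNReal.ofReal (min (v y) N ^ δ) * vE y ∂μ ≤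
      2 * A ^ δ * ∫⁻ y in Q, vE y := by
    intro N
    set u : RSpace n → ℝ := fun y => min (v y) N with hu
    have hum : Measurable u := hv.min measurable_const
    have hu0 : ∀ y, 0 ≤ u y := fun y => le_min (hv0 y) (Nat.cast_nonneg N)
    set I := ∫⁻ y, ENNReal.ofReal (u y ^ δ) * vE y ∂μ with hI
    have hIfin : I ≠ ⊤ := by
      refine ne_top_of_le_ne_top (ENNReal.mul_ne_top (ENNReal.ofReal_ne_top (r := (N : ℝ) ^ δ))
        hfin) ?_
      rw [← lintegral_const_mul _ hvEm]
      refine lintegral_mono fun y => ?_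
      gcongr
      · exact hu0 y
      · exact min_le_right _ _
    have hIν : I = ∫⁻ y, ENNReal.ofReal (u y ^ δ) ∂ν := by
      rw [hν, lintegral_withDensity_eq_lintegral_mul _ hvEm
        (by fun_prop : Measurable fun y => ENNReal.ofReal (u y ^ δ))]
      exact lintegral_congr fun y => mul_comm _ _
    -- The first term is all of `ν` below the mean `r` and zero above; above the mean the level set
    -- estimate takes over.
    have hpt : ∀ t ∈ Ioi (0 : ℝ), ν {y | t < u y} ≤ ν {_y : RSpace n | t < r} +
        2 ^ (n + 1) * ENNReal.ofReal t * μ {y | t < u y / γ} := by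
      intro t ht
      have ht : 0 < t := ht
      by_cases htr : t < r
      · exact le_trans (measure_mono fun y _ => htr) le_self_add
      · refine le_trans ?_ le_add_self
        by_cases htN : t < N
        · have h1 : ν {y | t < u y} ≤ ∫⁻ y in Q ∩ {y | ENNReal.ofReal t < vE y}, vE y := by
            have hm : MeasurableSet {y | t < u y} := measurableSet_lt measurable_const hum
            rw [hν, withDensity_apply _ hm, hμ, Measure.restrict_restrict hm, inter_comm]
            refine lintegral_mono_set (inter_subset_inter_right _ fun y hy => ?_)
            exact (ENNReal.ofReal_lt_ofReal_iff_of_nonneg ht.le).2 (lt_of_lt_of_le hy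
              (min_le_left _ _))
          have h2 : A ≤ ENNReal.ofReal t := by
            rw [← ENNReal.ofReal_toReal hAtop]
            exact ENNReal.ofReal_le_ofReal (not_lt.1 htr)
          refine (h1.trans (hlevel _ h2)).trans (mul_le_mul' le_rfl ?_)
          rw [hμ, Measure.restrict_apply (measurableSet_lt measurable_const
            (hum.div_const γ)), inter_comm]
          refine measure_mono (inter_subset_inter_left _ fun y hy => ?_)
          change ENNReal.ofReal γ * ENNReal.ofReal t < ENNReal.ofReal (v y) at hy
          change t < u y / γ
          rw [← ENNReal.ofReal_mul hγ.le,
            ENNReal.ofReal_lt_ofReal_iff_of_nonneg (by positivity)] at hy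
          rw [lt_div_iff₀ hγ, mul_comm]
          -- Here `γ ≤ 1` matters: it gives `γ * t ≤ t < N`, so the truncation does not affect the
          -- level `γ * t`.
          refine lt_min hy (lt_of_le_of_lt ?_ htN)
          nlinarith
        · have : {y | t < u y} = ∅ := by
            ext y
            simp only [mem_ofPred_eq, mem_empty_iff_false, iff_false, not_lt]
            exact (min_le_right _ _).trans (not_lt.1 htN)
          rw [this]; simp
    have hconst : ENNReal.ofReal δ *
        ∫⁻ t in Ioi (0 : ℝ), ν {_y : RSpace n | t < r} * ENNReal.ofReal (t ^ (δ - 1))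
        = A ^ δ * ∫⁻ y in Q, vE y := by
      rw [← lintegral_rpow_eq_lintegral_meas_lt_mul ν (f := fun _ => r)
        (Filter.Eventually.of_forall fun _ => hr0) aemeasurable_const hδ, lintegral_const, hνu,
        ← ENNReal.ofReal_rpow_of_nonneg hr0 hδ.le, ENNReal.ofReal_toReal hAtop]
    have hmain : ∫⁻ t in Ioi (0 : ℝ), ENNReal.ofReal t * μ {y | t < u y / γ} *
        ENNReal.ofReal (t ^ (δ - 1)) ≤ ENNReal.ofReal (γ⁻¹ ^ 2) * I := by
      have e1 : ∫⁻ t in Ioi (0 : ℝ), ENNReal.ofReal t * μ {y | t < u y / γ} *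
          ENNReal.ofReal (t ^ (δ - 1)) = ∫⁻ t in Ioi (0 : ℝ), μ {y | t < u y / γ} *
          ENNReal.ofReal (t ^ (1 + δ - 1)) := by
        refine setLIntegral_congr_fun measurableSet_Ioi fun t ht => ?_
        have ht : 0 < t := ht
        rw [mul_comm (ENNReal.ofReal t), mul_assoc, ← ENNReal.ofReal_mul ht.le]
        congr 2
        rw [show 1 + δ - 1 = 1 + (δ - 1) by ring, Real.rpow_add ht, Real.rpow_one]
      rw [e1]
      have h1 : (1 : ℝ≥0∞) ≤ ENNReal.ofReal (1 + δ) := by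
        rw [← ENNReal.ofReal_one]; exact ENNReal.ofReal_le_ofReal (by linarith)
      refine (le_mul_of_one_le_left zero_le h1).trans ?_
      rw [← lintegral_rpow_eq_lintegral_meas_lt_mul μ (f := fun y => u y / γ)
        (Filter.Eventually.of_forall fun y => div_nonneg (hu0 y) hγ.le)
        (hum.div_const γ).aemeasurable (by linarith), hI,
        ← lintegral_const_mul' _ _ ENNReal.ofReal_ne_top]
      refine lintegral_mono fun y => ?_
      simp only [hvE]
      rw [← ENNReal.ofReal_mul (by have := hu0 y; positivity), ← ENNReal.ofReal_mul (by positivity)]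
      refine ENNReal.ofReal_le_ofReal ?_
      rw [div_eq_mul_inv, Real.mul_rpow (hu0 y) (by positivity), mul_comm]
      have hg : 1 ≤ γ⁻¹ := (one_le_inv₀ hγ).2 hγ1
      have e2 : γ⁻¹ ^ (1 + δ) ≤ γ⁻¹ ^ 2 := by
        rw [← Real.rpow_natCast]
        exact Real.rpow_le_rpow_of_exponent_le hg (by push_cast; linarith)
      have e3 : u y ^ (1 + δ) ≤ u y ^ δ * v y := by
        rw [add_comm, Real.rpow_add_one' (hu0 y) (by linarith)]
        exact mul_le_mul_of_nonneg_left (min_le_left _ _) (Real.rpow_nonneg (hu0 y) _)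
      have := hv0 y
      exact mul_le_mul e2 e3 (Real.rpow_nonneg (hu0 y) _) (by positivity)
    -- Integrating the level estimate against `δ t ^ (δ - 1)` leaves the coefficient `δ * 2 ^ (n +
    -- 1) / γ ^ 2` before `I`, and the assumption on `δ` is exactly that this is at most `1 / 2`.
    have hItot : I ≤ A ^ δ * (∫⁻ y in Q, vE y) + ENNReal.ofReal (1 / 2) * I := by
      calc I = ENNReal.ofReal δ *
            ∫⁻ t in Ioi (0 : ℝ), ν {y | t < u y} * ENNReal.ofReal (t ^ (δ - 1)) := by
            rw [hIν]
            exact lintegral_rpow_eq_lintegral_meas_lt_mul ν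
              (Filter.Eventually.of_forall hu0) hum.aemeasurable hδ
        _ ≤ ENNReal.ofReal δ * ∫⁻ t in Ioi (0 : ℝ),
            (ν {_y : RSpace n | t < r} * ENNReal.ofReal (t ^ (δ - 1)) + 2 ^ (n + 1) *
              (ENNReal.ofReal t * μ {y | t < u y / γ} * ENNReal.ofReal (t ^ (δ - 1)))) := by
            refine mul_le_mul' le_rfl (setLIntegral_mono' measurableSet_Ioi fun t ht => ?_)
            refine (mul_le_mul' (hpt t ht) le_rfl).trans (le_of_eq ?_)
            rw [add_mul]; ring
        _ = A ^ δ * (∫⁻ y in Q, vE y) + ENNReal.ofReal δ * (2 ^ (n + 1) *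
            ∫⁻ t in Ioi (0 : ℝ), ENNReal.ofReal t * μ {y | t < u y / γ} *
              ENNReal.ofReal (t ^ (δ - 1))) := by
            rw [lintegral_add_left, mul_add, hconst, lintegral_const_mul' _ _ (by simp)]
            refine Measurable.mul ?_ (by fun_prop)
            have : (fun t : ℝ => ν {_y : RSpace n | t < r})
                = (Iio r).indicator fun _ => ν univ := by
              ext t
              by_cases h : t < r <;> simp [h]
            rw [this]
            exact measurable_const.indicator measurableSet_Iio
        _ ≤ A ^ δ * (∫⁻ y in Q, vE y) + ENNReal.ofReal δ * (2 ^ (n + 1) *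
            (ENNReal.ofReal (γ⁻¹ ^ 2) * I)) := by gcongr
        _ ≤ _ := by
            refine add_le_add le_rfl ?_
            have : (2 : ℝ≥0∞) ^ (n + 1) = ENNReal.ofReal (2 ^ (n + 1)) := by
              rw [ENNReal.ofReal_pow (by norm_num)]; norm_num
            rw [this, ← mul_assoc, ← mul_assoc, ← ENNReal.ofReal_mul hδ.le,
              ← ENNReal.ofReal_mul (by positivity)]
            refine mul_le_mul' (ENNReal.ofReal_le_ofReal ?_) le_rfl
            rw [inv_pow, ← div_eq_mul_inv, div_le_iff₀ (by positivity)]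
            rw [pow_succ] at hδγ
            linarith
    have hsplit : I = ENNReal.ofReal (1 / 2) * I + ENNReal.ofReal (1 / 2) * I := by
      rw [← add_mul, ← ENNReal.ofReal_add (by norm_num) (by norm_num)]; norm_num
    have hhalf : ENNReal.ofReal (1 / 2) * I ≤ A ^ δ * ∫⁻ y in Q, vE y := by
      have hne : ENNReal.ofReal (1 / 2) * I ≠ ⊤ := ENNReal.mul_ne_top ENNReal.ofReal_ne_top hIfin
      refine (ENNReal.add_le_add_iff_right hne).1 ?_
      rw [← hsplit]; exact hItot
    calc I = 2 * (ENNReal.ofReal (1 / 2) * I) := by rw [two_mul, ← hsplit]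
      _ ≤ 2 * (A ^ δ * ∫⁻ y in Q, vE y) := by gcongr
      _ = _ := by rw [mul_assoc]
  calc ∫⁻ y, ENNReal.ofReal (v y ^ (1 + δ)) ∂μ
      ≤ ∫⁻ y, ⨆ N : ℕ, ENNReal.ofReal (min (v y) N ^ δ) * vE y ∂μ := by
        refine lintegral_mono fun y => ?_
        obtain ⟨N, hN⟩ := exists_nat_ge (v y)
        refine le_trans (le_of_eq ?_) (le_iSup _ N)
        rw [min_eq_left hN, hvE, ← ENNReal.ofReal_mul (Real.rpow_nonneg (hv0 y) _), add_comm,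
          Real.rpow_add_one' (hv0 y) (by linarith)]
    _ = ⨆ N : ℕ, ∫⁻ y, ENNReal.ofReal (min (v y) N ^ δ) * vE y ∂μ := by
        refine lintegral_iSup (fun N => by fun_prop) fun N N' hNN' y => ?_
        simp only
        gcongr
        exact le_min (hv0 y) (Nat.cast_nonneg N)
    _ ≤ _ := iSup_le htrunc

end Gehring

/-! ### Logarithmic means, density, and summation over cells. -/

/-- If the logarithm of the mean of `v` is controlled by the mean of `log v`, then `v` is not much
smaller than its mean on at least half of the set. -/
theorem measure_le_two_mul_of_log_mean_le {n : ℕ} {R : Set (RSpace n)} (hR : MeasurableSet R)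
    (hR0 : volume R ≠ 0) (hRt : volume R ≠ ⊤) {v g F : RSpace n → ℝ} (hv : Measurable v)
    (hv0 : ∀ x, 0 < v x) (hg : IntegrableOn g R) (hF : IntegrableOn F R)
    (hgv : ∀ x ∈ R, g x ≤ Real.log (v x) + F x) {A : ℝ≥0∞}
    (hA : A = (∫⁻ y in R, ENNReal.ofReal (v y)) / volume R) {κ c : ℝ} (hκ : 0 ≤ κ) (hc : 0 ≤ c)
    (hlog : A ≤ ENNReal.ofReal (Real.exp (κ + (∫ x in R, g x) / volume.real R)))
    (hFc : ∫ x in R, F x ≤ c * volume.real R) :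
    volume R ≤ 2 * volume {y ∈ R | ENNReal.ofReal (Real.exp (-(2 * (κ + 1 + c)))) * A <
      ENNReal.ofReal (v y)} := by
  set V := volume.real R with hV
  have hVpos : 0 < V := ENNReal.toReal_pos hR0 hRt
  set s := 2 * (κ + 1 + c) with hs
  have hspos : 0 < s := by positivity
  have hAtop : A ≠ ⊤ := ne_top_of_le_ne_top ENNReal.ofReal_ne_top hlog
  have hvint : ∫⁻ y in R, ENNReal.ofReal (v y) ≠ ⊤ := by
    intro h; rw [h, ENNReal.top_div_of_ne_top hRt] at hA; exact hAtop hA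
  have hvI : IntegrableOn v R := by
    refine ⟨hv.aestronglyMeasurable, ?_⟩
    rw [hasFiniteIntegral_iff_ofReal (Filter.Eventually.of_forall fun x => (hv0 x).le)]
    exact lt_top_iff_ne_top.2 hvint
  have hvint' : ∫ x in R, v x = A.toReal * V := by
    rw [integral_eq_lintegral_of_nonneg_ae (Filter.Eventually.of_forall fun x => (hv0 x).le)
      hv.aestronglyMeasurable, hA, hV, measureReal_def, ← ENNReal.toReal_mul,
      ENNReal.div_mul_cancel hR0 hRt]
  have hApos : 0 < A.toReal := by
    refine ENNReal.toReal_pos ?_ hAtop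
    rw [hA]
    refine ENNReal.div_ne_zero.2 ⟨?_, hRt⟩
    rw [← pos_iff_ne_zero, setLIntegral_pos_iff hv.ennreal_ofReal]
    have : (Function.support fun y => ENNReal.ofReal (v y)) = univ := by
      ext y; simpa using hv0 y
    rw [this, univ_inter]
    exact pos_iff_ne_zero.2 hR0
  set a := A.toReal with ha
  have hlog' : Real.log a * V ≤ κ * V + ∫ x in R, g x := by
    have h1 : a ≤ Real.exp (κ + (∫ x in R, g x) / V) :=
      ENNReal.toReal_le_of_le_ofReal (Real.exp_pos _).le hlog
    have h2 := (Real.log_le_iff_le_exp hApos).2 h1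
    have h3 := mul_le_mul_of_nonneg_right h2 hVpos.le
    rwa [add_mul, div_mul_cancel₀ _ hVpos.ne'] at h3
  set E := {y | v y ≤ Real.exp (-s) * a} with hE
  have hEm : MeasurableSet E := measurableSet_le hv measurable_const
  -- On `E`, `log v` falls short of `log a` by at least `s`; elsewhere `log (v / a) ≤ v / a - 1`.
  -- Since `v / a` has mean `1`, integration gives `s |R ∩ E| ≤ (κ + 1 + c) |R|`, which explains the
  -- choice `s = 2 (κ + 1 + c)`.
  have hpt : ∀ x ∈ R, g x + s * E.indicator (fun _ => (1 : ℝ)) x ≤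
      Real.log a + v x / a + F x := by
    intro x hx
    have h1 := hgv x hx
    have h2 : 0 < v x / a := div_pos (hv0 x) hApos
    by_cases hxE : x ∈ E
    · rw [indicator_of_mem hxE]
      have h3 : Real.log (v x) ≤ -s + Real.log a := by
        rw [← Real.log_exp (-s), ← Real.log_mul (Real.exp_pos _).ne' hApos.ne']
        exact Real.log_le_log (hv0 x) hxE
      linarith
    · rw [indicator_of_notMem hxE]
      have h3 := Real.log_le_sub_one_of_pos h2
      rw [Real.log_div (hv0 x).ne' hApos.ne'] at h3
      linarith
  have hind : IntegrableOn (E.indicator fun _ => (1 : ℝ)) R :=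
    (integrableOn_const hRt).indicator hEm
  have hconst : IntegrableOn (fun _ : RSpace n => Real.log a) R := integrableOn_const hRt
  have hint := setIntegral_mono_on (hg.add (hind.const_mul s))
    ((hconst.add (hvI.div_const a)).add hF) hR hpt
  have e1 : ∫ x in R, (g + fun x => s * E.indicator (fun _ => (1 : ℝ)) x) x
      = (∫ x in R, g x) + s * volume.real (R ∩ E) := by
    simp only [Pi.add_apply]
    rw [integral_add hg (hind.const_mul s), integral_const_mul, setIntegral_indicator hEm]
    simp
  have e2 : ∫ x in R, (((fun _ => Real.log a) + fun x => v x / a) + F : RSpace n → ℝ) x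
      = Real.log a * V + V + ∫ x in R, F x := by
    rw [integral_add' (hconst.add (hvI.div_const a)) hF, integral_add' hconst (hvI.div_const a),
      integral_div, hvint', setIntegral_const, smul_eq_mul, ← hV]
    field_simp
  have hint' : (∫ x in R, g x) + s * volume.real (R ∩ E) ≤
      Real.log a * V + V + ∫ x in R, F x := by
    rw [← e1, ← e2]; exact hint
  have hEV : volume.real (R ∩ E) ≤ V / 2 := by
    have : s * volume.real (R ∩ E) ≤ s * (V / 2) := by
      have : s * (V / 2) = (κ + 1 + c) * V := by rw [hs]; ring
      linarith
    exact le_of_mul_le_mul_left this hspos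
  have hgoodset : R \ E ⊆ {y ∈ R | ENNReal.ofReal (Real.exp (-s)) * A < ENNReal.ofReal (v y)} := by
    rintro y ⟨hyR, hyE⟩
    refine ⟨hyR, ?_⟩
    rw [← ENNReal.ofReal_toReal hAtop, ← ENNReal.ofReal_mul (Real.exp_pos _).le,
      ENNReal.ofReal_lt_ofReal_iff (hv0 y)]
    exact not_le.1 hyE
  have hdiff : V / 2 ≤ volume.real (R \ E) := by
    have := measureReal_inter_add_sdiff (μ := volume) (s := R) hEm (h := hRt)
    linarith
  calc volume R = ENNReal.ofReal V := (ENNReal.ofReal_toReal hRt).symm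
    _ = 2 * ENNReal.ofReal (V / 2) := by
      rw [← ENNReal.ofReal_ofNat, ← ENNReal.ofReal_mul (by norm_num)]; congr 1; ring
    _ ≤ 2 * ENNReal.ofReal (volume.real (R \ E)) := by gcongr
    _ = 2 * volume (R \ E) := by
      rw [measureReal_def, ENNReal.ofReal_toReal (ne_top_of_le_ne_top hRt (measure_mono sdiff_subset))]
    _ ≤ _ := by gcongr

/-- Comparison of integrals over a dyadic cell from comparison on its subcells. -/
theorem setLIntegral_dyadic_le_of_cells {n : ℕ} {a : Fin n → ℝ} {L : ℝ} (hL : 0 < L) {k k₀ : ℕ}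
    (hk : k ≤ k₀) {x : RSpace n} {g₁ g₂ : RSpace n → ℝ≥0∞}
    (h : ∀ y ∈ dyadic a L k x,
      ∫⁻ z in dyadic a L k₀ y, g₁ z ≤ ∫⁻ z in dyadic a L k₀ y, g₂ z) :
    ∫⁻ z in dyadic a L k x, g₁ z ≤ ∫⁻ z in dyadic a L k x, g₂ z := by
  let T : Set (Set (RSpace n)) := (fun y => dyadic a L k₀ y) '' dyadic a L k x
  have hTc : T.Countable := countable_range_dyadic.mono (image_subset_range _ _)
  have hTm : ∀ S ∈ T, MeasurableSet S := by
    rintro _ ⟨y, -, rfl⟩; exact measurableSet_dyadic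
  have hTd : T.PairwiseDisjoint id := by
    rintro _ ⟨y, -, rfl⟩ _ ⟨y', -, rfl⟩ hne
    rw [Function.onFun, Set.disjoint_left]
    intro z hz hz'
    exact hne (by simp only [id] at hz hz' ⊢; rw [← dyadic_eq_of_mem hL hz, dyadic_eq_of_mem hL hz'])
  have hU : dyadic a L k x = ⋃ S ∈ T, S := by
    refine Subset.antisymm (fun y hy => mem_biUnion ⟨y, hy, rfl⟩ (self_mem_dyadic hL)) ?_
    refine iUnion₂_subset ?_
    rintro _ ⟨y, hy, rfl⟩
    exact (dyadic_subset hL hk).trans (dyadic_eq_of_mem hL hy).subset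
  rw [hU, lintegral_biUnion hTc hTm hTd, lintegral_biUnion hTc hTm hTd]
  refine ENNReal.tsum_le_tsum ?_
  rintro ⟨_, y, hy, rfl⟩
  exact h y hy

/-! ### Modulars and Luxemburg norms. -/

section VarNorm

variable {n : ℕ} {p : RSpace n → ℝ} {f g : RSpace n → ℝ} {s t : ℝ}

theorem modular_mono (hp : ∀ x, 0 < p x) (ht : 0 < t) (h : ∀ᵐ x, |f x| ≤ |g x|) :
    modular p f t ≤ modular p g t := by
  refine lintegral_mono_ae ?_
  filter_upwards [h] with x hx
  have := (hp x).le
  gcongr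

theorem modular_anti (hp : ∀ x, 0 < p x) (hs : 0 < s) (hst : s ≤ t) :
    modular p f t ≤ modular p f s := by
  refine lintegral_mono fun x => ?_
  have := (hp x).le
  have := hs.trans_le hst
  gcongr

theorem varNorm_le_ofReal (ht : 0 < t) (h : modular p f t ≤ 1) : varNorm p f ≤ ENNReal.ofReal t :=
  iInf_le_of_le t (iInf_le_of_le ht (iInf_le_of_le h le_rfl))

theorem modular_le_one_of_varNorm_lt (hp : ∀ x, 0 < p x) (h : varNorm p f < ENNReal.ofReal t) :
    modular p f t ≤ 1 := by
  simp only [varNorm, iInf_lt_iff] at h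
  obtain ⟨s, hs, hm, hst⟩ := h
  exact (modular_anti hp hs (ENNReal.ofReal_lt_ofReal_iff'.1 hst).1.le).trans hm

theorem varNorm_mono (hp : ∀ x, 0 < p x) (h : ∀ᵐ x, |f x| ≤ |g x|) :
    varNorm p f ≤ varNorm p g :=
  iInf_mono fun _ => iInf_mono fun ht => iInf_mono' fun hm =>
    ⟨(modular_mono hp ht h).trans hm, le_rfl⟩

theorem varNorm_congr (h : f =ᵐ[volume] g) : varNorm p f = varNorm p g := by
  have : modular p f = modular p g := by
    ext t
    refine lintegral_congr_ae ?_
    filter_upwards [h] with x hx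
    rw [hx]
  simp only [varNorm, this]

theorem varNorm_const_mul_le {c : ℝ} (hc : 0 < c) :
    varNorm p (fun x => c * f x) ≤ ENNReal.ofReal c * varNorm p f := by
  have hc0 : ENNReal.ofReal c ≠ 0 := by simpa using hc
  simp only [varNorm]
  simp only [ENNReal.mul_iInf_of_ne hc0 ENNReal.ofReal_ne_top]
  refine le_iInf fun t => le_iInf fun ht => le_iInf fun hm => ?_
  rw [← ENNReal.ofReal_mul hc.le]
  refine varNorm_le_ofReal (mul_pos hc ht) (le_trans (le_of_eq ?_) hm)
  refine lintegral_congr fun x => ?_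
  rw [abs_mul, abs_of_pos hc, mul_div_mul_left _ _ hc.ne']

theorem modular_indicator (hp : ∀ x, 0 < p x) {R : Set (RSpace n)} (hR : MeasurableSet R)
    (hf : ∀ x, 0 ≤ f x) :
    modular p (R.indicator f) t = ∫⁻ x in R, ENNReal.ofReal ((f x / t) ^ p x) := by
  rw [← lintegral_indicator hR, modular]
  refine lintegral_congr fun x => ?_
  by_cases hx : x ∈ R
  · simp [hx, abs_of_nonneg (hf x)]
  · simp [hx, Real.zero_rpow (hp x).ne']

/-- At `2 * N`, strictly above the infimum, the modular is at most `1`; rescaling costs `2 ^ P`.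
Accepting this factor avoids deciding whether the infimum is attained. The companion
`one_le_modular_varNorm` argues in the same way at `N / 2`. -/
theorem modular_varNorm_le {P : ℝ} (hp : ∀ x, 0 < p x) (hP : ∀ x, p x ≤ P) {N : ℝ} (hN : 0 < N)
    (h : varNorm p f = ENNReal.ofReal N) : modular p f N ≤ ENNReal.ofReal (2 ^ P) := by
  have h1 : modular p f (2 * N) ≤ 1 := modular_le_one_of_varNorm_lt hp (by
    rw [h]; exact (ENNReal.ofReal_lt_ofReal_iff (by positivity)).2 (by linarith))
  calc modular p f N ≤ ∫⁻ x, ENNReal.ofReal (2 ^ P) * ENNReal.ofReal ((|f x| / (2 * N)) ^ p x) := by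
        refine lintegral_mono fun x => ?_
        rw [← ENNReal.ofReal_mul (by positivity)]
        refine ENNReal.ofReal_le_ofReal ?_
        have : |f x| / N = 2 * (|f x| / (2 * N)) := by field_simp
        rw [this, Real.mul_rpow (by norm_num) (by positivity)]
        gcongr
        · norm_num
        · exact hP x
    _ = ENNReal.ofReal (2 ^ P) * modular p f (2 * N) :=
        lintegral_const_mul' _ _ ENNReal.ofReal_ne_top
    _ ≤ ENNReal.ofReal (2 ^ P) * 1 := by gcongr
    _ = _ := mul_one _

theorem one_le_modular_varNorm {P : ℝ} (hP : ∀ x, p x ≤ P) {N : ℝ} (hN : 0 < N)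
    (h : varNorm p f = ENNReal.ofReal N) : 1 ≤ ENNReal.ofReal (2 ^ P) * modular p f N := by
  have h1 : 1 < modular p f (N / 2) := by
    by_contra hcon
    have h2 := varNorm_le_ofReal (half_pos hN) (not_lt.1 hcon)
    rw [h, ENNReal.ofReal_le_ofReal_iff (by positivity)] at h2
    linarith
  refine h1.le.trans ?_
  rw [modular, modular, ← lintegral_const_mul' _ _ ENNReal.ofReal_ne_top]
  refine lintegral_mono fun x => ?_
  rw [← ENNReal.ofReal_mul (by positivity)]
  refine ENNReal.ofReal_le_ofReal ?_
  have : |f x| / (N / 2) = 2 * (|f x| / N) := by field_simp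
  rw [this, Real.mul_rpow (by norm_num) (by positivity)]
  gcongr
  · norm_num
  · exact hP x

/-- Enlarging `t` by `b = C ^ (1 / pm) ≥ 1` multiplies the integrand by `b ^ (-p x) ≤ b ^ (-pm) = 1
/ C`. -/
theorem varNorm_le_of_modular_le {pm C : ℝ} (hpm : 0 < pm) (hp : ∀ x, pm ≤ p x) (ht : 0 < t)
    (hC : 1 ≤ C) (h : modular p f t ≤ ENNReal.ofReal C) :
    varNorm p f ≤ ENNReal.ofReal (C ^ (1 / pm) * t) := by
  have hC0 : 0 < C := by linarith
  set b := C ^ (1 / pm) with hb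
  have hb1 : 1 ≤ b := Real.one_le_rpow hC (by positivity)
  have hb0 : 0 < b := by linarith
  have hbpm : b ^ pm = C := by
    rw [hb, ← Real.rpow_mul hC0.le, one_div_mul_cancel hpm.ne', Real.rpow_one]
  refine varNorm_le_ofReal (by positivity) ?_
  calc modular p f (b * t) ≤ ∫⁻ x, ENNReal.ofReal C⁻¹ * ENNReal.ofReal ((|f x| / t) ^ p x) := by
        refine lintegral_mono fun x => ?_
        rw [← ENNReal.ofReal_mul (by positivity)]
        refine ENNReal.ofReal_le_ofReal ?_
        have : |f x| / (b * t) = b⁻¹ * (|f x| / t) := by field_simp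
        rw [this, Real.mul_rpow (by positivity) (by positivity), ← hbpm, Real.inv_rpow hb0.le]
        gcongr
        exact hp x
    _ = ENNReal.ofReal C⁻¹ * modular p f t := lintegral_const_mul' _ _ ENNReal.ofReal_ne_top
    _ ≤ ENNReal.ofReal C⁻¹ * ENNReal.ofReal C := by gcongr
    _ = 1 := by rw [← ENNReal.ofReal_mul (by positivity), inv_mul_cancel₀ hC0.ne']; simp

end VarNorm

/-! ### Log-Hölder exponents and the exchange of exponents. -/

/-- Exponents with values in `[pm, P]` that are log-Hölder continuous on boxes of edge length at
most `1` and at infinity, with limit `pinf ∈ [pm, P]`. -/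
structure LogHolderClass {n : ℕ} (pm P Cd Ci : ℝ) (p : RSpace n → ℝ) (pinf : ℝ) : Prop where
  measurable : Measurable p
  pm_pos : 0 < pm
  Cd_nonneg : 0 ≤ Cd
  Ci_nonneg : 0 ≤ Ci
  lower : ∀ x, pm ≤ p x
  upper : ∀ x, p x ≤ P
  pm_le : pm ≤ pinf
  le_P : pinf ≤ P
  osc : ∀ (a : Fin n → ℝ) (l : ℝ), 0 < l → l ≤ 1 → ∀ x ∈ box a l, ∀ y ∈ box a l,
    |p x - p y| * (-Real.log l) ≤ Cd
  decay : ∀ x, |p x - pinf| * Real.log (Real.exp 1 + ‖x‖) ≤ Ci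

/-- The integrable weight `(e + |x|)^{-(n+1)}`. -/
noncomputable def decayWeight {n : ℕ} (x : RSpace n) : ℝ :=
  (Real.exp 1 + ‖x‖) ^ (-((n : ℝ) + 1))

theorem decayWeight_pos {n : ℕ} (x : RSpace n) : 0 < decayWeight x := by
  unfold decayWeight; positivity

theorem measurable_decayWeight {n : ℕ} : Measurable (decayWeight (n := n)) := by
  unfold decayWeight; fun_prop

theorem exists_lintegral_decayWeight_le (n : ℕ) : ∃ H : ℝ, 1 ≤ H ∧
    ∫⁻ x : RSpace n, ENNReal.ofReal (decayWeight x) ≤ ENNReal.ofReal H := by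
  have hi : Integrable (fun x : RSpace n => (1 + ‖x‖) ^ (-((n : ℝ) + 1))) :=
    integrable_one_add_norm (by simp)
  have hn : (0 : ℝ) ≤ n := Nat.cast_nonneg n
  have h1 : ∀ x : RSpace n, decayWeight x ≤ (1 + ‖x‖) ^ (-((n : ℝ) + 1)) := by
    intro x
    unfold decayWeight
    refine Real.rpow_le_rpow_of_nonpos (by positivity) ?_ (by linarith)
    have := Real.add_one_le_exp 1
    linarith
  have h2 : ∫⁻ x : RSpace n, ENNReal.ofReal (decayWeight x) ≠ ⊤ := by
    have h3 := hi.lintegral_lt_top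
    exact ne_top_of_le_ne_top h3.ne (lintegral_mono fun x => ENNReal.ofReal_le_ofReal (h1 x))
  refine ⟨max 1 (∫⁻ x : RSpace n, ENNReal.ofReal (decayWeight x)).toReal, le_max_left _ _, ?_⟩
  rw [← ENNReal.ofReal_toReal h2]
  exact ENNReal.ofReal_le_ofReal (by rw [ENNReal.ofReal_toReal h2]; exact le_max_right _ _)

/-- Within such a box `|x|` varies by at most `√n`, while `e + |x| ≥ 1`. The weight can therefore be
treated as constant on cells. -/
theorem exists_decayWeight_le_mul (n : ℕ) : ∃ C : ℝ, 1 ≤ C ∧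
    ∀ (a : Fin n → ℝ) (l : ℝ), 0 < l → l ≤ 1 → ∀ x ∈ box a l, ∀ y ∈ box a l,
      decayWeight x ≤ C * decayWeight y := by
  have hn : (0 : ℝ) ≤ n := Nat.cast_nonneg n
  refine ⟨(1 + √n) ^ ((n : ℝ) + 1), Real.one_le_rpow (by simp) (by linarith),
    fun a l hl hl1 x hx y hy => ?_⟩
  have hd : dist y x ≤ √n * l := dist_le_of_mem_coord_Icc hl.le
    (fun i => Ico_subset_Icc_self (hy i)) (fun i => Ico_subset_Icc_self (hx i))
  have h1 : ‖y‖ ≤ ‖x‖ + √n := by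
    have h2 : ‖y‖ ≤ ‖x‖ + dist y x := by
      rw [dist_eq_norm]; linarith [norm_le_norm_add_norm_sub' y x]
    have h3 : √n * l ≤ √n := mul_le_of_le_one_right (Real.sqrt_nonneg _) hl1
    linarith
  have he : 1 ≤ Real.exp 1 + ‖x‖ := by
    have := Real.add_one_le_exp 1
    have := norm_nonneg x
    linarith
  have h4 : Real.exp 1 + ‖y‖ ≤ (1 + √n) * (Real.exp 1 + ‖x‖) := by
    nlinarith [Real.sqrt_nonneg (n : ℝ)]
  unfold decayWeight
  rw [Real.rpow_neg (by positivity), Real.rpow_neg (by positivity), ← div_eq_mul_inv,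
    le_div_iff₀ (by positivity), mul_comm, ← div_eq_mul_inv, div_le_iff₀ (by positivity),
    ← Real.mul_rpow (by positivity) (by positivity)]
  gcongr

namespace LogHolderClass

variable {n : ℕ} {pm P Cd Ci : ℝ} {p : RSpace n → ℝ} {pinf : ℝ}

theorem pos (h : LogHolderClass pm P Cd Ci p pinf) (x : RSpace n) : 0 < p x :=
  h.pm_pos.trans_le (h.lower x)

theorem pinf_pos (h : LogHolderClass pm P Cd Ci p pinf) : 0 < pinf := h.pm_pos.trans_le h.pm_le

theorem P_pos (h : LogHolderClass pm P Cd Ci p pinf) : 0 < P := h.pinf_pos.trans_le h.le_P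

theorem abs_sub_le (h : LogHolderClass pm P Cd Ci p pinf) (x y : RSpace n) : |p x - p y| ≤ P := by
  have h1 := h.upper x; have h2 := h.upper y; have h3 := h.pos x; have h4 := h.pos y
  rw [abs_le]; constructor <;> linarith

/-- The doubled parameters do not depend on `r`, so every estimate for `p` also holds for `r * p`
uniformly in `r ∈ [1, 2]`. -/
theorem const_mul (h : LogHolderClass pm P Cd Ci p pinf) {r : ℝ} (hr : 1 ≤ r) (hr2 : r ≤ 2) :
    LogHolderClass pm (2 * P) (2 * Cd) (2 * Ci) (fun x => r * p x) (r * pinf) where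
  measurable := h.measurable.const_mul r
  pm_pos := h.pm_pos
  Cd_nonneg := by linarith [h.Cd_nonneg]
  Ci_nonneg := by linarith [h.Ci_nonneg]
  lower x := by nlinarith [h.lower x, h.pos x]
  upper x := by nlinarith [h.upper x, h.pos x]
  pm_le := by nlinarith [h.pm_le, h.pinf_pos]
  le_P := by nlinarith [h.le_P, h.pinf_pos]
  osc a l hl hl1 x hx y hy := by
    have h1 := h.osc a l hl hl1 x hx y hy
    have h2 : 0 ≤ |p x - p y| * (-Real.log l) :=
      mul_nonneg (abs_nonneg _) (by linarith [Real.log_nonpos hl.le hl1])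
    rw [← mul_sub, abs_mul, abs_of_nonneg (by linarith), mul_assoc]
    nlinarith
  decay x := by
    have h1 := h.decay x
    have h2 : 0 ≤ |p x - pinf| * Real.log (Real.exp 1 + ‖x‖) := by
      refine mul_nonneg (abs_nonneg _) (Real.log_nonneg ?_)
      have := Real.add_one_le_exp 1
      have := norm_nonneg x
      linarith
    rw [← mul_sub, abs_mul, abs_of_nonneg (by linarith), mul_assoc]
    nlinarith

/-- The quotient is `exp (log t * (p x - p y))`. The part of `|log t|` proportional to `-log l` is
absorbed by the oscillation bound `Cd`, the bounded part by `|p x - p y| ≤ P`. -/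
theorem rpow_le_of_mem_box (h : LogHolderClass pm P Cd Ci p pinf) {a : Fin n → ℝ} {l : ℝ}
    (hl : 0 < l) (hl1 : l ≤ 1) {x y : RSpace n} (hx : x ∈ box a l) (hy : y ∈ box a l)
    {t A B : ℝ} (ht : 0 < t) (hA : 0 ≤ A) (hB : 0 ≤ B)
    (hlog : |Real.log t| ≤ A * (-Real.log l) + B) :
    t ^ p x ≤ Real.exp (A * Cd + B * P) * t ^ p y := by
  rw [Real.rpow_def_of_pos ht, Real.rpow_def_of_pos ht, ← Real.exp_add]
  refine Real.exp_le_exp.2 ?_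
  have h1 := h.osc a l hl hl1 x hx y hy
  have h2 := h.abs_sub_le x y
  have h3 : Real.log t * (p x - p y) ≤ |Real.log t| * |p x - p y| := by
    rw [← abs_mul]; exact le_abs_self _
  have h4 : |Real.log t| * |p x - p y| ≤ (A * (-Real.log l) + B) * |p x - p y| := by gcongr
  have h5 := mul_le_mul_of_nonneg_left h1 hA
  have h6 := mul_le_mul_of_nonneg_left h2 hB
  nlinarith

/-- Let `Λ = log (e + |x|)` and `N = (n + 1) / pm`. If `log s ≥ -N Λ`, then `|log s|` is at most a
multiple of `Λ` and the decay condition bounds `s ^ (p x - pinf)` from both sides. Otherwise `s` is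
so small that `s ^ q ≤ exp (-N pm Λ) = decayWeight x` for every `q ≥ pm`. -/
theorem rpow_compare (h : LogHolderClass pm P Cd Ci p pinf) {B : ℝ} (hB : 1 ≤ B) {s : ℝ}
    (hs : 0 < s) (hsB : s ≤ B) (x : RSpace n) :
    s ^ pinf ≤ Real.exp ((((n : ℝ) + 1) / pm + Real.log B) * Ci) * (s ^ p x + decayWeight x) ∧
    s ^ p x ≤ Real.exp ((((n : ℝ) + 1) / pm + Real.log B) * Ci) * (s ^ pinf + decayWeight x) := by
  have hpm := h.pm_pos
  have hn : (0 : ℝ) ≤ n := Nat.cast_nonneg n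
  set N := ((n : ℝ) + 1) / pm with hN
  have hN0 : 0 < N := by positivity
  set Λ := Real.log (Real.exp 1 + ‖x‖) with hΛ
  have hΛ1 : 1 ≤ Λ := by
    rw [hΛ, Real.le_log_iff_exp_le (by positivity)]; linarith [norm_nonneg x]
  have hlB : 0 ≤ Real.log B := Real.log_nonneg hB
  have hCi := h.Ci_nonneg
  have hC1 : 1 ≤ Real.exp ((N + Real.log B) * Ci) := Real.one_le_exp (by positivity)
  have hdec := h.decay x
  rw [← hΛ] at hdec
  have hw := decayWeight_pos x
  have hdw : decayWeight x = Real.exp (-(((n : ℝ) + 1) * Λ)) := by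
    rw [decayWeight, Real.rpow_def_of_pos (by positivity), ← hΛ]; congr 1; ring
  by_cases hcase : -(N * Λ) ≤ Real.log s
  · have hls : Real.log s ≤ Real.log B := Real.log_le_log hs hsB
    have habs : |Real.log s| ≤ (N + Real.log B) * Λ := by
      rw [abs_le]
      constructor <;> nlinarith
    have hprod : |Real.log s| * |p x - pinf| ≤ (N + Real.log B) * Ci := by
      calc |Real.log s| * |p x - pinf| ≤ (N + Real.log B) * Λ * |p x - pinf| := by gcongr
        _ = (N + Real.log B) * (|p x - pinf| * Λ) := by ring
        _ ≤ _ := by gcongr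
    have h1 : Real.log s * (p x - pinf) ≤ (N + Real.log B) * Ci :=
      (le_abs_self _).trans (by rw [abs_mul]; exact hprod)
    have h2 : -(Real.log s * (p x - pinf)) ≤ (N + Real.log B) * Ci :=
      (neg_le_abs _).trans (by rw [abs_mul]; exact hprod)
    constructor
    · refine le_trans ?_ (mul_le_mul_of_nonneg_left (le_add_of_nonneg_right hw.le) (by positivity))
      rw [Real.rpow_def_of_pos hs, Real.rpow_def_of_pos hs, ← Real.exp_add]
      exact Real.exp_le_exp.2 (by linarith)
    · refine le_trans ?_ (mul_le_mul_of_nonneg_left (le_add_of_nonneg_right hw.le) (by positivity))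
      rw [Real.rpow_def_of_pos hs, Real.rpow_def_of_pos hs, ← Real.exp_add]
      exact Real.exp_le_exp.2 (by linarith)
  · have hcase := not_le.1 hcase
    have hsmall : ∀ q, pm ≤ q → s ^ q ≤ decayWeight x := by
      intro q hq
      rw [hdw, Real.rpow_def_of_pos hs]
      refine Real.exp_le_exp.2 ?_
      have h1 : N * pm = n + 1 := by rw [hN]; field_simp
      have h2 : 0 ≤ N * Λ := by positivity
      nlinarith
    constructor
    · have h1 := hsmall _ h.pm_le
      have h2 : 0 < s ^ p x := by positivity
      nlinarith
    · have h1 := hsmall _ (h.lower x)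
      have h2 : 0 < s ^ pinf := by positivity
      nlinarith

end LogHolderClass

/-! ### Norms of indicators of small and large boxes. -/

theorem setLIntegral_ofReal_const {n : ℕ} {a : Fin n → ℝ} {l : ℝ} (hl : 0 < l) {c : ℝ}
    (hc : 0 ≤ c) : ∫⁻ _x in box a l, ENNReal.ofReal c = ENNReal.ofReal (c * l ^ n) := by
  rw [setLIntegral_const, volume_box a hl, ENNReal.ofReal_mul hc]

/-- The norm `‖1_R‖_{p(·)}` as a real number. -/
noncomputable def indNorm {n : ℕ} (p : RSpace n → ℝ) (R : Set (RSpace n)) : ℝ :=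
  (varNorm p (R.indicator fun _ => (1 : ℝ))).toReal

theorem indNorm_nonneg {n : ℕ} (p : RSpace n → ℝ) (R : Set (RSpace n)) : 0 ≤ indNorm p R :=
  ENNReal.toReal_nonneg

/-- The constant comparing `‖1_R‖_{p(·)} ^ p(x)` with the volume of a small box. -/
noncomputable def boxConst (n : ℕ) (pm P Cd : ℝ) : ℝ := 2 ^ P * Real.exp (n / pm * Cd)

namespace LogHolderClass

variable {n : ℕ} {pm P Cd Ci : ℝ} {p : RSpace n → ℝ} {pinf : ℝ}

theorem one_le_boxConst (h : LogHolderClass pm P Cd Ci p pinf) : 1 ≤ boxConst n pm P Cd := by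
  have h1 : (1 : ℝ) ≤ 2 ^ P := Real.one_le_rpow (by norm_num) h.P_pos.le
  have h2 : 1 ≤ Real.exp (n / pm * Cd) := Real.one_le_exp (by
    have := h.pm_pos; have := h.Cd_nonneg; positivity)
  unfold boxConst
  nlinarith

theorem modular_one (h : LogHolderClass pm P Cd Ci p pinf) (a : Fin n → ℝ) (l s : ℝ) :
    modular p ((box a l).indicator fun _ => (1 : ℝ)) s =
      ∫⁻ x in box a l, ENNReal.ofReal ((1 / s) ^ p x) :=
  modular_indicator h.pos (measurableSet_box a l) fun _ => zero_le_one

theorem varNorm_one_le_one (h : LogHolderClass pm P Cd Ci p pinf) (a : Fin n → ℝ) {l : ℝ}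
    (hl : 0 < l) (hl1 : l ≤ 1) : varNorm p ((box a l).indicator fun _ => (1 : ℝ)) ≤ 1 := by
  rw [← ENNReal.ofReal_one]
  refine varNorm_le_ofReal one_pos ?_
  rw [h.modular_one]
  simp only [div_one, Real.one_rpow]
  rw [setLIntegral_ofReal_const hl zero_le_one, one_mul, ← ENNReal.ofReal_one]
  exact ENNReal.ofReal_le_ofReal (pow_le_one₀ hl.le hl1)

/-- For a smaller `t` one has `t ≤ 1`, so the modular is at least `t ^ (-pm) * l ^ n > 1`. This
crude power bound is what makes `|log ‖1_R‖|` comparable to `-log l`, the form needed to freeze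
exponents. -/
theorem rpow_le_varNorm_one (h : LogHolderClass pm P Cd Ci p pinf) (a : Fin n → ℝ) {l : ℝ}
    (hl : 0 < l) (hl1 : l ≤ 1) :
    ENNReal.ofReal (l ^ ((n : ℝ) / pm)) ≤ varNorm p ((box a l).indicator fun _ => (1 : ℝ)) := by
  have hpm := h.pm_pos
  refine le_iInf fun t => le_iInf fun ht => le_iInf fun hm => ?_
  refine ENNReal.ofReal_le_ofReal ?_
  by_contra hcon
  have hcon := not_le.1 hcon
  have ht1 : t ≤ 1 := hcon.le.trans (Real.rpow_le_one hl.le hl1 (by positivity))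
  have h1 : 1 < l ^ n * (1 / t) ^ pm := by
    have h2 : t ^ pm < l ^ n := by
      calc t ^ pm < (l ^ ((n : ℝ) / pm)) ^ pm := Real.rpow_lt_rpow ht.le hcon hpm
        _ = l ^ n := by
          rw [← Real.rpow_mul hl.le, div_mul_cancel₀ _ hpm.ne', Real.rpow_natCast]
    rw [Real.div_rpow zero_le_one ht.le, Real.one_rpow, mul_one_div, one_lt_div (by positivity)]
    exact h2
  have h2 : ENNReal.ofReal ((1 / t) ^ pm * l ^ n) ≤ 1 := by
    rw [← setLIntegral_ofReal_const (a := a) hl (by positivity)]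
    refine le_trans (lintegral_mono fun x => ENNReal.ofReal_le_ofReal ?_)
      ((h.modular_one a l t).symm.le.trans hm)
    exact Real.rpow_le_rpow_of_exponent_le ((one_le_div ht).2 ht1) (h.lower x)
  rw [ENNReal.ofReal_le_one] at h2
  linarith

theorem indNorm_small (h : LogHolderClass pm P Cd Ci p pinf) (a : Fin n → ℝ) {l : ℝ}
    (hl : 0 < l) (hl1 : l ≤ 1) :
    varNorm p ((box a l).indicator fun _ => (1 : ℝ)) = ENNReal.ofReal (indNorm p (box a l)) ∧
    l ^ ((n : ℝ) / pm) ≤ indNorm p (box a l) ∧ indNorm p (box a l) ≤ 1 := by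
  have h1 := h.varNorm_one_le_one a hl hl1
  have h2 := h.rpow_le_varNorm_one a hl hl1
  have hne : varNorm p ((box a l).indicator fun _ => (1 : ℝ)) ≠ ⊤ :=
    ne_top_of_le_ne_top ENNReal.one_ne_top h1
  have he : varNorm p ((box a l).indicator fun _ => (1 : ℝ)) =
    ENNReal.ofReal (indNorm p (box a l)) := (ENNReal.ofReal_toReal hne).symm
  refine ⟨he, ?_, ?_⟩
  · rwa [he, ENNReal.ofReal_le_ofReal_iff (indNorm_nonneg _ _)] at h2
  · rwa [he, ENNReal.ofReal_le_one] at h1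

theorem indNorm_small_pos (h : LogHolderClass pm P Cd Ci p pinf) (a : Fin n → ℝ) {l : ℝ}
    (hl : 0 < l) (hl1 : l ≤ 1) : 0 < indNorm p (box a l) :=
  (Real.rpow_pos_of_pos hl _).trans_le (h.indNorm_small a hl hl1).2.1

theorem abs_log_indNorm_le (h : LogHolderClass pm P Cd Ci p pinf) (a : Fin n → ℝ) {l : ℝ}
    (hl : 0 < l) (hl1 : l ≤ 1) :
    |Real.log (indNorm p (box a l))| ≤ n / pm * (-Real.log l) := by
  obtain ⟨-, h2, h3⟩ := h.indNorm_small a hl hl1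
  have h4 := Real.log_le_log (Real.rpow_pos_of_pos hl _) h2
  rw [Real.log_rpow hl] at h4
  rw [abs_of_nonpos (Real.log_nonpos (h.indNorm_small_pos a hl hl1).le h3)]
  linarith

/-- The modular of `1_R` at its norm `t` is about `1`, and freezing the exponent at `y` turns it
into `t ^ (-p y) * l ^ n` up to constants. -/
theorem indNorm_rpow_small (h : LogHolderClass pm P Cd Ci p pinf) (a : Fin n → ℝ) {l : ℝ}
    (hl : 0 < l) (hl1 : l ≤ 1) {y : RSpace n} (hy : y ∈ box a l) :
    indNorm p (box a l) ^ p y ≤ boxConst n pm P Cd * l ^ n ∧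
    l ^ n ≤ boxConst n pm P Cd * indNorm p (box a l) ^ p y := by
  obtain ⟨he, -, -⟩ := h.indNorm_small a hl hl1
  have htpos := h.indNorm_small_pos a hl hl1
  set t := indNorm p (box a l) with ht
  have hpm := h.pm_pos
  have hinv : |Real.log (1 / t)| ≤ n / pm * (-Real.log l) + 0 := by
    rw [one_div, Real.log_inv, abs_neg, add_zero]; exact h.abs_log_indNorm_le a hl hl1
  have hA : (0 : ℝ) ≤ n / pm := by positivity
  have hosc : ∀ x ∈ box a l, ∀ z ∈ box a l,
      (1 / t) ^ p x ≤ Real.exp (n / pm * Cd) * (1 / t) ^ p z := by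
    intro x hx z hz
    have := h.rpow_le_of_mem_box hl hl1 hx hz (one_div_pos.2 htpos) hA le_rfl hinv
    simpa using this
  have hy' : (1 / t) ^ p y = (t ^ p y)⁻¹ := by rw [one_div, Real.inv_rpow htpos.le]
  have htp : 0 < t ^ p y := by positivity
  set E := Real.exp (n / pm * Cd) with hE
  have hE0 : 0 < E := Real.exp_pos _
  have hup := modular_varNorm_le h.pos h.upper htpos he
  have hlo := one_le_modular_varNorm h.upper htpos he
  rw [h.modular_one] at hup hlo
  constructor
  · have h1 : (1 : ℝ≥0∞) ≤ ENNReal.ofReal (2 ^ P) * ENNReal.ofReal (E * (1 / t) ^ p y * l ^ n) := by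
      refine hlo.trans ?_
      gcongr
      rw [← setLIntegral_ofReal_const (a := a) hl (by positivity)]
      exact setLIntegral_mono' (measurableSet_box a l) fun x hx =>
        ENNReal.ofReal_le_ofReal (hosc x hx y hy)
    rw [← ENNReal.ofReal_mul (by positivity), ENNReal.one_le_ofReal, hy'] at h1
    have h2 : 2 ^ P * (E * (t ^ p y)⁻¹ * l ^ n) = (2 ^ P * E * l ^ n) / t ^ p y := by
      field_simp
    rw [h2, le_div_iff₀ htp, one_mul] at h1
    exact h1
  · have h1 : ENNReal.ofReal ((1 / t) ^ p y / E * l ^ n) ≤ ENNReal.ofReal (2 ^ P) := by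
      refine le_trans ?_ hup
      rw [← setLIntegral_ofReal_const (a := a) hl (by positivity)]
      refine setLIntegral_mono' (measurableSet_box a l) fun x hx =>
        ENNReal.ofReal_le_ofReal ?_
      rw [div_le_iff₀ hE0, mul_comm]
      exact hosc y hy x hx
    rw [ENNReal.ofReal_le_ofReal_iff (by positivity), hy'] at h1
    have h2 : (t ^ p y)⁻¹ / E * l ^ n = l ^ n / (E * t ^ p y) := by
      field_simp
    rw [h2, div_le_iff₀ (by positivity)] at h1
    unfold boxConst
    linarith

/-- Dividing `w` by `N / t` instead of `N` multiplies the modular integrand by `t ^ p x`, which is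
about `l ^ n`. Thus the normalized weight has mean of order `1` when raised to `p`. -/
theorem lintegral_normalized_small (h : LogHolderClass pm P Cd Ci p pinf) (a : Fin n → ℝ) {l : ℝ}
    (hl : 0 < l) (hl1 : l ≤ 1) {w : RSpace n → ℝ} (hw : ∀ x, 0 ≤ w x) {N : ℝ} (hN : 0 < N)
    (hwN : varNorm p ((box a l).indicator w) = ENNReal.ofReal N) :
    ∫⁻ x in box a l, ENNReal.ofReal ((w x / (N / indNorm p (box a l))) ^ p x) ≤
      ENNReal.ofReal (2 ^ P * boxConst n pm P Cd * l ^ n) ∧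
    ENNReal.ofReal (l ^ n) ≤ ENNReal.ofReal (2 ^ P * boxConst n pm P Cd) *
      ∫⁻ x in box a l, ENNReal.ofReal ((w x / (N / indNorm p (box a l))) ^ p x) := by
  have htpos := h.indNorm_small_pos a hl hl1
  set t := indNorm p (box a l) with ht
  have hC := h.one_le_boxConst
  set C := boxConst n pm P Cd with hCdef
  have hup := modular_varNorm_le h.pos h.upper hN hwN
  have hlo := one_le_modular_varNorm h.upper hN hwN
  rw [modular_indicator h.pos (measurableSet_box a l) hw] at hup hlo
  have hpt : ∀ x, (w x / (N / t)) ^ p x = t ^ p x * (w x / N) ^ p x := by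
    intro x
    rw [← Real.mul_rpow htpos.le (div_nonneg (hw x) hN.le)]
    congr 1
    field_simp
  simp only [hpt]
  constructor
  · calc ∫⁻ x in box a l, ENNReal.ofReal (t ^ p x * (w x / N) ^ p x)
        ≤ ∫⁻ x in box a l, ENNReal.ofReal (C * l ^ n) * ENNReal.ofReal ((w x / N) ^ p x) := by
          refine setLIntegral_mono' (measurableSet_box a l) fun x hx => ?_
          rw [← ENNReal.ofReal_mul (by positivity)]
          have := div_nonneg (hw x) hN.le
          have h1 := (h.indNorm_rpow_small a hl hl1 hx).1
          gcongr
      _ = ENNReal.ofReal (C * l ^ n) * ∫⁻ x in box a l, ENNReal.ofReal ((w x / N) ^ p x) :=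
          lintegral_const_mul' _ _ ENNReal.ofReal_ne_top
      _ ≤ ENNReal.ofReal (C * l ^ n) * ENNReal.ofReal (2 ^ P) := by gcongr
      _ = _ := by rw [← ENNReal.ofReal_mul (by positivity)]; congr 1; ring
  · calc ENNReal.ofReal (l ^ n)
        ≤ ENNReal.ofReal (l ^ n) * (ENNReal.ofReal (2 ^ P) *
          ∫⁻ x in box a l, ENNReal.ofReal ((w x / N) ^ p x)) := le_mul_of_one_le_right zero_le hlo
      _ = ENNReal.ofReal (2 ^ P) *
          ∫⁻ x in box a l, ENNReal.ofReal (l ^ n) * ENNReal.ofReal ((w x / N) ^ p x) := by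
          rw [lintegral_const_mul' _ _ ENNReal.ofReal_ne_top]; ring
      _ ≤ ENNReal.ofReal (2 ^ P) *
          ∫⁻ x in box a l, ENNReal.ofReal C * ENNReal.ofReal (t ^ p x * (w x / N) ^ p x) := by
          refine mul_le_mul' le_rfl (setLIntegral_mono' (measurableSet_box a l) fun x hx => ?_)
          have h0 := div_nonneg (hw x) hN.le
          rw [← ENNReal.ofReal_mul (by positivity), ← ENNReal.ofReal_mul (by positivity),
            ← mul_assoc]
          have h1 := (h.indNorm_rpow_small a hl hl1 hx).2
          gcongr
      _ = _ := by
          rw [lintegral_const_mul' _ _ ENNReal.ofReal_ne_top, ENNReal.ofReal_mul (by positivity),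
            mul_assoc]

end LogHolderClass

/-- Both norms to be compared are at least `1`, so their inverses are at most `1` and `p x` may be
exchanged for `pinf`. The error integrates to a constant, and with exponent `pinf` the modular of
`1_R` at `T` is exactly `l ^ n / T ^ pinf = 1`. -/
theorem exists_indNorm_large (n : ℕ) (pm P Cd Ci : ℝ) : ∃ C : ℝ, 1 ≤ C ∧
    ∀ (p : RSpace n → ℝ) (pinf : ℝ), LogHolderClass pm P Cd Ci p pinf →
    ∀ (a : Fin n → ℝ) (l : ℝ), 1 ≤ l →
      varNorm p ((box a l).indicator fun _ => (1 : ℝ)) = ENNReal.ofReal (indNorm p (box a l)) ∧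
      indNorm p (box a l) ≤ C * l ^ ((n : ℝ) / pinf) ∧
      l ^ ((n : ℝ) / pinf) ≤ C * indNorm p (box a l) := by
  obtain ⟨H, hH1, hH⟩ := exists_lintegral_decayWeight_le n
  set K := Real.exp ((((n : ℝ) + 1) / pm + Real.log 1) * Ci) with hK
  set D := max 1 (K * (2 ^ P + H)) with hD
  have hD1 : 1 ≤ D := le_max_left _ _
  set D' := max 1 (K * (1 + H)) with hD'
  have hD'1 : 1 ≤ D' := le_max_left _ _
  refine ⟨max 1 (max (D ^ (1 / pm)) (D' ^ (1 / pm))), le_max_left _ _, fun p pinf h a l hl => ?_⟩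
  have hl0 : 0 < l := by linarith
  have hpm := h.pm_pos
  have hpinf := h.pinf_pos
  set T := l ^ ((n : ℝ) / pinf) with hT
  have hT1 : 1 ≤ T := Real.one_le_rpow hl (by positivity)
  have hT0 : 0 < T := by linarith
  have hTp : T ^ pinf = l ^ n := by
    rw [hT, ← Real.rpow_mul hl0.le, div_mul_cancel₀ _ hpinf.ne', Real.rpow_natCast]
  have hHR : ∫⁻ x in box a l, ENNReal.ofReal (decayWeight x) ≤ ENNReal.ofReal H :=
    (setLIntegral_le_lintegral _ _).trans hH
  have hcmp := fun (s : ℝ) (hs : 0 < s) (hs1 : s ≤ 1) x => h.rpow_compare le_rfl hs hs1 x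
  have hup : varNorm p ((box a l).indicator fun _ => (1 : ℝ)) ≤
      ENNReal.ofReal (D' ^ (1 / pm) * T) := by
    refine varNorm_le_of_modular_le hpm h.lower hT0 hD'1 ?_
    rw [h.modular_one]
    calc ∫⁻ x in box a l, ENNReal.ofReal ((1 / T) ^ p x)
        ≤ ∫⁻ x in box a l, ENNReal.ofReal K *
          (ENNReal.ofReal ((1 / T) ^ pinf) + ENNReal.ofReal (decayWeight x)) := by
          refine lintegral_mono fun x => ?_
          rw [← ENNReal.ofReal_add (by positivity) (decayWeight_pos x).le,
            ← ENNReal.ofReal_mul (by positivity)]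
          exact ENNReal.ofReal_le_ofReal (hcmp _ (by positivity) ((div_le_one hT0).2 hT1) x).2
      _ = ENNReal.ofReal K * (ENNReal.ofReal ((1 / T) ^ pinf * l ^ n) +
          ∫⁻ x in box a l, ENNReal.ofReal (decayWeight x)) := by
          rw [lintegral_const_mul' _ _ ENNReal.ofReal_ne_top, lintegral_add_left measurable_const,
            setLIntegral_ofReal_const hl0 (by positivity)]
      _ ≤ ENNReal.ofReal K * (ENNReal.ofReal 1 + ENNReal.ofReal H) := by
          gcongr
          rw [Real.div_rpow zero_le_one hT0.le, hTp, Real.one_rpow, one_div,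
            inv_mul_cancel₀ (by positivity)]
      _ ≤ ENNReal.ofReal D' := by
          rw [← ENNReal.ofReal_add zero_le_one (by linarith), ← ENNReal.ofReal_mul (by positivity)]
          exact ENNReal.ofReal_le_ofReal (le_max_right _ _)
  have hne := ne_top_of_le_ne_top ENNReal.ofReal_ne_top hup
  have he : varNorm p ((box a l).indicator fun _ => (1 : ℝ)) =
    ENNReal.ofReal (indNorm p (box a l)) := (ENNReal.ofReal_toReal hne).symm
  -- The box contains a unit box, for which the lower power bound equals `1`.
  have ht1 : 1 ≤ indNorm p (box a l) := by
    have h1 := h.rpow_le_varNorm_one a one_pos le_rfl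
    rw [Real.one_rpow] at h1
    have h2 : varNorm p ((box a 1).indicator fun _ => (1 : ℝ)) ≤
        varNorm p ((box a l).indicator fun _ => (1 : ℝ)) := by
      refine varNorm_mono h.pos (Filter.Eventually.of_forall fun x => ?_)
      have hsub : box a 1 ⊆ box a l := fun x hx i => ⟨(hx i).1, (hx i).2.trans_le (by linarith)⟩
      by_cases hx : x ∈ box a 1
      · simp [hx, hsub hx]
      · simp [hx]
    have h3 := h1.trans h2
    rwa [he, ENNReal.ofReal_le_ofReal_iff (indNorm_nonneg _ _)] at h3
  set t := indNorm p (box a l) with ht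
  have ht0 : 0 < t := by linarith
  refine ⟨he, ?_, ?_⟩
  · rw [he, ENNReal.ofReal_le_ofReal_iff (by positivity)] at hup
    refine hup.trans ?_
    gcongr
    exact (le_max_right _ _).trans (le_max_right _ _)
  · have hmod := modular_varNorm_le h.pos h.upper ht0 he
    rw [h.modular_one] at hmod
    have h1 : ENNReal.ofReal ((1 / t) ^ pinf * l ^ n) ≤ ENNReal.ofReal D := by
      calc ENNReal.ofReal ((1 / t) ^ pinf * l ^ n)
          = ∫⁻ _x in box a l, ENNReal.ofReal ((1 / t) ^ pinf) :=
            (setLIntegral_ofReal_const hl0 (by positivity)).symm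
        _ ≤ ∫⁻ x in box a l, ENNReal.ofReal K *
          (ENNReal.ofReal ((1 / t) ^ p x) + ENNReal.ofReal (decayWeight x)) := by
            refine lintegral_mono fun x => ?_
            rw [← ENNReal.ofReal_add (by positivity) (decayWeight_pos x).le,
              ← ENNReal.ofReal_mul (by positivity)]
            exact ENNReal.ofReal_le_ofReal (hcmp _ (by positivity) ((div_le_one ht0).2 ht1) x).1
        _ = ENNReal.ofReal K * (∫⁻ x in box a l, ENNReal.ofReal ((1 / t) ^ p x) +
            ENNReal.ofReal (decayWeight x)) := lintegral_const_mul' _ _ ENNReal.ofReal_ne_top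
        _ = ENNReal.ofReal K * ((∫⁻ x in box a l, ENNReal.ofReal ((1 / t) ^ p x)) +
            ∫⁻ x in box a l, ENNReal.ofReal (decayWeight x)) := by
            rw [lintegral_add_right _ measurable_decayWeight.ennreal_ofReal]
        _ ≤ ENNReal.ofReal K * (ENNReal.ofReal (2 ^ P) + ENNReal.ofReal H) := by gcongr
        _ ≤ ENNReal.ofReal D := by
            rw [← ENNReal.ofReal_add (by positivity) (by linarith),
              ← ENNReal.ofReal_mul (by positivity)]
            exact ENNReal.ofReal_le_ofReal (le_max_right _ _)
    rw [ENNReal.ofReal_le_ofReal_iff (by linarith), Real.div_rpow zero_le_one ht0.le,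
      Real.one_rpow, one_div_mul_eq_div, div_le_iff₀ (by positivity), ← hTp] at h1
    have h2 : T ≤ D ^ (1 / pinf) * t := by
      have h3 := Real.rpow_le_rpow (by positivity) h1 (by positivity : 0 ≤ 1 / pinf)
      rwa [Real.mul_rpow (by linarith) (by positivity), ← Real.rpow_mul hT0.le,
        ← Real.rpow_mul ht0.le, mul_one_div_cancel hpinf.ne', Real.rpow_one, Real.rpow_one] at h3
    have h3 : D ^ (1 / pinf) ≤ D ^ (1 / pm) :=
      Real.rpow_le_rpow_of_exponent_le hD1 (one_div_le_one_div_of_le hpm h.pm_le)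
    refine h2.trans ?_
    gcongr
    exact h3.trans ((le_max_left _ _).trans (le_max_right _ _))

/-! ### Scalar weights and the gauge. -/

/-- The lower corner of a dyadic cell. -/
noncomputable def dyadicCorner {n : ℕ} (a : Fin n → ℝ) (L : ℝ) (k : ℕ) (x : RSpace n) : Fin n → ℝ :=
  fun i => a i + ⌊(x i - a i) / (L / 2 ^ k)⌋ * (L / 2 ^ k)

theorem dyadic_eq_box {n : ℕ} (a : Fin n → ℝ) (L : ℝ) (k : ℕ) (x : RSpace n) :
    dyadic a L k x = box (dyadicCorner a L k x) (L / 2 ^ k) := rfl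

/-- The norm `‖w 1_R‖_{p(·)}` as a real number. -/
noncomputable def setNorm {n : ℕ} (p w : RSpace n → ℝ) (R : Set (RSpace n)) : ℝ :=
  (varNorm p (R.indicator w)).toReal

/-- Scalar weights satisfying the `𝒜_{p(·),∞}` condition on half-open boxes. -/
structure ScalarAinf {n : ℕ} (p w : RSpace n → ℝ) (K : ℝ) : Prop where
  measurable : Measurable w
  pos : ∀ x, 0 < w x
  one_le : 1 ≤ K
  integrableOn_log : ∀ (a : Fin n → ℝ) (l : ℝ), 0 < l →
    IntegrableOn (fun x => Real.log (w x)) (box a l)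
  varNorm_eq : ∀ (a : Fin n → ℝ) (l : ℝ), 0 < l →
    varNorm p ((box a l).indicator w) = ENNReal.ofReal (setNorm p w (box a l))
  setNorm_pos : ∀ (a : Fin n → ℝ) (l : ℝ), 0 < l → 0 < setNorm p w (box a l)
  setNorm_le : ∀ (a : Fin n → ℝ) (l : ℝ), 0 < l → setNorm p w (box a l) ≤
    K * Real.exp ((∫ x in box a l, Real.log (w x)) / l ^ n) * indNorm p (box a l)

/-- The normalized norm of `w` on the cell of generation `k₀` around `x`. -/
noncomputable def cellMean {n : ℕ} (p w : RSpace n → ℝ) (a : Fin n → ℝ) (L : ℝ) (k₀ : ℕ)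
    (x : RSpace n) : ℝ :=
  setNorm p w (dyadic a L k₀ x) / indNorm p (dyadic a L k₀ x)

/-- The weight divided by its cell mean, truncated from below at `1`. -/
noncomputable def cellTrunc {n : ℕ} (p w : RSpace n → ℝ) (a : Fin n → ℝ) (L : ℝ) (k₀ : ℕ)
    (x : RSpace n) : ℝ :=
  max (w x / cellMean p w a L k₀ x) 1

/-- The scalar weight to which the Gehring inequality is applied. -/
noncomputable def cellGauge {n : ℕ} (p : RSpace n → ℝ) (pinf : ℝ) (w : RSpace n → ℝ) (a : Fin n → ℝ)
    (L : ℝ) (k₀ : ℕ) (x : RSpace n) : ℝ :=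
  cellMean p w a L k₀ x ^ pinf * cellTrunc p w a L k₀ x ^ p x

/-- The constant in the modular estimates on small cells. -/
noncomputable def modConst (n : ℕ) (pm P Cd : ℝ) : ℝ := 2 ^ P * boxConst n pm P Cd

section Cells

variable {n : ℕ} {pm P Cd Ci : ℝ} {p : RSpace n → ℝ} {pinf : ℝ} {w : RSpace n → ℝ} {K : ℝ}
  {a : Fin n → ℝ} {L : ℝ} {k₀ k : ℕ} {x y : RSpace n}

theorem LogHolderClass.one_le_modConst (h : LogHolderClass pm P Cd Ci p pinf) :
    1 ≤ modConst n pm P Cd := by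
  have h1 : (1 : ℝ) ≤ 2 ^ P := Real.one_le_rpow (by norm_num) h.P_pos.le
  have h2 := h.one_le_boxConst
  unfold modConst
  nlinarith

theorem cellMean_eq_of_mem (hL : 0 < L) (hy : y ∈ dyadic a L k₀ x) :
    cellMean p w a L k₀ y = cellMean p w a L k₀ x := by
  simp only [cellMean, dyadic_eq_of_mem hL hy]

theorem measurable_cellMean : Measurable (cellMean p w a L k₀) := by
  -- The cell mean factors through the integer index of the cell, on which every function is
  -- measurable.
  have h1 : Measurable fun (x : RSpace n) (i : Fin n) => ⌊(x i - a i) / (L / 2 ^ k₀)⌋ := by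
    refine measurable_pi_lambda _ fun i => Int.measurable_floor.comp ?_
    fun_prop
  let F : (Fin n → ℤ) → ℝ := fun z =>
    setNorm p w (box (fun i => a i + z i * (L / 2 ^ k₀)) (L / 2 ^ k₀)) /
      indNorm p (box (fun i => a i + z i * (L / 2 ^ k₀)) (L / 2 ^ k₀))
  exact (measurable_of_countable F).comp h1

theorem measurable_cellTrunc (hw : Measurable w) : Measurable (cellTrunc p w a L k₀) :=
  (hw.div measurable_cellMean).max measurable_const

theorem measurable_cellGauge (hp : Measurable p) (hw : Measurable w) :
    Measurable (cellGauge p pinf w a L k₀) :=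
  (measurable_cellMean.pow_const _).mul ((measurable_cellTrunc hw).pow hp)

theorem one_le_cellTrunc : 1 ≤ cellTrunc p w a L k₀ x := le_max_right _ _

theorem cellTrunc_pos : 0 < cellTrunc p w a L k₀ x := one_pos.trans_le one_le_cellTrunc

theorem cellMean_pos (h : LogHolderClass pm P Cd Ci p pinf) (hw : ScalarAinf p w K) (hL : 0 < L)
    (hk : L / 2 ^ k₀ ≤ 1) : 0 < cellMean p w a L k₀ x :=
  div_pos (hw.setNorm_pos _ _ (by positivity))
    (h.indNorm_small_pos _ (by positivity) hk)

theorem cellGauge_pos (h : LogHolderClass pm P Cd Ci p pinf) (hw : ScalarAinf p w K) (hL : 0 < L)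
    (hk : L / 2 ^ k₀ ≤ 1) : 0 < cellGauge p pinf w a L k₀ x :=
  mul_pos (Real.rpow_pos_of_pos (cellMean_pos h hw hL hk) _)
    (Real.rpow_pos_of_pos cellTrunc_pos _)

theorem max_one_rpow_le {s q : ℝ} (hs : 0 ≤ s) : max s 1 ^ q ≤ s ^ q + 1 := by
  rcases le_total s 1 with h1 | h1
  · rw [max_eq_right h1, Real.one_rpow]
    have := Real.rpow_nonneg hs q
    linarith
  · rw [max_eq_left h1]; linarith

theorem lintegral_cell_ratio_le (h : LogHolderClass pm P Cd Ci p pinf) (hw : ScalarAinf p w K)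
    (hL : 0 < L) (hk : L / 2 ^ k₀ ≤ 1) :
    ∫⁻ y in dyadic a L k₀ x, ENNReal.ofReal ((w y / cellMean p w a L k₀ y) ^ p y) ≤
      ENNReal.ofReal (modConst n pm P Cd * (L / 2 ^ k₀) ^ n) ∧
    ENNReal.ofReal ((L / 2 ^ k₀) ^ n) ≤ ENNReal.ofReal (modConst n pm P Cd) *
      ∫⁻ y in dyadic a L k₀ x, ENNReal.ofReal ((w y / cellMean p w a L k₀ y) ^ p y) := by
  have hl : 0 < L / 2 ^ k₀ := by positivity
  have key := h.lintegral_normalized_small (dyadicCorner a L k₀ x) hl hk (fun x => (hw.pos x).le)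
    (hw.setNorm_pos _ _ hl) (hw.varNorm_eq _ _ hl)
  have he : ∫⁻ y in dyadic a L k₀ x, ENNReal.ofReal ((w y / cellMean p w a L k₀ y) ^ p y) =
      ∫⁻ y in dyadic a L k₀ x, ENNReal.ofReal ((w y / cellMean p w a L k₀ x) ^ p y) :=
    setLIntegral_congr_fun measurableSet_dyadic fun y hy => by
      simp only [cellMean_eq_of_mem hL hy]
  rw [he]
  exact key

theorem lintegral_dyadic_const (hL : 0 < L) {c : ℝ} (hc : 0 ≤ c) :
    ∫⁻ _y in dyadic a L k x, ENNReal.ofReal c = ENNReal.ofReal (c * (L / 2 ^ k) ^ n) :=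
  setLIntegral_ofReal_const (by positivity) hc

/-- On each cell of generation `k₀` the normalized weight contributes `modConst` and the truncation
at `1` contributes one more unit of volume; then sum over cells. -/
theorem lintegral_cellTrunc_le (h : LogHolderClass pm P Cd Ci p pinf) (hw : ScalarAinf p w K)
    (hL : 0 < L) (hk : L / 2 ^ k₀ ≤ 1) (hkk : k ≤ k₀) :
    ∫⁻ y in dyadic a L k x, ENNReal.ofReal (cellTrunc p w a L k₀ y ^ p y) ≤
      ENNReal.ofReal ((modConst n pm P Cd + 1) * (L / 2 ^ k) ^ n) := by
  have hC := h.one_le_modConst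
  have hl : 0 < L / 2 ^ k₀ := by positivity
  rw [← lintegral_dyadic_const (a := a) (x := x) hL (by linarith)]
  refine setLIntegral_dyadic_le_of_cells hL hkk fun y _ => ?_
  rw [lintegral_dyadic_const hL (by linarith)]
  calc ∫⁻ z in dyadic a L k₀ y, ENNReal.ofReal (cellTrunc p w a L k₀ z ^ p z)
      ≤ ∫⁻ z in dyadic a L k₀ y, (ENNReal.ofReal ((w z / cellMean p w a L k₀ z) ^ p z) +
          ENNReal.ofReal 1) := by
        refine lintegral_mono fun z => ?_
        have h0 : 0 ≤ w z / cellMean p w a L k₀ z :=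
          div_nonneg (hw.pos z).le (cellMean_pos h hw hL hk).le
        rw [← ENNReal.ofReal_add (by positivity) zero_le_one]
        exact ENNReal.ofReal_le_ofReal (max_one_rpow_le h0)
    _ = (∫⁻ z in dyadic a L k₀ y, ENNReal.ofReal ((w z / cellMean p w a L k₀ z) ^ p z)) +
          ENNReal.ofReal (1 * (L / 2 ^ k₀) ^ n) := by
        rw [lintegral_add_right _ measurable_const, lintegral_dyadic_const hL zero_le_one]
    _ ≤ ENNReal.ofReal (modConst n pm P Cd * (L / 2 ^ k₀) ^ n) +
          ENNReal.ofReal (1 * (L / 2 ^ k₀) ^ n) := by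
        gcongr
        exact (lintegral_cell_ratio_le h hw hL hk).1
    _ = _ := by
        rw [← ENNReal.ofReal_add (by positivity) (by positivity)]; congr 1; ring

theorem log_le_rpow_div (h : LogHolderClass pm P Cd Ci p pinf) {s : ℝ} (hs : 0 < s) :
    Real.log s ≤ 1 / pm * s ^ p x := by
  have h1 := Real.log_le_rpow_div hs.le (h.pos x)
  refine h1.trans ?_
  rw [div_eq_mul_one_div, mul_comm]
  have := h.pm_pos
  gcongr
  exact h.lower x

theorem volume_real_dyadic (hL : 0 < L) : volume.real (dyadic a L k x) = (L / 2 ^ k) ^ n := by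
  rw [measureReal_def, volume_dyadic hL, ENNReal.toReal_ofReal (by positivity)]

/-- Real integrability and bounds from a bound on the Lebesgue integral. -/
theorem integrableOn_and_setIntegral_le {R : Set (RSpace n)} {F : RSpace n → ℝ} (hF : Measurable F)
    (hF0 : ∀ x, 0 ≤ F x) {c : ℝ} (hc : 0 ≤ c)
    (h : ∫⁻ x in R, ENNReal.ofReal (F x) ≤ ENNReal.ofReal c) :
    IntegrableOn F R ∧ ∫ x in R, F x ≤ c := by
  constructor
  · refine ⟨hF.aestronglyMeasurable, ?_⟩
    rw [hasFiniteIntegral_iff_ofReal (Filter.Eventually.of_forall hF0)]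
    exact h.trans_lt ENNReal.ofReal_lt_top
  · rw [integral_eq_lintegral_of_nonneg_ae (Filter.Eventually.of_forall hF0)
      hF.aestronglyMeasurable]
    exact ENNReal.toReal_le_of_le_ofReal hc h

end Cells

/-! ### Mean of the gauge inside a cell of generation `k₀`. -/

section Small

variable {n : ℕ} {pm P Cd Ci : ℝ} {p : RSpace n → ℝ} {pinf : ℝ} {w : RSpace n → ℝ} {K : ℝ}
  {a : Fin n → ℝ} {L : ℝ} {k₀ k : ℕ} {x y : RSpace n}

/-- The logarithmic constant for cells contained in a cell of generation `k₀`. -/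
noncomputable def smallConst (n : ℕ) (pm P Cd : ℝ) : ℝ :=
  Real.log (Real.exp (n / pm * Cd) * (modConst n pm P Cd + 1)) + n / pm * Cd +
    P / pm * (modConst n pm P Cd + 1)

theorem integrableOn_log_cellTrunc (h : LogHolderClass pm P Cd Ci p pinf) (hw : ScalarAinf p w K)
    (hL : 0 < L) (hk : L / 2 ^ k₀ ≤ 1) (hkk : k₀ ≤ k) :
    IntegrableOn (fun y => Real.log (cellTrunc p w a L k₀ y)) (dyadic a L k x) := by
  have hC := h.one_le_modConst
  have hpm := h.pm_pos
  have hl0 : 0 < L / 2 ^ k₀ := by positivity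
  have hm : Measurable fun y => cellTrunc p w a L k₀ y ^ p y :=
    (measurable_cellTrunc hw.measurable).pow h.measurable
  have h1 := (integrableOn_and_setIntegral_le (R := dyadic a L k₀ x) hm
    (fun y => Real.rpow_nonneg cellTrunc_pos.le _) (by positivity)
    (lintegral_cellTrunc_le h hw hL hk le_rfl)).1
  refine ((h1.mono_set (dyadic_subset hL hkk)).const_mul (1 / pm)).mono'
    (measurable_cellTrunc hw.measurable).log.aestronglyMeasurable
    (Filter.Eventually.of_forall fun y => ?_)
  rw [Real.norm_of_nonneg (Real.log_nonneg one_le_cellTrunc)]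
  exact log_le_rpow_div h cellTrunc_pos

theorem integrableOn_exponent_mul_log_cellTrunc (h : LogHolderClass pm P Cd Ci p pinf)
    (hw : ScalarAinf p w K) (hL : 0 < L) (hk : L / 2 ^ k₀ ≤ 1) (hkk : k₀ ≤ k) :
    IntegrableOn (fun y => p y * Real.log (cellTrunc p w a L k₀ y)) (dyadic a L k x) := by
  refine ((integrableOn_log_cellTrunc h hw hL hk hkk).const_mul P).mono'
    (h.measurable.mul (measurable_cellTrunc hw.measurable).log).aestronglyMeasurable
    (Filter.Eventually.of_forall fun y => ?_)
  have h1 := Real.log_nonneg (one_le_cellTrunc (p := p) (w := w) (a := a) (L := L) (k₀ := k₀)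
    (x := y))
  rw [Real.norm_of_nonneg (mul_nonneg (h.pos y).le h1)]
  gcongr
  exact h.upper y

theorem log_cellGauge (h : LogHolderClass pm P Cd Ci p pinf) (hw : ScalarAinf p w K)
    (hL : 0 < L) (hk : L / 2 ^ k₀ ≤ 1) :
    Real.log (cellGauge p pinf w a L k₀ x) = pinf * Real.log (cellMean p w a L k₀ x) +
      p x * Real.log (cellTrunc p w a L k₀ x) := by
  have h1 := cellMean_pos (a := a) (x := x) h hw hL hk
  have h2 := cellTrunc_pos (p := p) (w := w) (a := a) (L := L) (k₀ := k₀) (x := x)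
  rw [cellGauge, Real.log_mul (Real.rpow_pos_of_pos h1 _).ne' (Real.rpow_pos_of_pos h2 _).ne',
    Real.log_rpow h1, Real.log_rpow h2]

theorem setNorm_mono (hp : ∀ x, 0 < p x) (hw : ScalarAinf p w K) {b c : Fin n → ℝ} {l l' : ℝ}
    (hl : 0 < l) (hl' : 0 < l') (hsub : box b l ⊆ box c l') :
    setNorm p w (box b l) ≤ setNorm p w (box c l') := by
  have h1 : varNorm p ((box b l).indicator w) ≤ varNorm p ((box c l').indicator w) := by
    refine varNorm_mono hp (Filter.Eventually.of_forall fun z => ?_)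
    by_cases hz : z ∈ box b l
    · simp [hz, hsub hz]
    · simp [hz]
  rwa [hw.varNorm_eq _ _ hl, hw.varNorm_eq _ _ hl',
    ENNReal.ofReal_le_ofReal_iff (hw.setNorm_pos _ _ hl').le] at h1

set_option maxHeartbeats 1000000 in
-- Let `ρ` be the ratio of the normalized norm on the subcell `R` to that on the ambient cell, and
-- `θ = max ρ 1`. Then `u ≤ θ * q` with `q ^ p` of bounded mean, so the mean of the gauge is at most
-- a constant times `m ^ pinf * θ ^ p x`. The hypothesis on `w` bounds `log θ` by `log K` plus the
-- mean of `log u`, and the frozen exponent `p x` is finally moved back under the integral.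
theorem dyadicMean_cellGauge_le_small (h : LogHolderClass pm P Cd Ci p pinf)
    (hw : ScalarAinf p w K) (hL : 0 < L) (hk : L / 2 ^ k₀ ≤ 1) (hkk : k₀ ≤ k) :
    IntegrableOn (fun y => Real.log (cellGauge p pinf w a L k₀ y)) (dyadic a L k x) ∧
    dyadicMean a L (fun y => ENNReal.ofReal (cellGauge p pinf w a L k₀ y)) k x ≤
      ENNReal.ofReal (Real.exp (smallConst n pm P Cd + P * Real.log K +
        (∫ y in dyadic a L k x, Real.log (cellGauge p pinf w a L k₀ y)) /
          volume.real (dyadic a L k x))) := by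
  have hC := h.one_le_modConst
  have hpm := h.pm_pos
  have hK := hw.one_le
  have hP := h.P_pos
  have hl : 0 < L / 2 ^ k := by positivity
  have hl0 : 0 < L / 2 ^ k₀ := by positivity
  have hl1 : L / 2 ^ k ≤ 1 := by
    refine le_trans ?_ hk
    gcongr
    norm_num
  have hVreal := volume_real_dyadic (a := a) (k := k) (x := x) hL
  set R := dyadic a L k x with hR
  set l := L / 2 ^ k with hldef
  set V := volume.real R with hV
  have hV0 : 0 < V := by rw [hVreal]; positivity
  have hRS : R ⊆ dyadic a L k₀ x := dyadic_subset hL hkk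
  set C := modConst n pm P Cd with hCdef
  set m := cellMean p w a L k₀ x with hm
  have hm0 : 0 < m := cellMean_pos h hw hL hk
  have hmy : ∀ y ∈ R, cellMean p w a L k₀ y = m := fun y hy => cellMean_eq_of_mem hL (hRS hy)
  set N := setNorm p w R with hN
  have hN0 : 0 < N := hw.setNorm_pos _ _ hl
  set t := indNorm p R with ht
  have ht0 : 0 < t := h.indNorm_small_pos _ hl hl1
  set ρ := N / t / m with hρ
  have hρ0 : 0 < ρ := by positivity
  set θ := max ρ 1 with hθ
  have hθ1 : 1 ≤ θ := le_max_right _ _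
  have hθ0 : 0 < θ := by linarith
  have hnpm : (0 : ℝ) ≤ n / pm := by positivity
  have hlogl : 0 ≤ -Real.log l := by linarith [Real.log_nonpos hl.le hl1]
  have hlogθ0 : 0 ≤ Real.log θ := Real.log_nonneg hθ1
  -- Monotonicity of the norm and `‖1‖ ≤ 1` on the ambient cell give `N ≤ m`, hence `ρ ≤ 1 / t`.
  -- This is the logarithmic control that lets the exponent of `θ` be frozen.
  have hlogθ : Real.log θ ≤ n / pm * (-Real.log l) := by
    rcases le_total ρ 1 with h1 | h1
    · rw [hθ, max_eq_right h1, Real.log_one]; positivity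
    · rw [hθ, max_eq_left h1]
      have h2 : N ≤ setNorm p w (dyadic a L k₀ x) := setNorm_mono h.pos hw hl hl0 hRS
      have h3 : N ≤ m := by
        refine h2.trans ?_
        have hS : 0 < indNorm p (dyadic a L k₀ x) := h.indNorm_small_pos _ hl0 hk
        rw [hm, cellMean, le_div_iff₀ hS]
        exact mul_le_of_le_one_right (hw.setNorm_pos _ _ hl0).le (h.indNorm_small _ hl0 hk).2.2
      have h4 : ρ ≤ 1 / t := by
        rw [hρ, div_div, div_le_div_iff₀ (by positivity) ht0]
        nlinarith
      refine (Real.log_le_log hρ0 h4).trans ?_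
      rw [one_div, Real.log_inv]
      exact (neg_le_abs _).trans (h.abs_log_indNorm_le _ hl hl1)
  set u := cellTrunc p w a L k₀ with hu
  set q : RSpace n → ℝ := fun y => max (w y / (N / t)) 1 with hq
  have hq1 : ∀ y, 1 ≤ q y := fun y => le_max_right _ _
  have hqm : Measurable q := (hw.measurable.div_const _).max measurable_const
  have huq : ∀ y ∈ R, u y ≤ θ * q y := by
    intro y hy
    rw [hu, cellTrunc, hmy y hy]
    refine max_le ?_ ?_
    · have h1 : w y / m = ρ * (w y / (N / t)) := by rw [hρ]; field_simp
      rw [h1]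
      have := (hw.pos y).le
      exact mul_le_mul (le_max_left _ _) (le_max_left _ _) (by positivity) hθ0.le
    · nlinarith [hq1 y]
  have hqint : ∫⁻ y in R, ENNReal.ofReal (q y ^ p y) ≤ ENNReal.ofReal ((C + 1) * V) := by
    calc ∫⁻ y in R, ENNReal.ofReal (q y ^ p y)
        ≤ ∫⁻ y in R, (ENNReal.ofReal ((w y / (N / t)) ^ p y) + ENNReal.ofReal 1) := by
          refine lintegral_mono fun y => ?_
          have h0 : 0 ≤ w y / (N / t) := div_nonneg (hw.pos y).le (by positivity)
          rw [← ENNReal.ofReal_add (by positivity) zero_le_one]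
          exact ENNReal.ofReal_le_ofReal (max_one_rpow_le h0)
      _ = (∫⁻ y in R, ENNReal.ofReal ((w y / (N / t)) ^ p y)) + ENNReal.ofReal (1 * l ^ n) := by
          rw [lintegral_add_right _ measurable_const, lintegral_dyadic_const hL zero_le_one]
      _ ≤ ENNReal.ofReal (C * l ^ n) + ENNReal.ofReal (1 * l ^ n) := by
          gcongr
          exact (h.lintegral_normalized_small (dyadicCorner a L k x) hl hl1
            (fun x => (hw.pos x).le) hN0 (hw.varNorm_eq _ _ hl)).1
      _ = _ := by
          rw [← ENNReal.ofReal_add (by positivity) (by positivity), hVreal]; congr 1; ring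
  obtain ⟨hqI, hqle⟩ := integrableOn_and_setIntegral_le (hqm.pow h.measurable)
    (fun y => Real.rpow_nonneg (one_pos.le.trans (hq1 y)) _) (by positivity) hqint
  have hlogu := integrableOn_log_cellTrunc (a := a) (x := x) h hw hL hk hkk
  have hplogu := integrableOn_exponent_mul_log_cellTrunc (a := a) (x := x) h hw hL hk hkk
  have hlogg : ∀ y ∈ R, Real.log (cellGauge p pinf w a L k₀ y) =
      pinf * Real.log m + p y * Real.log (u y) := by
    intro y hy
    rw [log_cellGauge h hw hL hk, hmy y hy]
  have hRfin : volume R ≠ ⊤ := volume_dyadic_ne_top hL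
  have hconst : ∀ c : ℝ, IntegrableOn (fun _ : RSpace n => c) R := fun c => integrableOn_const hRfin
  have hintg : IntegrableOn (fun y => Real.log (cellGauge p pinf w a L k₀ y)) R :=
    IntegrableOn.congr_fun ((hconst (pinf * Real.log m)).add hplogu)
      (fun y hy => (hlogg y hy).symm) measurableSet_dyadic
  refine ⟨hintg, ?_⟩
  have hIg : ∫ y in R, Real.log (cellGauge p pinf w a L k₀ y) =
      pinf * Real.log m * V + ∫ y in R, p y * Real.log (u y) := by
    rw [setIntegral_congr_fun measurableSet_dyadic hlogg,
      integral_add (hconst _) hplogu, setIntegral_const, smul_eq_mul, mul_comm]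
  set E := Real.exp (n / pm * Cd) with hE
  have hE0 : 0 < E := Real.exp_pos _
  have hbound : ∫⁻ y in R, ENNReal.ofReal (cellGauge p pinf w a L k₀ y) ≤
      ENNReal.ofReal (m ^ pinf * (E * θ ^ p x) * ((C + 1) * V)) := by
    calc ∫⁻ y in R, ENNReal.ofReal (cellGauge p pinf w a L k₀ y)
        ≤ ∫⁻ y in R, ENNReal.ofReal (m ^ pinf * (E * θ ^ p x)) * ENNReal.ofReal (q y ^ p y) := by
          refine setLIntegral_mono' measurableSet_dyadic fun y hy => ?_
          rw [← ENNReal.ofReal_mul (by positivity)]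
          refine ENNReal.ofReal_le_ofReal ?_
          have hq0 : 0 ≤ q y := one_pos.le.trans (hq1 y)
          rw [cellGauge, hmy y hy, mul_assoc]
          have h1 : u y ^ p y ≤ θ ^ p y * q y ^ p y := by
            rw [← Real.mul_rpow hθ0.le hq0]
            exact Real.rpow_le_rpow cellTrunc_pos.le (huq y hy) (h.pos y).le
          have h2 : θ ^ p y ≤ E * θ ^ p x := by
            have := h.rpow_le_of_mem_box hl hl1 hy (self_mem_dyadic hL) hθ0 hnpm le_rfl
              (by rw [abs_of_nonneg hlogθ0, add_zero]; exact hlogθ)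
            simpa using this
          have h3 : 0 ≤ q y ^ p y := Real.rpow_nonneg hq0 _
          refine mul_le_mul_of_nonneg_left ?_ (by positivity)
          exact h1.trans (mul_le_mul_of_nonneg_right h2 h3)
      _ = ENNReal.ofReal (m ^ pinf * (E * θ ^ p x)) * ∫⁻ y in R, ENNReal.ofReal (q y ^ p y) :=
          lintegral_const_mul' _ _ ENNReal.ofReal_ne_top
      _ ≤ ENNReal.ofReal (m ^ pinf * (E * θ ^ p x)) * ENNReal.ofReal ((C + 1) * V) := by gcongr
      _ = _ := by rw [← ENNReal.ofReal_mul (by positivity)]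
  have hmean : dyadicMean a L (fun y => ENNReal.ofReal (cellGauge p pinf w a L k₀ y)) k x ≤
      ENNReal.ofReal (m ^ pinf * (E * θ ^ p x) * (C + 1)) := by
    rw [dyadicMean, ENNReal.div_le_iff (volume_dyadic_ne_zero hL) hRfin, ← hR,
      ← ENNReal.ofReal_toReal hRfin, ← ENNReal.ofReal_mul (by positivity), mul_assoc]
    exact hbound
  refine hmean.trans (ENNReal.ofReal_le_ofReal ?_)
  have hexp : m ^ pinf * (E * θ ^ p x) * (C + 1) =
      Real.exp (pinf * Real.log m + Real.log (E * (C + 1)) + p x * Real.log θ) := by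
    rw [Real.exp_add, Real.exp_add, Real.exp_log (by positivity), Real.rpow_def_of_pos hm0,
      Real.rpow_def_of_pos hθ0, mul_comm (Real.log m), mul_comm (Real.log θ)]
    ring
  rw [hexp]
  refine Real.exp_le_exp.2 ?_
  rw [hIg, add_div, mul_div_cancel_right₀ _ hV0.ne', smallConst]
  -- The only use of the `𝒜_{p(·),∞}` bound on `R`. If `ρ ≤ 1` the left side vanishes; otherwise
  -- `log (w / m) ≤ log u` pointwise.
  have hlogθK : Real.log θ * V ≤ Real.log K * V + ∫ y in R, Real.log (u y) := by
    have hIu : 0 ≤ ∫ y in R, Real.log (u y) :=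
      setIntegral_nonneg measurableSet_dyadic fun y _ => Real.log_nonneg one_le_cellTrunc
    have hlK : 0 ≤ Real.log K := Real.log_nonneg hK
    rcases le_total ρ 1 with h1 | h1
    · rw [hθ, max_eq_right h1, Real.log_one, zero_mul]; positivity
    · rw [hθ, max_eq_left h1]
      have hlw : IntegrableOn (fun y => Real.log (w y)) R := hw.integrableOn_log _ _ hl
      have h2 : N ≤ K * Real.exp ((∫ y in R, Real.log (w y)) / V) * t := by
        rw [hVreal]; exact hw.setNorm_le _ _ hl
      have h3 : Real.log ρ ≤ Real.log K + (∫ y in R, Real.log (w y)) / V - Real.log m := by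
        rw [hρ, Real.log_div (by positivity) hm0.ne']
        gcongr
        rw [← Real.log_exp ((∫ y in R, Real.log (w y)) / V), ← Real.log_mul (by positivity)
          (Real.exp_pos _).ne']
        refine Real.log_le_log (by positivity) ?_
        rw [div_le_iff₀ ht0]
        exact h2
      have h4 : (∫ y in R, Real.log (w y)) - Real.log m * V ≤ ∫ y in R, Real.log (u y) := by
        have e1 : ∫ y in R, (Real.log (w y) - Real.log m) =
            (∫ y in R, Real.log (w y)) - Real.log m * V := by
          rw [integral_sub hlw (hconst _), setIntegral_const, smul_eq_mul, mul_comm V]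
        rw [← e1]
        refine setIntegral_mono_on (hlw.sub (hconst _)) hlogu measurableSet_dyadic fun y hy => ?_
        rw [← Real.log_div (hw.pos y).ne' hm0.ne']
        refine Real.log_le_log (div_pos (hw.pos y) hm0) ?_
        rw [hu, cellTrunc, hmy y hy]
        exact le_max_left _ _
      have h5 := mul_le_mul_of_nonneg_right h3 hV0.le
      rw [sub_mul, add_mul, div_mul_cancel₀ _ hV0.ne'] at h5
      linarith
  -- The exponent is unfrozen: in `(p x - p y) * log u`, the bound `log u ≤ log θ + log q` pairs the
  -- oscillation of `p` with `-log l`, and `log q` is dominated by `q ^ p y / pm`.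
  have hpt : ∀ y ∈ R, p x * Real.log (u y) ≤
      p y * Real.log (u y) + (n / pm * Cd + P / pm * q y ^ p y) := by
    intro y hy
    have hq0 : 0 < q y := one_pos.trans_le (hq1 y)
    have h1 : Real.log (u y) ≤ n / pm * (-Real.log l) + 1 / pm * q y ^ p y := by
      refine (Real.log_le_log cellTrunc_pos (huq y hy)).trans ?_
      rw [Real.log_mul hθ0.ne' hq0.ne']
      exact add_le_add hlogθ (log_le_rpow_div h hq0)
    have h0 : 0 ≤ Real.log (u y) := Real.log_nonneg one_le_cellTrunc
    have h2 : (p x - p y) * Real.log (u y) ≤ |p x - p y| * Real.log (u y) :=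
      mul_le_mul_of_nonneg_right (le_abs_self _) h0
    have h3 : |p x - p y| * Real.log (u y) ≤
        |p x - p y| * (n / pm * (-Real.log l) + 1 / pm * q y ^ p y) := by gcongr
    have h4 : |p x - p y| * (-Real.log l) ≤ Cd := h.osc _ l hl hl1 x (self_mem_dyadic hL) y hy
    have h5 : |p x - p y| ≤ P := h.abs_sub_le x y
    have h6 : 0 ≤ 1 / pm * q y ^ p y := by positivity
    have h7 := mul_le_mul_of_nonneg_left h4 hnpm
    have h8 := mul_le_mul_of_nonneg_right h5 h6
    have h9 : P / pm * q y ^ p y = P * (1 / pm * q y ^ p y) := by ring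
    rw [h9]
    linarith
  have hI := setIntegral_mono_on (hlogu.const_mul (p x))
    (hplogu.add ((hconst (n / pm * Cd)).add (hqI.const_mul (P / pm)))) measurableSet_dyadic hpt
  have eI : ∫ y in R, ((fun y => p y * Real.log (u y)) +
      ((fun _ => n / pm * Cd) + fun y => P / pm * q y ^ p y) : RSpace n → ℝ) y =
      (∫ y in R, p y * Real.log (u y)) + (n / pm * Cd * V + P / pm * ∫ y in R, q y ^ p y) := by
    rw [integral_add' hplogu ((hconst _).add (hqI.const_mul (P / pm))),
      integral_add' (hconst _) (hqI.const_mul (P / pm)), setIntegral_const, smul_eq_mul,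
      integral_const_mul, mul_comm V]
  have hI' : p x * ∫ y in R, Real.log (u y) ≤
      (∫ y in R, p y * Real.log (u y)) + (n / pm * Cd * V + P / pm * ∫ y in R, q y ^ p y) := by
    rw [← eI, ← integral_const_mul]; exact hI
  have h1 : p x * Real.log θ * V ≤ (P * Real.log K + n / pm * Cd + P / pm * (C + 1)) * V +
      ∫ y in R, p y * Real.log (u y) := by
    have h2 := mul_le_mul_of_nonneg_left hlogθK (h.pos x).le
    have h3 : p x * Real.log K ≤ P * Real.log K :=
      mul_le_mul_of_nonneg_right (h.upper x) (Real.log_nonneg hK)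
    have h4 := mul_le_mul_of_nonneg_right h3 hV0.le
    have h5 : P / pm * ∫ y in R, q y ^ p y ≤ P / pm * ((C + 1) * V) := by gcongr
    linarith
  have h2 : p x * Real.log θ ≤ P * Real.log K + n / pm * Cd + P / pm * (C + 1) +
      (∫ y in R, p y * Real.log (u y)) / V := by
    rw [← sub_le_iff_le_add', le_div_iff₀ hV0]
    linarith
  linarith

end Small

/-! ### Mean of the gauge on large cells, and the density estimate. -/

/-- Divided by the norm `N` over the large cell, the cell means are bounded, so `(m / N) ^ pinf` can
be traded for `(m / N) ^ p x`. This recombines with `(w / m) ^ p x` into the modular of `w / N`,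
which is at most `2 ^ P`. -/
theorem exists_lintegral_cellGauge_le (n : ℕ) (pm P Cd Ci : ℝ) : ∃ C : ℝ, 1 ≤ C ∧
    ∀ (p : RSpace n → ℝ) (pinf : ℝ), LogHolderClass pm P Cd Ci p pinf →
    ∀ (w : RSpace n → ℝ) (K : ℝ), ScalarAinf p w K →
    ∀ (a : Fin n → ℝ) (L : ℝ) (k₀ : ℕ), 0 < L → L / 2 ^ k₀ ≤ 1 → 1 / 2 ≤ L / 2 ^ k₀ →
    ∀ k ≤ k₀, ∀ x, ∫⁻ y in dyadic a L k x, ENNReal.ofReal (cellGauge p pinf w a L k₀ y) ≤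
      ENNReal.ofReal (C * setNorm p w (dyadic a L k x) ^ pinf) := by
  obtain ⟨H, hH1, hH⟩ := exists_lintegral_decayWeight_le n
  obtain ⟨Ch, hCh1, hCh⟩ := exists_decayWeight_le_mul n
  set B : ℝ := 2 ^ ((n : ℝ) / pm) with hB
  set Kc := Real.exp ((((n : ℝ) + 1) / pm + Real.log B) * Ci) with hKc
  set C₀ := modConst n pm P Cd with hC₀
  refine ⟨max 1 ((1 + C₀) * (Kc * (2 ^ P + Ch * (Ch * C₀) * H))), le_max_left _ _, ?_⟩
  intro p pinf h w K hw a L k₀ hL hk hk2 k hkk x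
  have hC₀1 : 1 ≤ C₀ := h.one_le_modConst
  have hpm := h.pm_pos
  have hl0 : 0 < L / 2 ^ k₀ := by positivity
  have hl : 0 < L / 2 ^ k := by positivity
  have hB1 : 1 ≤ B := Real.one_le_rpow (by norm_num) (by positivity)
  set R := dyadic a L k x with hR
  set N := setNorm p w R with hN
  have hN0 : 0 < N := hw.setNorm_pos _ _ hl
  set f : RSpace n → ℝ := fun y => (w y / cellMean p w a L k₀ y) ^ p y with hf
  have hfm : Measurable f := (hw.measurable.div measurable_cellMean).pow h.measurable
  have hμ : ∀ y, 0 < cellMean p w a L k₀ y := fun y => cellMean_pos h hw hL hk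
  have hf0 : ∀ y, 0 ≤ f y := fun y =>
    Real.rpow_nonneg (div_nonneg (hw.pos y).le (hμ y).le) _
  -- The lower bound `1 / 2` on the edge enters here: the indicator norm of a cell is at least `(1 /
  -- 2) ^ (n / pm)`.
  have hμB : ∀ y ∈ R, cellMean p w a L k₀ y / N ≤ B := by
    intro y hy
    have hsub : dyadic a L k₀ y ⊆ R :=
      (dyadic_subset hL hkk).trans (dyadic_eq_of_mem hL hy).subset
    have h1 : setNorm p w (dyadic a L k₀ y) ≤ N := setNorm_mono h.pos hw hl0 hl hsub
    have h2 : (L / 2 ^ k₀) ^ ((n : ℝ) / pm) ≤ indNorm p (dyadic a L k₀ y) :=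
      (h.indNorm_small _ hl0 hk).2.1
    have h3 : 0 < indNorm p (dyadic a L k₀ y) := h.indNorm_small_pos _ hl0 hk
    have h4 : 1 ≤ B * indNorm p (dyadic a L k₀ y) := by
      calc (1 : ℝ) = B * (1 / 2) ^ ((n : ℝ) / pm) := by
            rw [hB, ← Real.mul_rpow (by norm_num) (by norm_num)]; norm_num
        _ ≤ B * (L / 2 ^ k₀) ^ ((n : ℝ) / pm) := by gcongr
        _ ≤ _ := by gcongr
    rw [cellMean, div_div, div_le_iff₀ (by positivity)]
    nlinarith
  -- The truncation is removed: the volume it adds to a cell is at most `C₀` times the integral of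
  -- `f` there, by the lower half of `lintegral_cell_ratio_le`.
  have step1 : ∫⁻ y in R, ENNReal.ofReal (cellGauge p pinf w a L k₀ y) ≤
      ∫⁻ y in R, ENNReal.ofReal (1 + C₀) *
        ENNReal.ofReal (cellMean p w a L k₀ y ^ pinf * f y) := by
    refine setLIntegral_dyadic_le_of_cells hL hkk fun y _ => ?_
    set m := cellMean p w a L k₀ y with hm
    have hm0 : 0 < m := hμ y
    have hmz : ∀ z ∈ dyadic a L k₀ y, cellMean p w a L k₀ z = m := fun z hz =>
      cellMean_eq_of_mem hL hz
    calc ∫⁻ z in dyadic a L k₀ y, ENNReal.ofReal (cellGauge p pinf w a L k₀ z)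
        ≤ ∫⁻ z in dyadic a L k₀ y, ENNReal.ofReal (m ^ pinf) *
            (ENNReal.ofReal (f z) + ENNReal.ofReal 1) := by
          refine setLIntegral_mono' measurableSet_dyadic fun z hz => ?_
          rw [← ENNReal.ofReal_add (hf0 z) zero_le_one, ← ENNReal.ofReal_mul (by positivity)]
          refine ENNReal.ofReal_le_ofReal ?_
          rw [cellGauge, hmz z hz]
          refine mul_le_mul_of_nonneg_left ?_ (by positivity)
          exact max_one_rpow_le (div_nonneg (hw.pos z).le (hμ z).le)
      _ = ENNReal.ofReal (m ^ pinf) * ((∫⁻ z in dyadic a L k₀ y, ENNReal.ofReal (f z)) +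
            ENNReal.ofReal (1 * (L / 2 ^ k₀) ^ n)) := by
          rw [lintegral_const_mul' _ _ ENNReal.ofReal_ne_top,
            lintegral_add_right _ measurable_const, lintegral_dyadic_const hL zero_le_one]
      _ ≤ ENNReal.ofReal (m ^ pinf) * ((∫⁻ z in dyadic a L k₀ y, ENNReal.ofReal (f z)) +
            ENNReal.ofReal C₀ * ∫⁻ z in dyadic a L k₀ y, ENNReal.ofReal (f z)) := by
          rw [one_mul]
          gcongr
          exact (lintegral_cell_ratio_le h hw hL hk).2
      _ = ∫⁻ z in dyadic a L k₀ y, ENNReal.ofReal (1 + C₀) *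
            (ENNReal.ofReal (m ^ pinf) * ENNReal.ofReal (f z)) := by
          rw [lintegral_const_mul' _ _ ENNReal.ofReal_ne_top,
            lintegral_const_mul' _ _ ENNReal.ofReal_ne_top,
            ENNReal.ofReal_add zero_le_one (by linarith), ENNReal.ofReal_one]
          ring
      _ = _ := by
          refine setLIntegral_congr_fun measurableSet_dyadic fun z hz => ?_
          simp only [hmz z hz]
          rw [← ENNReal.ofReal_mul (by positivity)]
  have step2 : ∀ y ∈ R, cellMean p w a L k₀ y ^ pinf * f y ≤
      N ^ pinf * (Kc * ((w y / N) ^ p y + decayWeight y * f y)) := by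
    intro y hy
    have h1 := (h.rpow_compare hB1 (div_pos (hμ y) hN0) (hμB y hy) y).1
    have h2 : cellMean p w a L k₀ y ^ pinf = N ^ pinf * (cellMean p w a L k₀ y / N) ^ pinf := by
      rw [← Real.mul_rpow hN0.le (div_nonneg (hμ y).le hN0.le), mul_div_cancel₀ _ hN0.ne']
    have h3 : (w y / N) ^ p y = (cellMean p w a L k₀ y / N) ^ p y * f y := by
      rw [hf, ← Real.mul_rpow (div_nonneg (hμ y).le hN0.le)
        (div_nonneg (hw.pos y).le (hμ y).le)]
      congr 1
      have := (hμ y).ne'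
      field_simp
    rw [h2, h3, mul_assoc, ← add_mul, ← mul_assoc Kc]
    exact mul_le_mul_of_nonneg_left (mul_le_mul_of_nonneg_right h1 (hf0 y)) (by positivity)
  -- The decay weight is nearly constant on a cell and `f` has bounded mean there, so `f` can be
  -- dropped at the cost of a constant.
  have step3 : ∫⁻ y in R, ENNReal.ofReal (decayWeight y * f y) ≤
      ENNReal.ofReal (Ch * (Ch * C₀)) * ENNReal.ofReal H := by
    calc ∫⁻ y in R, ENNReal.ofReal (decayWeight y * f y)
        ≤ ∫⁻ y in R, ENNReal.ofReal (Ch * (Ch * C₀)) * ENNReal.ofReal (decayWeight y) := by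
          refine setLIntegral_dyadic_le_of_cells hL hkk fun y _ => ?_
          have hd := decayWeight_pos y
          calc ∫⁻ z in dyadic a L k₀ y, ENNReal.ofReal (decayWeight z * f z)
              ≤ ∫⁻ z in dyadic a L k₀ y, ENNReal.ofReal (Ch * decayWeight y) *
                  ENNReal.ofReal (f z) := by
                refine setLIntegral_mono' measurableSet_dyadic fun z hz => ?_
                rw [← ENNReal.ofReal_mul (by positivity)]
                refine ENNReal.ofReal_le_ofReal ?_
                exact mul_le_mul_of_nonneg_right
                  (hCh _ _ hl0 hk z hz y (self_mem_dyadic hL)) (hf0 z)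
            _ = ENNReal.ofReal (Ch * decayWeight y) *
                  ∫⁻ z in dyadic a L k₀ y, ENNReal.ofReal (f z) :=
                lintegral_const_mul' _ _ ENNReal.ofReal_ne_top
            _ ≤ ENNReal.ofReal (Ch * decayWeight y) *
                  ENNReal.ofReal (C₀ * (L / 2 ^ k₀) ^ n) := by
                gcongr
                exact (lintegral_cell_ratio_le h hw hL hk).1
            _ = ∫⁻ _z in dyadic a L k₀ y, ENNReal.ofReal (Ch * C₀ * decayWeight y) := by
                rw [lintegral_dyadic_const hL (by positivity), ← ENNReal.ofReal_mul (by positivity)]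
                congr 1; ring
            _ ≤ _ := by
                refine setLIntegral_mono' measurableSet_dyadic fun z hz => ?_
                rw [← ENNReal.ofReal_mul (by positivity)]
                refine ENNReal.ofReal_le_ofReal ?_
                have h1 := hCh _ _ hl0 hk y (self_mem_dyadic hL) z hz
                have h2 : 0 ≤ Ch * C₀ := by positivity
                have h3 := mul_le_mul_of_nonneg_left h1 h2
                linarith
      _ = ENNReal.ofReal (Ch * (Ch * C₀)) * ∫⁻ y in R, ENNReal.ofReal (decayWeight y) :=
          lintegral_const_mul' _ _ ENNReal.ofReal_ne_top
      _ ≤ _ := by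
          gcongr
          exact (setLIntegral_le_lintegral _ _).trans hH
  have hmod : ∫⁻ y in R, ENNReal.ofReal ((w y / N) ^ p y) ≤ ENNReal.ofReal (2 ^ P) := by
    have h1 := modular_varNorm_le h.pos h.upper hN0 (hw.varNorm_eq _ _ hl)
    rwa [modular_indicator h.pos (measurableSet_box _ _) fun y => (hw.pos y).le] at h1
  calc ∫⁻ y in R, ENNReal.ofReal (cellGauge p pinf w a L k₀ y)
      ≤ ENNReal.ofReal (1 + C₀) *
        ∫⁻ y in R, ENNReal.ofReal (cellMean p w a L k₀ y ^ pinf * f y) := by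
        rw [← lintegral_const_mul' _ _ ENNReal.ofReal_ne_top]; exact step1
    _ ≤ ENNReal.ofReal (1 + C₀) * ∫⁻ y in R, ENNReal.ofReal (N ^ pinf * Kc) *
        (ENNReal.ofReal ((w y / N) ^ p y) + ENNReal.ofReal (decayWeight y * f y)) := by
        refine mul_le_mul' le_rfl (setLIntegral_mono' measurableSet_dyadic fun y hy => ?_)
        rw [← ENNReal.ofReal_add (Real.rpow_nonneg (div_nonneg (hw.pos y).le hN0.le) _)
          (mul_nonneg (decayWeight_pos y).le (hf0 y)), ← ENNReal.ofReal_mul (by positivity)]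
        refine ENNReal.ofReal_le_ofReal ((step2 y hy).trans (le_of_eq ?_))
        ring
    _ = ENNReal.ofReal (1 + C₀) * (ENNReal.ofReal (N ^ pinf * Kc) *
        ((∫⁻ y in R, ENNReal.ofReal ((w y / N) ^ p y)) +
          ∫⁻ y in R, ENNReal.ofReal (decayWeight y * f y))) := by
        rw [lintegral_const_mul' _ _ ENNReal.ofReal_ne_top,
          lintegral_add_right _ (Measurable.ennreal_ofReal (measurable_decayWeight.fun_mul hfm))]
    _ ≤ ENNReal.ofReal (1 + C₀) * (ENNReal.ofReal (N ^ pinf * Kc) *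
        (ENNReal.ofReal (2 ^ P) + ENNReal.ofReal (Ch * (Ch * C₀)) * ENNReal.ofReal H)) := by
        gcongr
    _ = ENNReal.ofReal ((1 + C₀) * (Kc * (2 ^ P + Ch * (Ch * C₀) * H)) * N ^ pinf) := by
        rw [← ENNReal.ofReal_mul (by positivity), ← ENNReal.ofReal_add (by positivity)
          (by positivity), ← ENNReal.ofReal_mul (by positivity),
          ← ENNReal.ofReal_mul (by positivity)]
        congr 1; ring
    _ ≤ _ := by
        refine ENNReal.ofReal_le_ofReal ?_
        gcongr
        exact le_max_right _ _

/-- On every dyadic cell the gauge is bounded below by a fraction of its mean on half of the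
cell. -/
theorem exists_cellGauge_good (n : ℕ) (pm P Cd Ci : ℝ) : ∃ D : ℝ,
    ∀ (p : RSpace n → ℝ) (pinf : ℝ), LogHolderClass pm P Cd Ci p pinf →
    ∀ (w : RSpace n → ℝ) (K : ℝ), ScalarAinf p w K →
    ∀ (a : Fin n → ℝ) (L : ℝ) (k₀ : ℕ), 0 < L → L / 2 ^ k₀ ≤ 1 → (k₀ = 0 ∨ 1 / 2 ≤ L / 2 ^ k₀) →
    0 ≤ D + P * Real.log K ∧
    ∀ k x, volume (dyadic a L k x) ≤ 2 * volume {y ∈ dyadic a L k x |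
      ENNReal.ofReal (Real.exp (-(2 * (D + P * Real.log K)))) *
        dyadicMean a L (fun y => ENNReal.ofReal (cellGauge p pinf w a L k₀ y)) k x <
      ENNReal.ofReal (cellGauge p pinf w a L k₀ y)} := by
  obtain ⟨C₁, hC₁, hlarge⟩ := exists_lintegral_cellGauge_le n pm P Cd Ci
  obtain ⟨C₂, hC₂, hind⟩ := exists_indNorm_large n pm P Cd Ci
  set c := P / pm * (modConst n pm P Cd + 1) with hc
  -- One constant serves both regimes: `smallConst` for small cells, `C₁`, `C₂` and `c` for large
  -- ones, and `1` from the density lemma. The absolute value keeps `κ` nonnegative.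
  refine ⟨|smallConst n pm P Cd| + Real.log C₁ + P * Real.log C₂ + 1 + c, ?_⟩
  intro p pinf h w K hw a L k₀ hL hk hk2
  have hpm := h.pm_pos
  have hP := h.P_pos
  have hM := h.one_le_modConst
  have hK := hw.one_le
  have hc0 : 0 ≤ c := by positivity
  have hlK : 0 ≤ Real.log K := Real.log_nonneg hK
  have hl1 : 0 ≤ Real.log C₁ := Real.log_nonneg hC₁
  have hl2 : 0 ≤ P * Real.log C₂ := mul_nonneg hP.le (Real.log_nonneg hC₂)
  set κ := |smallConst n pm P Cd| + Real.log C₁ + P * Real.log C₂ + P * Real.log K with hκ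
  have hκ0 : 0 ≤ κ := by positivity
  have hD : |smallConst n pm P Cd| + Real.log C₁ + P * Real.log C₂ + 1 + c + P * Real.log K =
      κ + 1 + c := by rw [hκ]; ring
  rw [hD]
  refine ⟨by linarith, fun k x => ?_⟩
  have hvm := measurable_cellGauge (pinf := pinf) (a := a) (L := L) (k₀ := k₀) h.measurable
    hw.measurable
  have hvpos : ∀ y, 0 < cellGauge p pinf w a L k₀ y := fun y => cellGauge_pos h hw hL hk
  have hVreal := volume_real_dyadic (a := a) (k := k) (x := x) hL
  have hl : 0 < L / 2 ^ k := by positivity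
  rcases le_or_gt k₀ k with hkk | hkk
  · obtain ⟨hI, hle⟩ := dyadicMean_cellGauge_le_small (a := a) (x := x) h hw hL hk hkk
    refine measure_le_two_mul_of_log_mean_le measurableSet_dyadic (volume_dyadic_ne_zero hL)
      (volume_dyadic_ne_top hL) hvm hvpos hI (F := fun _ => 0) integrableOn_zero
      (fun y _ => by simp) rfl hκ0 hc0 (hle.trans (ENNReal.ofReal_le_ofReal ?_)) ?_
    · refine Real.exp_le_exp.2 ?_
      have := le_abs_self (smallConst n pm P Cd)
      linarith
    · simpa using mul_nonneg hc0 measureReal_nonneg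
  -- A generation `k < k₀` excludes `k₀ = 0`. Such a cell has edge at least `2 * (1 / 2) = 1`, hence
  -- qualifies as large.
  · have hhalf : 1 / 2 ≤ L / 2 ^ k₀ := hk2.resolve_left (by omega)
    have hlone : 1 ≤ L / 2 ^ k := by
      have h1 : L / 2 ^ k = 2 ^ (k₀ - k) * (L / 2 ^ k₀) := by
        have : (2 : ℝ) ^ k₀ = 2 ^ (k₀ - k) * 2 ^ k := by rw [← pow_add]; congr 1; omega
        rw [this]; field_simp
      have h2 : (2 : ℝ) ≤ 2 ^ (k₀ - k) := by
        calc (2 : ℝ) = 2 ^ 1 := (pow_one _).symm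
          _ ≤ _ := pow_le_pow_right₀ (by norm_num) (by omega)
      rw [h1]; nlinarith
    set R := dyadic a L k x with hR
    set V := volume.real R with hV
    have hV0 : 0 < V := by rw [hVreal]; positivity
    obtain ⟨he, ht, -⟩ := hind p pinf h (dyadicCorner a L k x) _ hlone
    rw [← dyadic_eq_box, ← hR] at ht
    have hlw : IntegrableOn (fun y => Real.log (w y)) R := hw.integrableOn_log _ _ hl
    have hum : Measurable fun y => cellTrunc p w a L k₀ y ^ p y :=
      (measurable_cellTrunc hw.measurable).pow h.measurable
    obtain ⟨huI, hule⟩ := integrableOn_and_setIntegral_le (R := R) hum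
      (fun y => Real.rpow_nonneg cellTrunc_pos.le _) (by positivity)
      (lintegral_cellTrunc_le (a := a) (x := x) h hw hL hk hkk.le)
    -- On large cells the geometric mean of `w ^ pinf` replaces that of the gauge. As `w ≤ m * u`,
    -- `pinf * log w` exceeds the logarithm of the gauge by at most `pinf * log u ≤ (P / pm) * u ^
    -- p`, whose mean is at most `c`.
    refine measure_le_two_mul_of_log_mean_le measurableSet_dyadic (volume_dyadic_ne_zero hL)
      (volume_dyadic_ne_top hL) hvm hvpos (g := fun y => pinf * Real.log (w y))
      (F := fun y => P / pm * cellTrunc p w a L k₀ y ^ p y) (hlw.const_mul pinf)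
      (huI.const_mul (P / pm)) (fun y _ => ?_) rfl hκ0 hc0 ?_ ?_
    · have hm0 : 0 < cellMean p w a L k₀ y := cellMean_pos h hw hL hk
      have hu1 := one_le_cellTrunc (p := p) (w := w) (a := a) (L := L) (k₀ := k₀) (x := y)
      have hu0 := cellTrunc_pos (p := p) (w := w) (a := a) (L := L) (k₀ := k₀) (x := y)
      rw [log_cellGauge h hw hL hk]
      have h1 : Real.log (w y) ≤ Real.log (cellMean p w a L k₀ y) +
          Real.log (cellTrunc p w a L k₀ y) := by
        rw [← Real.log_mul hm0.ne' hu0.ne']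
        refine Real.log_le_log (hw.pos y) ?_
        rw [← div_le_iff₀' hm0]
        exact le_max_left _ _
      have h2 : 0 ≤ Real.log (cellTrunc p w a L k₀ y) := Real.log_nonneg hu1
      have h3 : Real.log (cellTrunc p w a L k₀ y) ≤ 1 / pm * cellTrunc p w a L k₀ y ^ p y :=
        log_le_rpow_div h hu0
      have h4 : pinf * Real.log (cellTrunc p w a L k₀ y) ≤
          P * (1 / pm * cellTrunc p w a L k₀ y ^ p y) := by
        have := h.le_P; have := h.pinf_pos
        gcongr
      have h5 : 0 ≤ p y * Real.log (cellTrunc p w a L k₀ y) := mul_nonneg (h.pos y).le h2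
      have h6 := mul_le_mul_of_nonneg_left h1 h.pinf_pos.le
      have h7 : P / pm * cellTrunc p w a L k₀ y ^ p y =
        P * (1 / pm * cellTrunc p w a L k₀ y ^ p y) := by ring
      rw [h7]
      linarith
    · have hN0 : 0 < setNorm p w R := hw.setNorm_pos _ _ hl
      have hpinf := h.pinf_pos
      set J := (∫ y in R, Real.log (w y)) / V with hJ
      have hN : setNorm p w R ≤ K * Real.exp J * (C₂ * (L / 2 ^ k) ^ ((n : ℝ) / pinf)) := by
        have h1 : setNorm p w R ≤ K * Real.exp J * indNorm p R := by
          rw [hJ, hVreal]; exact hw.setNorm_le _ _ hl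
        exact h1.trans (mul_le_mul_of_nonneg_left ht (by positivity))
      have hpow : setNorm p w R ^ pinf ≤
          K ^ P * Real.exp (pinf * J) * (C₂ ^ P * V) := by
        have h1 : ((L / 2 ^ k) ^ ((n : ℝ) / pinf)) ^ pinf = V := by
          rw [hVreal, ← Real.rpow_mul hl.le, div_mul_cancel₀ _ hpinf.ne', Real.rpow_natCast]
        calc setNorm p w R ^ pinf
            ≤ (K * Real.exp J * (C₂ * (L / 2 ^ k) ^ ((n : ℝ) / pinf))) ^ pinf :=
              Real.rpow_le_rpow hN0.le hN hpinf.le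
          _ = K ^ pinf * Real.exp (pinf * J) * (C₂ ^ pinf * V) := by
              rw [Real.mul_rpow (by positivity) (by positivity),
                Real.mul_rpow (by positivity) (by positivity),
                Real.mul_rpow (by positivity) (by positivity), h1, ← Real.exp_mul, mul_comm J]
          _ ≤ _ := by
              gcongr
              · exact h.le_P
              · exact h.le_P
      have h2 := hlarge p pinf h w K hw a L k₀ hL hk hhalf k hkk.le x
      rw [ENNReal.div_le_iff (volume_dyadic_ne_zero hL) (volume_dyadic_ne_top hL),
        ← ENNReal.ofReal_toReal (volume_dyadic_ne_top hL), ← ENNReal.ofReal_mul (by positivity)]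
      refine h2.trans (ENNReal.ofReal_le_ofReal ?_)
      change C₁ * setNorm p w R ^ pinf ≤ Real.exp (κ + (∫ y in R, pinf * Real.log (w y)) / V) * V
      rw [integral_const_mul, mul_div_assoc, ← hJ]
      have h3 : C₁ * (K ^ P * Real.exp (pinf * J) * (C₂ ^ P * V)) =
          Real.exp (Real.log C₁ + P * Real.log C₂ + P * Real.log K + pinf * J) * V := by
        rw [Real.exp_add, Real.exp_add, Real.exp_add, Real.exp_log (by linarith),
          Real.rpow_def_of_pos (by linarith : 0 < K), Real.rpow_def_of_pos (by linarith : 0 < C₂),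
          mul_comm (Real.log K), mul_comm (Real.log C₂)]
        ring
      calc C₁ * setNorm p w R ^ pinf
          ≤ C₁ * (K ^ P * Real.exp (pinf * J) * (C₂ ^ P * V)) := by gcongr
        _ = Real.exp (Real.log C₁ + P * Real.log C₂ + P * Real.log K + pinf * J) * V := h3
        _ ≤ _ := by
          have := abs_nonneg (smallConst n pm P Cd)
          gcongr
          rw [hκ]; linarith
    · rw [integral_const_mul, hc, mul_assoc]
      gcongr
      rw [← hV, hVreal]
      exact hule

/-! ### Reverse Hölder inequality for scalar weights. -/

theorem gehring_of_lintegral_le {n : ℕ} {a : Fin n → ℝ} {L : ℝ} (hL : 0 < L) {v : RSpace n → ℝ}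
    (hv : Measurable v) (hv0 : ∀ x, 0 ≤ v x) {γ : ℝ} (hγ : 0 < γ) (hγ1 : γ ≤ 1)
    (hgood : ∀ k x, volume (dyadic a L k x) ≤
      2 * volume {y ∈ dyadic a L k x | ENNReal.ofReal γ *
        dyadicMean a L (fun y => ENNReal.ofReal (v y)) k x < ENNReal.ofReal (v y)})
    {r : ℝ} (hr : 1 < r) (hr2 : r ≤ 2) (hrγ : (r - 1) * 2 ^ (n + 2) ≤ γ ^ 2)
    {k : ℕ} {x : RSpace n} {X : ℝ} (hX : 0 < X)
    (h : ∫⁻ y in dyadic a L k x, ENNReal.ofReal (v y) ≤ ENNReal.ofReal (X * (L / 2 ^ k) ^ n)) :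
    ∫⁻ y in dyadic a L k x, ENNReal.ofReal (v y ^ r) ≤
      ENNReal.ofReal (2 * X ^ r * (L / 2 ^ k) ^ n) := by
  have hl : 0 < (L / 2 ^ k) ^ n := by positivity
  have h1 := gehring (x₀ := x) (k := k) hL hv hv0 (ne_top_of_le_ne_top ENNReal.ofReal_ne_top h)
    hγ hγ1 (fun j _ y _ => hgood j y) (sub_pos.2 hr) (by linarith) hrγ
  rw [add_sub_cancel] at h1
  have hmean : dyadicMean a L (fun y => ENNReal.ofReal (v y)) k x ≤ ENNReal.ofReal X := by
    rw [dyadicMean, ENNReal.div_le_iff (volume_dyadic_ne_zero hL) (volume_dyadic_ne_top hL),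
      volume_dyadic hL, ← ENNReal.ofReal_mul hX.le]
    exact h
  refine h1.trans ?_
  calc 2 * dyadicMean a L (fun y => ENNReal.ofReal (v y)) k x ^ (r - 1) *
        ∫⁻ y in dyadic a L k x, ENNReal.ofReal (v y)
      ≤ 2 * ENNReal.ofReal X ^ (r - 1) * ENNReal.ofReal (X * (L / 2 ^ k) ^ n) := by gcongr
    _ = ENNReal.ofReal (2 * X ^ (r - 1) * (X * (L / 2 ^ k) ^ n)) := by
        rw [ENNReal.ofReal_rpow_of_nonneg hX.le (by linarith), ← ENNReal.ofReal_ofNat,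
          ← ENNReal.ofReal_mul (by norm_num), ← ENNReal.ofReal_mul (by positivity)]
    _ = _ := by
        congr 1
        have : X ^ r = X ^ (r - 1) * X := by
          rw [← Real.rpow_add_one hX.ne', sub_add_cancel]
        rw [this]; ring

theorem exists_half_le_div_two_pow {L : ℝ} (hL : 1 < L) :
    ∃ k : ℕ, L / 2 ^ k ≤ 1 ∧ 1 / 2 ≤ L / 2 ^ k := by
  obtain ⟨j, h1, h2⟩ := exists_nat_pow_near hL.le (by norm_num : (1 : ℝ) < 2)
  refine ⟨j + 1, (div_le_one (by positivity)).2 h2.le, ?_⟩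
  rw [le_div_iff₀ (by positivity), pow_succ]
  linarith

section Scalar

variable {n : ℕ} {pm P Cd Ci : ℝ} {p : RSpace n → ℝ} {pinf : ℝ} {w : RSpace n → ℝ} {K : ℝ}
  {a : Fin n → ℝ} {L : ℝ} {k₀ k : ℕ} {x y : RSpace n}

theorem cellGauge_rpow (h : LogHolderClass pm P Cd Ci p pinf) (hw : ScalarAinf p w K) (hL : 0 < L)
    (hk : L / 2 ^ k₀ ≤ 1) (r : ℝ) : cellGauge p pinf w a L k₀ x ^ r =
      cellMean p w a L k₀ x ^ (r * pinf) * cellTrunc p w a L k₀ x ^ (r * p x) := by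
  have h1 : 0 < cellMean p w a L k₀ x := cellMean_pos h hw hL hk
  have h2 := cellTrunc_pos (p := p) (w := w) (a := a) (L := L) (k₀ := k₀) (x := x)
  rw [cellGauge, Real.mul_rpow (by positivity) (by positivity), ← Real.rpow_mul h1.le,
    ← Real.rpow_mul h2.le, mul_comm pinf, mul_comm (p x)]

/-- The reverse Hölder inequality on a cell of generation `k₀`. -/
theorem lintegral_cellTrunc_rpow_le (h : LogHolderClass pm P Cd Ci p pinf) (hw : ScalarAinf p w K)
    (hL : 0 < L) (hk : L / 2 ^ k₀ ≤ 1) {γ : ℝ} (hγ : 0 < γ) (hγ1 : γ ≤ 1)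
    (hgood : ∀ k x, volume (dyadic a L k x) ≤
      2 * volume {y ∈ dyadic a L k x | ENNReal.ofReal γ *
        dyadicMean a L (fun y => ENNReal.ofReal (cellGauge p pinf w a L k₀ y)) k x <
          ENNReal.ofReal (cellGauge p pinf w a L k₀ y)})
    {r : ℝ} (hr : 1 < r) (hr2 : r ≤ 2) (hrγ : (r - 1) * 2 ^ (n + 2) ≤ γ ^ 2) :
    ∫⁻ y in dyadic a L k₀ x, ENNReal.ofReal (cellTrunc p w a L k₀ y ^ (r * p y)) ≤
      ENNReal.ofReal (2 * (modConst n pm P Cd + 1) ^ 2 * (L / 2 ^ k₀) ^ n) := by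
  have hC := h.one_le_modConst
  set C := modConst n pm P Cd with hCdef
  set m := cellMean p w a L k₀ x with hm
  have hm0 : 0 < m := cellMean_pos h hw hL hk
  have hmy : ∀ y ∈ dyadic a L k₀ x, cellMean p w a L k₀ y = m := fun y hy =>
    cellMean_eq_of_mem hL hy
  have h1 : ∫⁻ y in dyadic a L k₀ x, ENNReal.ofReal (cellGauge p pinf w a L k₀ y) ≤
      ENNReal.ofReal (m ^ pinf * (C + 1) * (L / 2 ^ k₀) ^ n) := by
    calc ∫⁻ y in dyadic a L k₀ x, ENNReal.ofReal (cellGauge p pinf w a L k₀ y)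
        = ∫⁻ y in dyadic a L k₀ x, ENNReal.ofReal (m ^ pinf) *
            ENNReal.ofReal (cellTrunc p w a L k₀ y ^ p y) := by
          refine setLIntegral_congr_fun measurableSet_dyadic fun y hy => ?_
          rw [← ENNReal.ofReal_mul (by positivity)]
          simp only [cellGauge, hmy y hy]
      _ = ENNReal.ofReal (m ^ pinf) *
            ∫⁻ y in dyadic a L k₀ x, ENNReal.ofReal (cellTrunc p w a L k₀ y ^ p y) :=
          lintegral_const_mul' _ _ ENNReal.ofReal_ne_top
      _ ≤ ENNReal.ofReal (m ^ pinf) * ENNReal.ofReal ((C + 1) * (L / 2 ^ k₀) ^ n) := by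
          gcongr
          exact lintegral_cellTrunc_le h hw hL hk le_rfl
      _ = _ := by rw [← ENNReal.ofReal_mul (by positivity), mul_assoc]
  have h2 := gehring_of_lintegral_le hL
    (measurable_cellGauge (pinf := pinf) h.measurable hw.measurable)
    (fun y => (cellGauge_pos h hw hL hk).le) hγ hγ1 hgood hr hr2 hrγ (by positivity) h1
  have hmr : 0 < m ^ (r * pinf) := by positivity
  have hmul : m ^ (r * pinf) * (2 * (C + 1) ^ r * (L / 2 ^ k₀) ^ n) =
      2 * (m ^ pinf * (C + 1)) ^ r * (L / 2 ^ k₀) ^ n := by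
    rw [Real.mul_rpow (by positivity) (by positivity), ← Real.rpow_mul hm0.le, mul_comm r]
    ring
  have h3 : ENNReal.ofReal (m ^ (r * pinf)) *
      ∫⁻ y in dyadic a L k₀ x, ENNReal.ofReal (cellTrunc p w a L k₀ y ^ (r * p y)) ≤
      ENNReal.ofReal (m ^ (r * pinf)) *
        ENNReal.ofReal (2 * (C + 1) ^ r * (L / 2 ^ k₀) ^ n) := by
    rw [← ENNReal.ofReal_mul hmr.le, hmul, ← lintegral_const_mul' _ _ ENNReal.ofReal_ne_top]
    refine le_trans (le_of_eq ?_) h2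
    refine setLIntegral_congr_fun measurableSet_dyadic fun y hy => ?_
    rw [← ENNReal.ofReal_mul hmr.le]
    simp only [cellGauge_rpow h hw hL hk, hmy y hy]
  rw [ENNReal.mul_le_mul_iff_right (by simpa using hmr) ENNReal.ofReal_ne_top] at h3
  refine h3.trans (ENNReal.ofReal_le_ofReal ?_)
  gcongr
  rw [← Real.rpow_natCast]
  exact Real.rpow_le_rpow_of_exponent_le (by linarith) (by exact_mod_cast hr2)

theorem ratio_le_cellTrunc : w x / cellMean p w a L k₀ x ≤ cellTrunc p w a L k₀ x := le_max_left _ _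

/-- The reverse Hölder inequality on boxes of edge length at most `1`. -/
theorem varNorm_mul_exponent_le_small (h : LogHolderClass pm P Cd Ci p pinf)
    (hw : ScalarAinf p w K) (hL : 0 < L) (hL1 : L ≤ 1) {r : ℝ} (hr : 1 < r) (hr2 : r ≤ 2)
    {M : ℝ} (hM : 1 ≤ M)
    (hint : ∀ x, ∫⁻ y in dyadic a L 0 x, ENNReal.ofReal (cellTrunc p w a L 0 y ^ (r * p y)) ≤
      ENNReal.ofReal (M * (L / 2 ^ 0) ^ n)) :
    varNorm (fun x => r * p x) ((box a L).indicator w) ≤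
      ENNReal.ofReal ((M * boxConst n pm (2 * P) (2 * Cd)) ^ (1 / pm) *
        (setNorm p w (box a L) / indNorm p (box a L)) *
          indNorm (fun x => r * p x) (box a L)) := by
  have h' := h.const_mul hr.le hr2
  have hpm := h.pm_pos
  set C' := boxConst n pm (2 * P) (2 * Cd) with hC'
  have hC'1 : 1 ≤ C' := h'.one_le_boxConst
  set t := indNorm (fun x => r * p x) (box a L) with ht
  have ht0 : 0 < t := h'.indNorm_small_pos a hL hL1
  have hx₀ : (WithLp.toLp 2 a : RSpace n) ∈ box a L := fun i => by
    simp only [mem_Ico]; exact ⟨le_rfl, by linarith⟩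
  set x₀ : RSpace n := WithLp.toLp 2 a with hx₀def
  have hQ : dyadic a L 0 x₀ = box a L := dyadic_zero hL hx₀
  set m := setNorm p w (box a L) / indNorm p (box a L) with hm
  have hm0 : 0 < m := div_pos (hw.setNorm_pos a L hL) (h.indNorm_small_pos a hL hL1)
  have hmy : ∀ y ∈ box a L, cellMean p w a L 0 y = m := by
    intro y hy
    rw [cellMean, dyadic_zero hL hy]
  rw [mul_assoc]
  refine varNorm_le_of_modular_le hpm h'.lower (by positivity) (by nlinarith) ?_
  rw [modular_indicator h'.pos (measurableSet_box _ _) fun y => (hw.pos y).le]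
  have hLn : 0 < L ^ n := by positivity
  calc ∫⁻ y in box a L, ENNReal.ofReal ((w y / (m * t)) ^ (r * p y))
      ≤ ∫⁻ y in box a L, ENNReal.ofReal (C' / L ^ n) *
          ENNReal.ofReal (cellTrunc p w a L 0 y ^ (r * p y)) := by
        refine setLIntegral_mono' (measurableSet_box a L) fun y hy => ?_
        rw [← ENNReal.ofReal_mul (by positivity)]
        refine ENNReal.ofReal_le_ofReal ?_
        have h1 : w y / (m * t) = (1 / t) * (w y / m) := by field_simp
        have h2 := (h'.indNorm_rpow_small a hL hL1 hy).2
        have h0 : 0 ≤ w y / m := div_nonneg (hw.pos y).le hm0.le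
        -- With `t` the indicator norm for `r * p`, this turns the modular of `w / (m * t)` into an
        -- average of `(w / m) ^ (r * p)`.
        have h3 : (1 / t) ^ (r * p y) ≤ C' / L ^ n := by
          rw [Real.div_rpow zero_le_one ht0.le, Real.one_rpow,
            div_le_div_iff₀ (by positivity) hLn, one_mul]
          exact h2
        have h4 : w y / m ≤ cellTrunc p w a L 0 y := by
          rw [← hmy y hy]; exact ratio_le_cellTrunc
        rw [h1, Real.mul_rpow (by positivity) h0]
        have h5 := (h'.pos y).le
        gcongr
    _ = ENNReal.ofReal (C' / L ^ n) *
          ∫⁻ y in box a L, ENNReal.ofReal (cellTrunc p w a L 0 y ^ (r * p y)) :=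
        lintegral_const_mul' _ _ ENNReal.ofReal_ne_top
    _ ≤ ENNReal.ofReal (C' / L ^ n) * ENNReal.ofReal (M * L ^ n) := by
        gcongr
        have := hint x₀
        rwa [hQ, pow_zero, div_one] at this
    _ = _ := by
        rw [← ENNReal.ofReal_mul (by positivity)]
        congr 1
        field_simp

end Scalar

/-- The reverse Hölder inequality on boxes of edge length at least `1`. -/
theorem exists_varNorm_mul_exponent_le_large (n : ℕ) (pm P Cd Ci : ℝ) : ∃ C : ℝ, 1 ≤ C ∧
    ∀ (p : RSpace n → ℝ) (pinf : ℝ), LogHolderClass pm P Cd Ci p pinf →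
    ∀ (w : RSpace n → ℝ) (K : ℝ), ScalarAinf p w K →
    ∀ (a : Fin n → ℝ) (L : ℝ) (k₀ : ℕ), 1 < L → L / 2 ^ k₀ ≤ 1 → 1 / 2 ≤ L / 2 ^ k₀ →
    ∀ γ : ℝ, 0 < γ → γ ≤ 1 →
    (∀ k x, volume (dyadic a L k x) ≤
      2 * volume {y ∈ dyadic a L k x | ENNReal.ofReal γ *
        dyadicMean a L (fun y => ENNReal.ofReal (cellGauge p pinf w a L k₀ y)) k x <
          ENNReal.ofReal (cellGauge p pinf w a L k₀ y)}) →
    ∀ r : ℝ, 1 < r → r ≤ 2 → (r - 1) * 2 ^ (n + 2) ≤ γ ^ 2 →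
    varNorm (fun x => r * p x) ((box a L).indicator w) ≤
      ENNReal.ofReal (C * (setNorm p w (box a L) / indNorm p (box a L)) *
          indNorm (fun x => r * p x) (box a L)) := by
  obtain ⟨H, hH1, hH⟩ := exists_lintegral_decayWeight_le n
  obtain ⟨Ch, hCh1, hCh⟩ := exists_decayWeight_le_mul n
  obtain ⟨C₁, hC₁, hlarge⟩ := exists_lintegral_cellGauge_le n pm P Cd Ci
  obtain ⟨C₂, hC₂, hind⟩ := exists_indNorm_large n pm P Cd Ci
  obtain ⟨C₂', hC₂', hind'⟩ := exists_indNorm_large n pm (2 * P) (2 * Cd) (2 * Ci)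
  set M := 2 * (modConst n pm P Cd + 1) ^ 2 with hM
  set B₀ : ℝ := 2 * C₁ ^ 2 * 2 ^ n with hB₀
  set B : ℝ := B₀ ^ (1 / pm) with hB
  set Kc := Real.exp ((((n : ℝ) + 1) / pm + Real.log B) * (2 * Ci)) with hKc
  set C₃ := max 1 (Kc * (2 * C₁ ^ 2 + Ch * (Ch * M) * H)) with hC₃
  have hC₃1 : 1 ≤ C₃ := le_max_left _ _
  refine ⟨max 1 (C₃ ^ (1 / pm) * (C₂ * C₂')), le_max_left _ _, ?_⟩
  intro p pinf h w K hw a L k₀ hL1 hk hk2 γ hγ hγ1 hgood r hr hr2 hrγ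
  have h' := h.const_mul hr.le hr2
  have hL : 0 < L := by linarith
  have hpm := h.pm_pos
  have hpinf := h.pinf_pos
  have hr0 : 0 < r := by linarith
  have hM0 : 0 ≤ M := by rw [hM]; have := h.one_le_modConst; positivity
  have hB₀1 : 1 ≤ B₀ := by
    have h1 : 1 ≤ C₁ ^ 2 := one_le_pow₀ hC₁
    have h2 : (1 : ℝ) ≤ 2 ^ n := one_le_pow₀ (by norm_num)
    rw [hB₀]; nlinarith
  have hB1 : 1 ≤ B := Real.one_le_rpow hB₀1 (by positivity)
  have hl0 : 0 < L / 2 ^ k₀ := by positivity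
  have hx₀ : (WithLp.toLp 2 a : RSpace n) ∈ box a L := fun i => by
    simp only [mem_Ico]; exact ⟨le_rfl, by linarith⟩
  set x₀ : RSpace n := WithLp.toLp 2 a with hx₀def
  have hQ : dyadic a L 0 x₀ = box a L := dyadic_zero hL hx₀
  set Q := box a L with hQdef
  set N := setNorm p w Q with hN
  have hN0 : 0 < N := hw.setNorm_pos _ _ hL
  set V := L ^ n with hV
  have hV0 : 0 < V := by positivity
  obtain ⟨-, ht, -⟩ := hind p pinf h a L hL1.le
  obtain ⟨-, -, ht'⟩ := hind' _ _ h' a L hL1.le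
  rw [← hQdef] at ht ht'
  set t := indNorm p Q with htdef
  set t' := indNorm (fun x => r * p x) Q with ht'def
  have ht'0 : 0 < t' := by
    have h1 : 0 < L ^ ((n : ℝ) / (r * pinf)) := by positivity
    exact pos_of_mul_pos_right (h1.trans_le ht') (by linarith)
  have ht0 : 0 < t := by
    obtain ⟨-, -, h1⟩ := hind p pinf h a L hL1.le
    have h2 : 0 < L ^ ((n : ℝ) / pinf) := by positivity
    exact pos_of_mul_pos_right (h2.trans_le h1) (by linarith)
  -- This is the target norm, with both indicator norms replaced by the powers of `L` they are
  -- comparable to. It satisfies `τ ^ (r * pinf) = N ^ (r * pinf) * V ^ (1 - r)`, the natural size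
  -- of `∫ v ^ r`.
  set τ := N * L ^ ((n : ℝ) / (r * pinf)) / L ^ ((n : ℝ) / pinf) with hτ
  have hτ0 : 0 < τ := by positivity
  have hτr : τ ^ (r * pinf) = N ^ (r * pinf) * V / V ^ r := by
    rw [hτ, Real.div_rpow (by positivity) (by positivity), Real.mul_rpow hN0.le (by positivity),
      ← Real.rpow_mul hL.le, ← Real.rpow_mul hL.le, div_mul_cancel₀ _ (by positivity),
      Real.rpow_natCast, hV, ← Real.rpow_natCast L n, ← Real.rpow_mul hL.le]
    congr 2
    field_simp
  set v := cellGauge p pinf w a L k₀ with hv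
  have hv0 : ∀ y, 0 < v y := fun y => cellGauge_pos h hw hL hk
  have hvm : Measurable v := measurable_cellGauge h.measurable hw.measurable
  have hvr : ∫⁻ y in Q, ENNReal.ofReal (v y ^ r) ≤
      ENNReal.ofReal (2 * C₁ ^ 2 * τ ^ (r * pinf)) := by
    have h1 := hlarge p pinf h w K hw a L k₀ hL hk hk2 0 (Nat.zero_le _) x₀
    have h2 : C₁ * setNorm p w (dyadic a L 0 x₀) ^ pinf =
        C₁ * N ^ pinf / V * (L / 2 ^ 0) ^ n := by
      rw [hQ, pow_zero, div_one, ← hV, ← hN]; field_simp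
    rw [h2] at h1
    have h3 := gehring_of_lintegral_le hL hvm (fun y => (hv0 y).le) hγ hγ1 hgood hr hr2 hrγ
      (by positivity) h1
    rw [hQ, pow_zero, div_one, ← hV] at h3
    refine h3.trans (ENNReal.ofReal_le_ofReal ?_)
    rw [hτr, Real.div_rpow (by positivity) hV0.le, Real.mul_rpow (by positivity) (by positivity),
      ← Real.rpow_mul hN0.le, mul_comm pinf]
    have h4 : C₁ ^ r ≤ C₁ ^ 2 := by
      rw [← Real.rpow_natCast]
      exact Real.rpow_le_rpow_of_exponent_le hC₁ (by exact_mod_cast hr2)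
    calc 2 * (C₁ ^ r * N ^ (r * pinf) / V ^ r) * V
        = 2 * C₁ ^ r * (N ^ (r * pinf) * V / V ^ r) := by ring
      _ ≤ _ := by gcongr
  -- Since `u ≥ 1`, the gauge dominates `m ^ pinf` on the whole cell, whose volume is at least `2 ^
  -- (-n)`; the bound on `∫ v ^ r` therefore limits each cell mean.
  have hμB : ∀ y ∈ Q, cellMean p w a L k₀ y / τ ≤ B := by
    intro y hy
    set m := cellMean p w a L k₀ y with hm
    have hm0 : 0 < m := cellMean_pos h hw hL hk
    have hsub : dyadic a L k₀ y ⊆ Q := by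
      rw [hQdef, ← dyadic_zero hL hy]; exact dyadic_subset hL (Nat.zero_le _)
    have h1 : ENNReal.ofReal (m ^ (r * pinf) * (L / 2 ^ k₀) ^ n) ≤
        ENNReal.ofReal (2 * C₁ ^ 2 * τ ^ (r * pinf)) := by
      rw [← lintegral_dyadic_const (a := a) (x := y) hL (by positivity)]
      refine le_trans (setLIntegral_mono' measurableSet_dyadic fun z hz => ?_)
        ((lintegral_mono_set hsub).trans hvr)
      refine ENNReal.ofReal_le_ofReal ?_
      rw [hv, cellGauge_rpow h hw hL hk, cellMean_eq_of_mem hL hz]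
      refine le_mul_of_one_le_right (by positivity) ?_
      exact Real.one_le_rpow one_le_cellTrunc (h'.pos z).le
    rw [ENNReal.ofReal_le_ofReal_iff (by positivity)] at h1
    have h2 : (1 / 2 : ℝ) ^ n ≤ (L / 2 ^ k₀) ^ n := by gcongr
    have h3 : (m / τ) ^ (r * pinf) ≤ B₀ := by
      rw [Real.div_rpow hm0.le hτ0.le, div_le_iff₀ (by positivity)]
      have h4 : m ^ (r * pinf) * (1 / 2) ^ n ≤ 2 * C₁ ^ 2 * τ ^ (r * pinf) :=
        le_trans (by gcongr) h1
      rw [one_div, inv_pow, ← div_eq_mul_inv, div_le_iff₀ (by positivity)] at h4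
      rw [hB₀]; linarith
    have h4 : m / τ ≤ B₀ ^ (1 / (r * pinf)) := by
      have h5 := Real.rpow_le_rpow (by positivity) h3 (by positivity : 0 ≤ 1 / (r * pinf))
      rwa [← Real.rpow_mul (by positivity), mul_one_div_cancel (by positivity),
        Real.rpow_one] at h5
    refine h4.trans (Real.rpow_le_rpow_of_exponent_le hB₀1 (one_div_le_one_div_of_le hpm ?_))
    exact h'.pm_le
  set u := cellTrunc p w a L k₀ with hu
  have hu0 : ∀ y, 0 < u y := fun y => cellTrunc_pos
  have hum : Measurable fun y => u y ^ (r * p y) :=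
    (measurable_cellTrunc hw.measurable).pow h'.measurable
  -- Use `w ≤ m * u` and exchange the exponent of `m / τ` only. The main term reassembles into `v ^
  -- r`; the error carries `u ^ (r * p)`, whose cell means are bounded by
  -- `lintegral_cellTrunc_rpow_le`.
  have hpt : ∀ y ∈ Q, (w y / τ) ^ (r * p y) ≤
      Kc * (1 / τ ^ (r * pinf) * v y ^ r + decayWeight y * u y ^ (r * p y)) := by
    intro y hy
    set m := cellMean p w a L k₀ y with hm
    have hm0 : 0 < m := cellMean_pos h hw hL hk
    have h1 := (h'.rpow_compare hB1 (div_pos hm0 hτ0) (hμB y hy) y).2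
    have h2 : w y / τ ≤ m / τ * u y := by
      have h3 : w y / m ≤ u y := ratio_le_cellTrunc
      rw [div_le_iff₀ hm0] at h3
      rw [div_mul_eq_mul_div]
      gcongr
      linarith
    have h3 : (w y / τ) ^ (r * p y) ≤ (m / τ) ^ (r * p y) * u y ^ (r * p y) := by
      rw [← Real.mul_rpow (by positivity) (hu0 y).le]
      exact Real.rpow_le_rpow (div_nonneg (hw.pos y).le hτ0.le) h2 (h'.pos y).le
    have h4 : 0 < u y ^ (r * p y) := Real.rpow_pos_of_pos (hu0 y) _
    refine h3.trans ((mul_le_mul_of_nonneg_right h1 h4.le).trans (le_of_eq ?_))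
    rw [hv, cellGauge_rpow h hw hL hk, ← hm, ← hu, Real.div_rpow hm0.le hτ0.le]
    ring
  have hdec : ∫⁻ y in Q, ENNReal.ofReal (decayWeight y * u y ^ (r * p y)) ≤
      ENNReal.ofReal (Ch * (Ch * M)) * ENNReal.ofReal H := by
    calc ∫⁻ y in Q, ENNReal.ofReal (decayWeight y * u y ^ (r * p y))
        ≤ ∫⁻ y in Q, ENNReal.ofReal (Ch * (Ch * M)) * ENNReal.ofReal (decayWeight y) := by
          rw [← hQ]
          refine setLIntegral_dyadic_le_of_cells hL (Nat.zero_le k₀) fun y _ => ?_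
          have hd := decayWeight_pos y
          calc ∫⁻ z in dyadic a L k₀ y, ENNReal.ofReal (decayWeight z * u z ^ (r * p z))
              ≤ ∫⁻ z in dyadic a L k₀ y, ENNReal.ofReal (Ch * decayWeight y) *
                  ENNReal.ofReal (u z ^ (r * p z)) := by
                refine setLIntegral_mono' measurableSet_dyadic fun z hz => ?_
                rw [← ENNReal.ofReal_mul (by positivity)]
                refine ENNReal.ofReal_le_ofReal ?_
                exact mul_le_mul_of_nonneg_right
                  (hCh _ _ hl0 hk z hz y (self_mem_dyadic hL)) (Real.rpow_nonneg (hu0 z).le _)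
            _ = ENNReal.ofReal (Ch * decayWeight y) *
                  ∫⁻ z in dyadic a L k₀ y, ENNReal.ofReal (u z ^ (r * p z)) :=
                lintegral_const_mul' _ _ ENNReal.ofReal_ne_top
            _ ≤ ENNReal.ofReal (Ch * decayWeight y) *
                  ENNReal.ofReal (M * (L / 2 ^ k₀) ^ n) := by
                gcongr
                exact lintegral_cellTrunc_rpow_le h hw hL hk hγ hγ1 hgood hr hr2 hrγ
            _ = ∫⁻ _z in dyadic a L k₀ y, ENNReal.ofReal (Ch * M * decayWeight y) := by
                rw [lintegral_dyadic_const hL (by positivity), ← ENNReal.ofReal_mul (by positivity)]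
                congr 1; ring
            _ ≤ _ := by
                refine setLIntegral_mono' measurableSet_dyadic fun z hz => ?_
                rw [← ENNReal.ofReal_mul (by positivity)]
                refine ENNReal.ofReal_le_ofReal ?_
                have h1 := hCh _ _ hl0 hk y (self_mem_dyadic hL) z hz
                have h2 : 0 ≤ Ch * M := by positivity
                have h3 := mul_le_mul_of_nonneg_left h1 h2
                linarith
      _ = ENNReal.ofReal (Ch * (Ch * M)) * ∫⁻ y in Q, ENNReal.ofReal (decayWeight y) :=
          lintegral_const_mul' _ _ ENNReal.ofReal_ne_top
      _ ≤ _ := by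
          gcongr
          exact (setLIntegral_le_lintegral _ _).trans hH
  have hmod : modular (fun x => r * p x) (Q.indicator w) τ ≤ ENNReal.ofReal C₃ := by
    rw [modular_indicator h'.pos (measurableSet_box _ _) fun y => (hw.pos y).le]
    calc ∫⁻ y in Q, ENNReal.ofReal ((w y / τ) ^ (r * p y))
        ≤ ∫⁻ y in Q, ENNReal.ofReal Kc * (ENNReal.ofReal (1 / τ ^ (r * pinf)) *
            ENNReal.ofReal (v y ^ r) + ENNReal.ofReal (decayWeight y * u y ^ (r * p y))) := by
          refine setLIntegral_mono' (measurableSet_box a L) fun y hy => ?_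
          have h1 := (hv0 y).le
          have h2 := (hu0 y).le
          have h3 := (decayWeight_pos y).le
          rw [← ENNReal.ofReal_mul (by positivity), ← ENNReal.ofReal_add (by positivity)
            (by positivity), ← ENNReal.ofReal_mul (by positivity)]
          exact ENNReal.ofReal_le_ofReal (hpt y hy)
      _ = ENNReal.ofReal Kc * (ENNReal.ofReal (1 / τ ^ (r * pinf)) *
            (∫⁻ y in Q, ENNReal.ofReal (v y ^ r)) +
            ∫⁻ y in Q, ENNReal.ofReal (decayWeight y * u y ^ (r * p y))) := by
          rw [lintegral_const_mul' _ _ ENNReal.ofReal_ne_top,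
            lintegral_add_left ((hvm.pow_const r).ennreal_ofReal.const_mul _),
            lintegral_const_mul' _ _ ENNReal.ofReal_ne_top]
      _ ≤ ENNReal.ofReal Kc * (ENNReal.ofReal (1 / τ ^ (r * pinf)) *
            ENNReal.ofReal (2 * C₁ ^ 2 * τ ^ (r * pinf)) +
            ENNReal.ofReal (Ch * (Ch * M)) * ENNReal.ofReal H) := by gcongr
      _ = ENNReal.ofReal (Kc * (2 * C₁ ^ 2 + Ch * (Ch * M) * H)) := by
          rw [← ENNReal.ofReal_mul (by positivity), ← ENNReal.ofReal_mul (by positivity),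
            ← ENNReal.ofReal_add (by positivity) (by positivity),
            ← ENNReal.ofReal_mul (by positivity)]
          congr 2
          field_simp
      _ ≤ _ := ENNReal.ofReal_le_ofReal (le_max_right _ _)
  refine (varNorm_le_of_modular_le hpm h'.lower hτ0 hC₃1 hmod).trans
    (ENNReal.ofReal_le_ofReal ?_)
  have hτle : τ ≤ C₂ * C₂' * (N / t) * t' := by
    rw [hτ, div_le_iff₀ (by positivity)]
    calc N * L ^ ((n : ℝ) / (r * pinf)) ≤ N * (C₂' * t') := by gcongr
      _ = C₂' * (N / t) * t' * t := by field_simp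
      _ ≤ C₂' * (N / t) * t' * (C₂ * L ^ ((n : ℝ) / pinf)) := by gcongr
      _ = _ := by ring
  calc C₃ ^ (1 / pm) * τ ≤ C₃ ^ (1 / pm) * (C₂ * C₂' * (N / t) * t') := by gcongr
    _ = C₃ ^ (1 / pm) * (C₂ * C₂') * (N / t) * t' := by ring
    _ ≤ _ := by
      gcongr
      exact le_max_right _ _

/-- The reverse Hölder inequality for scalar `𝒜_{p(·),∞}` weights. -/
theorem exists_scalar_reverse_holder (n : ℕ) (pm P Cd Ci : ℝ) : ∃ C δ : ℝ, 1 ≤ C ∧ 0 < δ ∧ δ ≤ 1 ∧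
    ∀ (p : RSpace n → ℝ) (pinf : ℝ), LogHolderClass pm P Cd Ci p pinf →
    ∀ (w : RSpace n → ℝ) (K : ℝ), ScalarAinf p w K →
    ∀ r : ℝ, 1 < r → r ≤ 1 + δ / K ^ (4 * P) → ∀ (a : Fin n → ℝ) (L : ℝ), 0 < L →
    varNorm (fun x => r * p x) ((box a L).indicator w) ≤
      ENNReal.ofReal (C * (setNorm p w (box a L) / indNorm p (box a L)) *
          indNorm (fun x => r * p x) (box a L)) := by
  obtain ⟨D, hD⟩ := exists_cellGauge_good n pm P Cd Ci
  obtain ⟨C₁, hC₁, hlarge⟩ := exists_varNorm_mul_exponent_le_large n pm P Cd Ci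
  set C₂ := (2 * (modConst n pm P Cd + 1) ^ 2 * boxConst n pm (2 * P) (2 * Cd)) ^ (1 / pm) with hC₂
  -- The Gehring condition reads `(r - 1) * 2 ^ (n + 2) ≤ γ ^ 2 = exp (-4 D) * K ^ (-4 P)`, which
  -- dictates this value and the power `4 * P`. The minimum with `1` ensures `r ≤ 2`.
  refine ⟨max C₁ C₂, min 1 (Real.exp (-(4 * D)) / 2 ^ (n + 2)), le_max_of_le_left hC₁,
    lt_min one_pos (by positivity), min_le_left _ _, ?_⟩
  intro p pinf h w K hw r hr hrK a L hL
  set δ := min 1 (Real.exp (-(4 * D)) / 2 ^ (n + 2)) with hδ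
  have hδ1 : δ ≤ 1 := min_le_left _ _
  have hδ2 : δ ≤ Real.exp (-(4 * D)) / 2 ^ (n + 2) := min_le_right _ _
  have hP := h.P_pos
  have hK := hw.one_le
  have hK0 : 0 < K := by linarith
  have hKP : 1 ≤ K ^ (4 * P) := Real.one_le_rpow hK (by positivity)
  have hδ0 : 0 < δ := lt_min one_pos (by positivity)
  have hr2 : r ≤ 2 := by
    have : δ / K ^ (4 * P) ≤ 1 := by rw [div_le_one (by positivity)]; linarith
    linarith
  have hM1 : 1 ≤ 2 * (modConst n pm P Cd + 1) ^ 2 := by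
    have := h.one_le_modConst; nlinarith
  set γ := Real.exp (-(2 * (D + P * Real.log K))) with hγ
  have hγ0 : 0 < γ := Real.exp_pos _
  have hγ2 : γ ^ 2 = Real.exp (-(4 * D)) / K ^ (4 * P) := by
    rw [hγ, ← Real.exp_nat_mul, Real.rpow_def_of_pos hK0, ← Real.exp_sub]
    congr 1; push_cast; ring
  have hrγ : (r - 1) * 2 ^ (n + 2) ≤ γ ^ 2 := by
    rw [hγ2, ← le_div_iff₀ (by positivity)]
    have h1 : r - 1 ≤ δ / K ^ (4 * P) := by linarith
    refine h1.trans ?_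
    rw [div_right_comm]
    gcongr
  have hpos : 0 ≤ setNorm p w (box a L) / indNorm p (box a L) :=
    div_nonneg (hw.setNorm_pos a L hL).le (indNorm_nonneg _ _)
  have hpos' := indNorm_nonneg (fun x => r * p x) (box a L)
  rcases le_or_gt L 1 with hL1 | hL1
  · have hk : L / 2 ^ 0 ≤ 1 := by simpa using hL1
    obtain ⟨hD0, hgood⟩ := hD p pinf h w K hw a L 0 hL hk (Or.inl rfl)
    have hγ1 : γ ≤ 1 := Real.exp_le_one_iff.2 (by linarith)
    refine (varNorm_mul_exponent_le_small h hw hL hL1 hr hr2 hM1 fun x =>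
      lintegral_cellTrunc_rpow_le h hw hL hk hγ0 hγ1 hgood hr hr2 hrγ).trans
      (ENNReal.ofReal_le_ofReal ?_)
    gcongr
    exact le_max_right _ _
  · obtain ⟨k₀, hk, hk2⟩ := exists_half_le_div_two_pow hL1
    obtain ⟨hD0, hgood⟩ := hD p pinf h w K hw a L k₀ hL hk (Or.inr hk2)
    have hγ1 : γ ≤ 1 := Real.exp_le_one_iff.2 (by linarith)
    refine (hlarge p pinf h w K hw a L k₀ hL1 hk hk2 γ hγ0 hγ1 hgood r hr hr2 hrγ).trans
      (ENNReal.ofReal_le_ofReal ?_)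
    gcongr
    exact le_max_left _ _

/-! ### From the given exponent conditions to the working class. -/

section Exponent

variable {n : ℕ} {p : RSpace n → ℝ} {C₀ Cinf pinf : ℝ}

theorem LocalLogHolder.continuous (h : LocalLogHolder C₀ p) : Continuous p := by
  obtain ⟨hC₀, h⟩ := h
  rw [Metric.continuous_iff]
  intro y ε hε
  refine ⟨min (1 / 4) (Real.exp (-(C₀ / ε) - 1)), lt_min (by norm_num) (Real.exp_pos _),
    fun x hx => ?_⟩
  rw [dist_eq_norm] at hx
  have hx1 : ‖x - y‖ < 1 / 4 := hx.trans_le (min_le_left _ _)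
  have hx2 : ‖x - y‖ < Real.exp (-(C₀ / ε) - 1) := hx.trans_le (min_le_right _ _)
  have h1 := h x y (by linarith)
  rw [Real.dist_eq]
  rcases (norm_nonneg (x - y)).eq_or_lt with h0 | h0
  · rw [← h0, Real.log_zero, div_zero] at h1
    linarith
  · have h2 : Real.log ‖x - y‖ < -(C₀ / ε) - 1 := (Real.log_lt_iff_lt_exp h0).2 hx2
    have h3 : 0 < C₀ / ε := by positivity
    have h4 : C₀ / ε < -Real.log ‖x - y‖ := by linarith
    refine h1.trans_lt ?_
    rw [neg_div, ← div_neg, div_lt_iff₀ (by linarith)]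
    rwa [div_lt_iff₀ hε, mul_comm] at h4

/-- The inequality holds almost everywhere, hence on a dense set, and continuity of `p` extends it
to every point. -/
theorem IsExponent.essInf_le (hp : IsExponent p) (h : LocalLogHolder C₀ p) (x : RSpace n) :
    essInf p volume ≤ p x := by
  have h1 : ∀ᵐ x, essInf p volume ≤ p x :=
    ae_essInf_le ⟨0, Filter.eventually_map.2 (Filter.Eventually.of_forall fun x => (hp.pos x).le)⟩
  have h2 : Dense {x | essInf p volume ≤ p x} := Measure.dense_of_ae h1
  have h3 : IsClosed {x | essInf p volume ≤ p x} := isClosed_le continuous_const h.continuous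
  have h4 : x ∈ closure {x | essInf p volume ≤ p x} := h2 x
  rwa [h3.closure_eq] at h4

/-- The upper bound comes from the decay condition, as the logarithm there is at least `1`; the
minimum in the lower bound places `pinf` in the same range. The two terms of the oscillation
constant treat boxes with `4 n l ≤ 1` and the others. -/
theorem IsExponent.logHolderClass (hn : 0 < n) (hp : IsExponent p) (h : LocalLogHolder C₀ p)
    (hinf : LogHolderAtInfty pinf Cinf p) :
    LogHolderClass (min (essInf p volume) pinf) (pinf + Cinf)
      (2 * C₀ + (pinf + Cinf) * Real.log (4 * n)) Cinf p pinf := by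
  obtain ⟨hpinf, hCinf, hdec⟩ := hinf
  have hlower := hp.essInf_le h
  obtain ⟨hC₀, hloc⟩ := h
  have hn1 : (1 : ℝ) ≤ n := by exact_mod_cast hn
  have hlog1 : ∀ x : RSpace n, 1 ≤ Real.log (Real.exp 1 + ‖x‖) := fun x => by
    rw [Real.le_log_iff_exp_le (by positivity)]; linarith [norm_nonneg x]
  have hupper : ∀ x, p x ≤ pinf + Cinf := by
    intro x
    have h1 := hdec x
    have h2 : Cinf / Real.log (Real.exp 1 + ‖x‖) ≤ Cinf := div_le_self hCinf.le (hlog1 x)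
    have h3 := le_abs_self (p x - pinf)
    linarith
  have hlog4 : 0 ≤ Real.log (4 * n) := Real.log_nonneg (by linarith)
  refine ⟨hp.measurable, lt_min hp.essInf_pos hpinf, by positivity, hCinf.le,
    fun x => (min_le_left _ _).trans (hlower x), hupper, min_le_right _ _, by linarith, ?_, ?_⟩
  · intro a l hl hl1 x hx y hy
    have hlogl : 0 ≤ -Real.log l := by linarith [Real.log_nonpos hl.le hl1]
    have hE : 0 ≤ (pinf + Cinf) * Real.log (4 * n) := by positivity
    rcases le_or_gt (4 * n * l) 1 with hs | hs
    · suffices |p x - p y| * (-Real.log l) ≤ 2 * C₀ by linarith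
      have hd : ‖x - y‖ ≤ √n * l := by
        rw [← dist_eq_norm]
        exact dist_le_of_mem_coord_Icc hl.le (fun i => Ico_subset_Icc_self (hx i))
          (fun i => Ico_subset_Icc_self (hy i))
      -- Squaring trades the dimensional factor for one power of `l`: it gives `2 * log ‖x - y‖ ≤
      -- log l`, whence the constant `2 * C₀`.
      have hd2 : ‖x - y‖ ^ 2 ≤ l / 4 := by
        calc ‖x - y‖ ^ 2 ≤ (√n * l) ^ 2 := by gcongr
          _ = n * l * l := by rw [mul_pow, Real.sq_sqrt (by linarith)]; ring
          _ ≤ l / 4 := by nlinarith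
      have hl4 : l ≤ 1 / 4 := by nlinarith
      have hd4 : ‖x - y‖ ≤ 1 / 4 := by
        by_contra hcon
        nlinarith [not_le.1 hcon]
      have h1 := hloc x y (by linarith)
      rcases (norm_nonneg (x - y)).eq_or_lt with h0 | h0
      · rw [← h0, Real.log_zero, div_zero] at h1
        nlinarith
      · have h2 : 2 * Real.log ‖x - y‖ ≤ Real.log l := by
          have := Real.log_le_log (by positivity) (hd2.trans (by linarith : l / 4 ≤ l))
          rwa [Real.log_pow, Nat.cast_ofNat] at this
        have hl0 : Real.log l < 0 := Real.log_neg hl (by linarith)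
        rw [neg_div, ← div_neg, le_div_iff₀ (by linarith)] at h1
        nlinarith [abs_nonneg (p x - p y)]
    · have h1 : -Real.log l ≤ Real.log (4 * n) := by
        rw [← Real.log_inv]
        refine Real.log_le_log (by positivity) ?_
        rw [inv_le_iff_one_le_mul₀ hl]
        exact hs.le
      have h2 : |p x - p y| ≤ pinf + Cinf := by
        rw [abs_le]
        constructor <;> linarith [hp.pos x, hp.pos y, hupper x, hupper y]
      have h3 : |p x - p y| * (-Real.log l) ≤ (pinf + Cinf) * Real.log (4 * n) := by gcongr
      linarith
  · intro x
    have h1 := hdec x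
    rwa [le_div_iff₀ (by linarith [hlog1 x])] at h1

end Exponent

/-! ### Operator norms and matrix weights. -/

section MatNorm

variable {n m : ℕ}

theorem matNorm_nonneg (A : Matrix (Fin m) (Fin m) ℂ) : 0 ≤ matNorm A := norm_nonneg _

theorem matNorm_mul_le (A B : Matrix (Fin m) (Fin m) ℂ) :
    matNorm (A * B) ≤ matNorm A * matNorm B := by
  unfold matNorm
  rw [map_mul]
  exact norm_mul_le _ _

theorem matNorm_eq_zero {A : Matrix (Fin m) (Fin m) ℂ} : matNorm A = 0 ↔ A = 0 := by
  unfold matNorm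
  rw [norm_eq_zero, EmbeddingLike.map_eq_zero_iff]

/-- Expansion in the entries of `A` with fixed operator coefficients, through which measurability
and integrability pass from the entries of `W` to `‖W(·)M‖`. -/
theorem toEuclideanCLM_mul_eq_sum (A M : Matrix (Fin m) (Fin m) ℂ) :
    Matrix.toEuclideanCLM (n := Fin m) (𝕜 := ℂ) (A * M) =
      ∑ i, ∑ j, A i j • Matrix.toEuclideanCLM (n := Fin m) (𝕜 := ℂ) (Matrix.single i j 1 * M) := by
  conv_lhs => rw [Matrix.matrix_eq_sum_single A]
  simp only [Matrix.sum_mul, map_sum]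
  refine Finset.sum_congr rfl fun i _ => Finset.sum_congr rfl fun j _ => ?_
  rw [← map_smul, ← Matrix.smul_mul, Matrix.smul_single, smul_eq_mul, mul_one]

theorem box_subset_isCompact (a : Fin n → ℝ) {l : ℝ} (hl : 0 < l) :
    ∃ S : Set (RSpace n), IsCompact S ∧ box a l ⊆ S := by
  refine ⟨Metric.closedBall (WithLp.toLp 2 a) (√n * l), isCompact_closedBall _ _, fun x hx => ?_⟩
  exact dist_le_of_mem_coord_Icc hl.le (fun i => Ico_subset_Icc_self (hx i))
    (fun i => by simp only [mem_Icc]; exact ⟨le_rfl, by linarith⟩)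

variable {W : RSpace n → Matrix (Fin m) (Fin m) ℂ}

theorem IsMatrixWeight.aemeasurable (hW : IsMatrixWeight W) (M : Matrix (Fin m) (Fin m) ℂ) :
    AEMeasurable fun x => matNorm (W x * M) := by
  have h : AEStronglyMeasurable
      (fun x => Matrix.toEuclideanCLM (n := Fin m) (𝕜 := ℂ) (W x * M)) volume := by
    simp only [fun x => toEuclideanCLM_mul_eq_sum (W x) M]
    refine Finset.aestronglyMeasurable_fun_sum _ fun i _ =>
      Finset.aestronglyMeasurable_fun_sum _ fun j _ => ?_
    exact (hW.locallyIntegrable i j).aestronglyMeasurable.smul_const _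
  exact h.norm.aemeasurable

theorem IsMatrixWeight.integrableOn (hW : IsMatrixWeight W) (M : Matrix (Fin m) (Fin m) ℂ)
    (a : Fin n → ℝ) {l : ℝ} (hl : 0 < l) :
    IntegrableOn (fun x => matNorm (W x * M)) (box a l) := by
  obtain ⟨S, hS, hsub⟩ := box_subset_isCompact a hl
  have hij : ∀ i j, Integrable (fun x => ‖W x i j‖ * matNorm (Matrix.single i j 1 * M))
      (volume.restrict (box a l)) := fun i j =>
    (((hW.locallyIntegrable i j).integrableOn_isCompact hS).mono_set hsub).norm.mul_const _
  have hsum : Integrable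
      (fun x => ∑ i, ∑ j, ‖W x i j‖ * matNorm (Matrix.single i j 1 * M))
      (volume.restrict (box a l)) :=
    integrable_finsetSum _ fun i _ => integrable_finsetSum _ fun j _ => hij i j
  refine hsum.mono' (hW.aemeasurable M).restrict.aestronglyMeasurable
    (Filter.Eventually.of_forall fun x => ?_)
  rw [Real.norm_of_nonneg (matNorm_nonneg _), matNorm, toEuclideanCLM_mul_eq_sum]
  refine (norm_sum_le _ _).trans (Finset.sum_le_sum fun i _ =>
    (norm_sum_le _ _).trans (Finset.sum_le_sum fun j _ => ?_))
  rw [norm_smul, matNorm]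

theorem IsMatrixWeight.ae_pos (hW : IsMatrixWeight W) {M : Matrix (Fin m) (Fin m) ℂ}
    (hM : M ≠ 0) : ∀ᵐ x, 0 < matNorm (W x * M) := by
  filter_upwards [hW.isUnit] with x hx
  refine lt_of_le_of_ne (matNorm_nonneg _) fun h0 => hM ?_
  have h1 := matNorm_eq_zero.1 h0.symm
  exact (hx.mul_right_eq_zero).1 h1

end MatNorm

/-! ### From the matrix condition to the scalar one. -/

section Transfer

variable {n : ℕ} {pm P Cd Ci : ℝ} {p : RSpace n → ℝ} {pinf : ℝ}

theorem LogHolderClass.indNorm_spec (h : LogHolderClass pm P Cd Ci p pinf) (a : Fin n → ℝ) {l : ℝ}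
    (hl : 0 < l) :
    varNorm p ((box a l).indicator fun _ => (1 : ℝ)) = ENNReal.ofReal (indNorm p (box a l)) ∧
    0 < indNorm p (box a l) := by
  rcases le_total l 1 with hl1 | hl1
  · exact ⟨(h.indNorm_small a hl hl1).1, h.indNorm_small_pos a hl hl1⟩
  · obtain ⟨C, hC, hind⟩ := exists_indNorm_large n pm P Cd Ci
    obtain ⟨h1, -, h2⟩ := hind p pinf h a l hl1
    have h3 : 0 < l ^ ((n : ℝ) / pinf) := by positivity
    exact ⟨h1, pos_of_mul_pos_right (h3.trans_le h2) (by linarith)⟩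

/-- If the norm were zero, rescaling would bound the modular at `1` by `t ^ pm` for every `t ≤ 1`,
so it would vanish although the integrand is positive on a set of positive measure. -/
theorem LogHolderClass.varNorm_ne_zero (h : LogHolderClass pm P Cd Ci p pinf) {w : RSpace n → ℝ}
    (hw : Measurable w) (hw0 : ∀ x, 0 < w x) (a : Fin n → ℝ) {l : ℝ} (hl : 0 < l) :
    varNorm p ((box a l).indicator w) ≠ 0 := by
  intro h0
  have hpm := h.pm_pos
  have hm : ∀ t, modular p ((box a l).indicator w) t =
      ∫⁻ x in box a l, ENNReal.ofReal ((w x / t) ^ p x) := fun t =>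
    modular_indicator h.pos (measurableSet_box a l) fun x => (hw0 x).le
  have h1 : ∀ t : ℝ, 0 < t → t ≤ 1 → ∫⁻ x in box a l, ENNReal.ofReal ((w x / 1) ^ p x) ≤
      ENNReal.ofReal (t ^ pm) := by
    intro t ht ht1
    have h2 : modular p ((box a l).indicator w) t ≤ 1 := modular_le_one_of_varNorm_lt h.pos (by
      rw [h0]; simpa using ht)
    rw [hm] at h2
    calc ∫⁻ x in box a l, ENNReal.ofReal ((w x / 1) ^ p x)
        ≤ ∫⁻ x in box a l, ENNReal.ofReal (t ^ pm) * ENNReal.ofReal ((w x / t) ^ p x) := by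
          refine lintegral_mono fun x => ?_
          have hwx := hw0 x
          rw [← ENNReal.ofReal_mul (by positivity)]
          refine ENNReal.ofReal_le_ofReal ?_
          have h3 : w x / 1 = t * (w x / t) := by field_simp
          rw [h3, Real.mul_rpow ht.le (by positivity)]
          refine mul_le_mul_of_nonneg_right ?_ (by positivity)
          exact Real.rpow_le_rpow_of_exponent_ge ht ht1 (h.lower x)
      _ = ENNReal.ofReal (t ^ pm) * ∫⁻ x in box a l, ENNReal.ofReal ((w x / t) ^ p x) :=
          lintegral_const_mul' _ _ ENNReal.ofReal_ne_top
      _ ≤ ENNReal.ofReal (t ^ pm) * 1 := by gcongr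
      _ = _ := mul_one _
  have h2 : ∫⁻ x in box a l, ENNReal.ofReal ((w x / 1) ^ p x) = 0 := by
    by_contra hne
    set I := ∫⁻ x in box a l, ENNReal.ofReal ((w x / 1) ^ p x) with hI
    have hfin : I ≠ ⊤ := ne_top_of_le_ne_top ENNReal.ofReal_ne_top (h1 1 one_pos le_rfl)
    have hpos : 0 < I.toReal := ENNReal.toReal_pos hne hfin
    set s := min 1 (I.toReal / 2) with hs
    have hs0 : 0 < s := lt_min one_pos (by linarith)
    have h3 := h1 (s ^ (1 / pm)) (by positivity)
      (Real.rpow_le_one hs0.le (min_le_left _ _) (by positivity))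
    rw [← Real.rpow_mul hs0.le, one_div_mul_cancel hpm.ne', Real.rpow_one] at h3
    have h4 := ENNReal.toReal_le_of_le_ofReal hs0.le h3
    have h5 : s ≤ I.toReal / 2 := min_le_right _ _
    linarith
  refine absurd h2 (ne_of_gt ?_)
  have hmeas : Measurable fun x => ENNReal.ofReal ((w x / 1) ^ p x) :=
    Measurable.ennreal_ofReal ((hw.div_const 1).pow h.measurable)
  rw [setLIntegral_pos_iff hmeas]
  have : (Function.support fun x => ENNReal.ofReal ((w x / 1) ^ p x)) = univ := by
    ext x
    have := hw0 x
    simp only [Function.mem_support, mem_univ, iff_true, ne_eq, ENNReal.ofReal_eq_zero, not_le]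
    positivity
  rw [this, univ_inter]
  exact pos_iff_ne_zero.2 (volume_box_ne_zero a hl)

theorem sub_le_logMean {Q : Set (RSpace n)} {φ : RSpace n → ℝ≥0∞} {G : RSpace n → ℝ}
    (h : ∀ᵐ y ∂volume.restrict Q, (G y : EReal) ≤ ENNReal.log (φ y)) :
    ((laverage (volume.restrict Q) fun y => ENNReal.ofReal (G y) : ℝ≥0∞) : EReal) -
      ((laverage (volume.restrict Q) fun y => ENNReal.ofReal (-G y) : ℝ≥0∞) : EReal) ≤
      logMean Q φ := by
  unfold logMean
  refine EReal.sub_le_sub (EReal.coe_ennreal_le_coe_ennreal_iff.2 ?_)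
    (EReal.coe_ennreal_le_coe_ennreal_iff.2 ?_)
  · rw [laverage_eq, laverage_eq]
    refine ENNReal.div_le_div_right (lintegral_mono_ae ?_) _
    filter_upwards [h] with y hy
    rw [← EReal.real_coe_toENNReal]
    exact EReal.toENNReal_le_toENNReal hy
  · rw [laverage_eq, laverage_eq]
    refine ENNReal.div_le_div_right (lintegral_mono_ae ?_) _
    filter_upwards [h] with y hy
    rw [← EReal.real_coe_toENNReal, EReal.coe_neg]
    exact EReal.toENNReal_le_toENNReal (EReal.neg_le_neg_iff.2 hy)

end Transfer

section Final

variable {n m : ℕ} {pm P Cd Ci : ℝ} {p : RSpace n → ℝ} {pinf : ℝ}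
  {W : RSpace n → Matrix (Fin m) (Fin m) ℂ}

theorem varNorm_indicator_congr {Q R : Set (RSpace n)} {f g : RSpace n → ℝ}
    (hQR : Q =ᵐ[volume] R) (hfg : f =ᵐ[volume] g) :
    varNorm p (Q.indicator f) = varNorm p (R.indicator g) := by
  refine varNorm_congr ?_
  filter_upwards [hQR, hfg] with x hx hx'
  have hmem : x ∈ Q ↔ x ∈ R := hx.to_iff
  by_cases h : x ∈ Q
  · rw [indicator_of_mem h, indicator_of_mem (hmem.1 h), hx']
  · rw [indicator_of_notMem h, indicator_of_notMem (fun h' => h (hmem.2 h'))]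

/-- Factor `W x * M = (W x * (W y)⁻¹) * (W y * M)` and use submultiplicativity; the second factor
does not depend on `x`. -/
theorem normRatio_le_mul (h : LogHolderClass pm P Cd Ci p pinf) (hW : IsMatrixWeight W)
    {M : Matrix (Fin m) (Fin m) ℂ} (hM : M ≠ 0) (Q : Set (RSpace n)) :
    ∀ᵐ y, normRatio p Q (fun x => matNorm (W x * M)) ≤
      ENNReal.ofReal (matNorm (W y * M)) *
        normRatio p Q (fun x => matNorm (W x * (W y)⁻¹)) := by
  filter_upwards [hW.isUnit, hW.ae_pos hM] with y hy hpos
  unfold normRatio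
  rw [← mul_div_assoc]
  refine ENNReal.div_le_div_right (le_trans ?_ (varNorm_const_mul_le hpos)) _
  refine varNorm_mono h.pos (Filter.Eventually.of_forall fun x => ?_)
  by_cases hx : x ∈ Q
  · rw [indicator_of_mem hx, indicator_of_mem hx, abs_of_nonneg (matNorm_nonneg _),
      abs_of_nonneg (mul_nonneg hpos.le (matNorm_nonneg _)), mul_comm]
    have h1 : W x * M = (W x * (W y)⁻¹) * (W y * M) := by
      rw [Matrix.mul_assoc, ← Matrix.mul_assoc (W y)⁻¹,
        Matrix.nonsing_inv_mul _ ((Matrix.isUnit_iff_isUnit_det _).1 hy), Matrix.one_mul]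
    rw [h1]
    exact matNorm_mul_le _ _
  · simp [hx]

/-- The scalar weight `‖W(·) M‖` satisfies the scalar `𝒜_{p(·),∞}` condition with the constant
of `W`. -/
theorem IsMatrixApWeight.exists_scalar (h : LogHolderClass pm P Cd Ci p pinf)
    (hW : IsMatrixApWeight p W) {M : Matrix (Fin m) (Fin m) ℂ} (hM : M ≠ 0) :
    ∃ w : RSpace n → ℝ, Measurable w ∧ (∀ x, 0 < w x) ∧
      ((fun x => matNorm (W x * M)) =ᵐ[volume] w) ∧
      ∀ (a : Fin n → ℝ) (l : ℝ), 0 < l →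
        IntegrableOn (fun x => Real.log (w x)) (box a l) ∧
        varNorm p ((box a l).indicator w) = ENNReal.ofReal (setNorm p w (box a l)) ∧
        0 < setNorm p w (box a l) ∧
        setNorm p w (box a l) ≤ (matrixApConst p W).toReal *
          Real.exp ((∫ x in box a l, Real.log (w x)) / l ^ n) * indNorm p (box a l) := by
  obtain ⟨hWw, hK⟩ := hW
  have hae := hWw.aemeasurable M
  set w₀ := hae.mk with hw₀
  -- A Borel representative, reset to `1` on a null set so that it is positive everywhere.
  set w : RSpace n → ℝ := {x | 0 < w₀ x}.piecewise w₀ (fun _ => 1) with hw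
  have hwm : Measurable w :=
    hae.measurable_mk.piecewise (measurableSet_lt measurable_const hae.measurable_mk)
      measurable_const
  have hwpos : ∀ x, 0 < w x := by
    intro x
    by_cases hx : x ∈ {x | 0 < w₀ x}
    · rw [hw, piecewise_eq_of_mem _ _ _ hx]; exact hx
    · rw [hw, piecewise_eq_of_notMem _ _ _ hx]; exact one_pos
  have hww : (fun x => matNorm (W x * M)) =ᵐ[volume] w := by
    filter_upwards [hae.ae_eq_mk, hWw.ae_pos hM] with x hx hpos
    have hx' : x ∈ {x | 0 < w₀ x} := by
      change 0 < w₀ x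
      rw [hw₀, ← hx]; exact hpos
    rw [hw, piecewise_eq_of_mem _ _ _ hx', hw₀, ← hx]
  refine ⟨w, hwm, hwpos, hww, fun a l hl => ?_⟩
  set R := box a l with hR
  have hRm : MeasurableSet R := measurableSet_box a l
  have hR0 : volume R ≠ 0 := volume_box_ne_zero a hl
  have hRt : volume R ≠ ⊤ := volume_box_ne_top a hl
  have hVreal : volume.real R = l ^ n := by
    rw [measureReal_def, volume_box a hl, ENNReal.toReal_ofReal (by positivity)]
  obtain ⟨ht, ht0⟩ := h.indNorm_spec a hl
  rw [← hR] at ht ht0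
  set t := indNorm p R with htdef
  set φ : RSpace n → ℝ≥0∞ := fun y => normRatio p R fun x => matNorm (W x * (W y)⁻¹) with hφ
  set ν := normRatio p R (fun x => matNorm (W x * M)) with hν
  have hνeq : ν = varNorm p (R.indicator w) / ENNReal.ofReal t := by
    rw [hν, normRatio, varNorm_indicator_congr (Filter.EventuallyEq.refl _ R) hww, ht]
  have hφw : ∀ᵐ y, ν ≤ ENNReal.ofReal (w y) * φ y := by
    filter_upwards [normRatio_le_mul h hWw hM R, hww] with y hy hy'
    rw [← hy']; exact hy
  have hexp : EReal.exp (logMean R φ) ≤ matrixApConst p W :=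
    le_iSup₂_of_le R (isCube_box a hl) le_rfl
  -- An infinite norm of `w` on `R` would force `φ = ⊤` almost everywhere, making the logarithmic
  -- mean, and with it the constant of `W`, infinite.
  have hνtop : ν ≠ ⊤ := by
    intro hcon
    have h1 : ∀ᵐ y, φ y = ⊤ := by
      filter_upwards [hφw] with y hy
      rw [hcon, top_le_iff] at hy
      by_contra hne
      exact ENNReal.mul_ne_top ENNReal.ofReal_ne_top hne hy
    have h2 : logMean R φ = ⊤ := by
      unfold logMean
      have e1 : (laverage (volume.restrict R) fun y => (ENNReal.log (φ y)).toENNReal) = ⊤ := by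
        have : (fun y => (ENNReal.log (φ y)).toENNReal) =ᵐ[volume.restrict R] fun _ => ⊤ := by
          filter_upwards [ae_restrict_of_ae h1] with y hy
          simp [hy]
        rw [laverage_eq, lintegral_congr_ae this, lintegral_const, Measure.restrict_apply_univ,
          ENNReal.top_mul hR0, ENNReal.top_div_of_ne_top hRt]
      have e2 : (laverage (volume.restrict R) fun y => (-ENNReal.log (φ y)).toENNReal) = 0 := by
        have : (fun y => (-ENNReal.log (φ y)).toENNReal) =ᵐ[volume.restrict R] fun _ => 0 := by
          filter_upwards [ae_restrict_of_ae h1] with y hy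
          simp [hy]
        rw [laverage_eq, lintegral_congr_ae this, lintegral_zero, ENNReal.zero_div]
      rw [e1, e2]; simp
    rw [h2, EReal.exp_top, top_le_iff] at hexp
    exact hK.ne hexp
  have hNne0 : varNorm p (R.indicator w) ≠ 0 := h.varNorm_ne_zero hwm hwpos a hl
  have hNtop : varNorm p (R.indicator w) ≠ ⊤ := by
    intro hcon
    rw [hcon, ENNReal.top_div_of_ne_top ENNReal.ofReal_ne_top] at hνeq
    exact hνtop hνeq
  have hNeq : varNorm p (R.indicator w) = ENNReal.ofReal (setNorm p w R) :=
    (ENNReal.ofReal_toReal hNtop).symm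
  have hN0 : 0 < setNorm p w R := ENNReal.toReal_pos hNne0 hNtop
  set N := setNorm p w R with hN
  have hνreal : ν = ENNReal.ofReal (N / t) := by
    rw [hνeq, hNeq, ENNReal.ofReal_div_of_pos ht0]
  set s := N / t with hs
  have hs0 : 0 < s := div_pos hN0 ht0
  set G : RSpace n → ℝ := fun y => Real.log s - Real.log (w y) with hG
  have hGm : Measurable G := measurable_const.sub hwm.log
  have hGφ : ∀ᵐ y ∂volume.restrict R, (G y : EReal) ≤ ENNReal.log (φ y) := by
    refine ae_restrict_of_ae ?_
    filter_upwards [hφw] with y hy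
    have h1 : ENNReal.ofReal (s / w y) ≤ φ y := by
      rw [ENNReal.ofReal_div_of_pos (hwpos y)]
      refine ENNReal.div_le_of_le_mul' ?_
      rwa [hνreal] at hy
    have h2 := ENNReal.log_le_log h1
    rwa [ENNReal.log_ofReal_of_pos (div_pos hs0 (hwpos y)),
      Real.log_div hs0.ne' (hwpos y).ne'] at h2
  have hwint : IntegrableOn w R := by
    refine (hWw.integrableOn M a hl).congr ?_
    exact ae_restrict_of_ae hww
  -- The part where `log w` is large is controlled by `log w ≤ w - 1` and local integrability. The
  -- other part can only be finite, since otherwise the extended mean would be `⊤`; together they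
  -- make `log w` integrable.
  have hnegfin : ∫⁻ y in R, ENNReal.ofReal (-G y) ≠ ⊤ := by
    have h1 : IntegrableOn (fun y => w y + |Real.log s|) R := hwint.add (integrableOn_const hRt)
    refine ne_top_of_le_ne_top h1.lintegral_lt_top.ne
      (lintegral_mono fun y => ENNReal.ofReal_le_ofReal ?_)
    have h2 := Real.log_le_sub_one_of_pos (hwpos y)
    have h3 := neg_le_abs (Real.log s)
    simp only [hG]
    linarith
  have hmain := (EReal.exp_monotone (sub_le_logMean hGφ)).trans hexp
  simp only [laverage_eq, Measure.restrict_apply_univ] at hmain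
  set I₁ := ∫⁻ y in R, ENNReal.ofReal (G y) with hI₁
  set I₂ := ∫⁻ y in R, ENNReal.ofReal (-G y) with hI₂
  have hI₂' : I₂ / volume R ≠ ⊤ := ENNReal.div_ne_top hnegfin hR0
  have hI₁' : I₁ / volume R ≠ ⊤ := by
    intro hcon
    rw [hcon, ← EReal.coe_toENNReal (x := ((I₂ / volume R : ℝ≥0∞) : EReal))
      (EReal.coe_ennreal_nonneg _), EReal.toENNReal_coe, ← ENNReal.ofReal_toReal hI₂'] at hmain
    rw [EReal.coe_ennreal_top, EReal.coe_ennreal_ofReal, EReal.top_sub_coe, EReal.exp_top,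
      top_le_iff] at hmain
    exact hK.ne hmain
  have hposfin : I₁ ≠ ⊤ := by
    intro hcon
    rw [hcon, ENNReal.top_div_of_ne_top hRt] at hI₁'
    exact hI₁' rfl
  have hGint : IntegrableOn G R := by
    refine ⟨hGm.aestronglyMeasurable, ?_⟩
    have h1 : ∫⁻ y in R, ‖G y‖ₑ ≤ I₁ + I₂ := by
      rw [hI₁, hI₂, ← lintegral_add_left hGm.ennreal_ofReal]
      refine lintegral_mono fun y => ?_
      rw [Real.enorm_eq_ofReal_abs]
      rcases le_total 0 (G y) with h0 | h0
      · rw [abs_of_nonneg h0]; exact le_self_add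
      · rw [abs_of_nonpos h0]; exact le_add_self
    exact h1.trans_lt (ENNReal.add_lt_top.2 ⟨lt_top_iff_ne_top.2 hposfin,
      lt_top_iff_ne_top.2 hnegfin⟩)
  have hlogint : IntegrableOn (fun x => Real.log (w x)) R := by
    have h1 : IntegrableOn (fun y => Real.log s - G y) R := (integrableOn_const hRt).sub hGint
    refine h1.congr_fun (fun y _ => ?_) hRm
    simp only [hG]; ring
  refine ⟨hlogint, hNeq, hN0, ?_⟩
  have hV0 : 0 < volume.real R := by rw [hVreal]; positivity
  have hGavg : ((I₁ / volume R : ℝ≥0∞) : EReal) - ((I₂ / volume R : ℝ≥0∞) : EReal) =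
      (((∫ y in R, G y) / volume.real R : ℝ) : EReal) := by
    rw [integral_eq_lintegral_pos_part_sub_lintegral_neg_part hGint, ← hI₁, ← hI₂, sub_div,
      measureReal_def, ← ENNReal.toReal_div, ← ENNReal.toReal_div, EReal.coe_sub,
      EReal.coe_ennreal_toReal hI₁', EReal.coe_ennreal_toReal hI₂']
  rw [hGavg, EReal.exp_coe] at hmain
  have h1 : Real.exp ((∫ y in R, G y) / volume.real R) ≤ (matrixApConst p W).toReal := by
    rwa [← ENNReal.ofReal_le_iff_le_toReal hK.ne]
  have h2 : ∫ y in R, G y = volume.real R * Real.log s - ∫ y in R, Real.log (w y) := by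
    simp only [hG]
    rw [integral_sub (integrableOn_const (C := Real.log s) hRt) hlogint, setIntegral_const,
      smul_eq_mul]
  rw [h2, sub_div, mul_div_cancel_left₀ _ hV0.ne', Real.exp_sub, Real.exp_log hs0, hVreal,
    div_le_iff₀ (Real.exp_pos _), hs, div_le_iff₀ ht0] at h1
  exact h1

end Final

/-! ### Lower bound for the constant of the weight. -/

section LowerBound

variable {n : ℕ} {pm P Cd Ci : ℝ} {p : RSpace n → ℝ} {pinf : ℝ}

/-- A Jensen-type bound on a unit box: with `s` the normalized norm, `log (w / s) ≤ (w / s) ^ p /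
pm` has integral at most `modConst / pm`, so the geometric mean of `w` is at most `s` times a
constant. Inserted in the hypothesis this bounds `K` from below, whereas `ScalarAinf` requires a
constant at least `1`. -/
theorem LogHolderClass.one_le_mul_exp (h : LogHolderClass pm P Cd Ci p pinf) {w : RSpace n → ℝ}
    (hw : Measurable w) (hw0 : ∀ x, 0 < w x) {a : Fin n → ℝ} {K : ℝ} (hK : 0 ≤ K)
    (hlog : IntegrableOn (fun x => Real.log (w x)) (box a 1))
    (hN : varNorm p ((box a 1).indicator w) = ENNReal.ofReal (setNorm p w (box a 1)))
    (hN0 : 0 < setNorm p w (box a 1))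
    (hle : setNorm p w (box a 1) ≤
      K * Real.exp ((∫ x in box a 1, Real.log (w x)) / 1 ^ n) * indNorm p (box a 1)) :
    1 ≤ K * Real.exp (modConst n pm P Cd / pm) := by
  have hpm := h.pm_pos
  have ht0 := h.indNorm_small_pos a one_pos le_rfl
  have hmod := (h.lintegral_normalized_small a one_pos le_rfl (fun x => (hw0 x).le) hN0 hN).1
  set R := box a 1 with hR
  set s := setNorm p w R / indNorm p R with hs
  have hs0 : 0 < s := div_pos hN0 ht0
  have hRm : MeasurableSet R := measurableSet_box a 1
  have hvol : volume.real R = 1 := by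
    rw [measureReal_def, volume_box a one_pos]; simp
  have hRt : volume R ≠ ⊤ := volume_box_ne_top a one_pos
  rw [one_pow, mul_one] at hmod
  rw [one_pow, div_one] at hle
  have hM : 0 ≤ modConst n pm P Cd := by linarith [h.one_le_modConst]
  have hq0 : ∀ x, 0 ≤ (w x / s) ^ p x := fun x => by have := hw0 x; positivity
  have hqm : Measurable fun x => (w x / s) ^ p x := (hw.div_const s).pow h.measurable
  have hqI : IntegrableOn (fun x => (w x / s) ^ p x) R := by
    refine ⟨hqm.aestronglyMeasurable, ?_⟩
    rw [hasFiniteIntegral_iff_ofReal (Filter.Eventually.of_forall hq0)]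
    exact hmod.trans_lt ENNReal.ofReal_lt_top
  have hq : ∫ x in R, (w x / s) ^ p x ≤ modConst n pm P Cd := by
    rw [integral_eq_lintegral_of_nonneg_ae (Filter.Eventually.of_forall hq0)
      hqm.aestronglyMeasurable]
    exact ENNReal.toReal_le_of_le_ofReal hM hmod
  have hconst : IntegrableOn (fun _ : RSpace n => Real.log s) R := integrableOn_const hRt
  have hmono : ∫ x in R, Real.log (w x) ≤
      ∫ x in R, (Real.log s + 1 / pm * (w x / s) ^ p x) := by
    refine setIntegral_mono_on hlog (hconst.add (hqI.const_mul _)) hRm fun x _ => ?_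
    have h1 := log_le_rpow_div h (x := x) (div_pos (hw0 x) hs0)
    rw [Real.log_div (hw0 x).ne' hs0.ne'] at h1
    linarith
  rw [integral_add hconst (hqI.const_mul _), setIntegral_const, hvol, one_smul,
    integral_const_mul] at hmono
  have h1 : ∫ x in R, Real.log (w x) ≤ Real.log s + modConst n pm P Cd / pm := by
    have h2 : 1 / pm * ∫ x in R, (w x / s) ^ p x ≤ 1 / pm * modConst n pm P Cd := by gcongr
    rw [one_div_mul_eq_div _ (modConst n pm P Cd)] at h2
    linarith
  have h2 : s ≤ K * Real.exp (∫ x in R, Real.log (w x)) := by rwa [hs, div_le_iff₀ ht0]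
  have h3 : s * 1 ≤ s * (K * Real.exp (modConst n pm P Cd / pm)) := by
    calc s * 1 ≤ K * Real.exp (Real.log s + modConst n pm P Cd / pm) := by
          rw [mul_one]; refine h2.trans ?_; gcongr
      _ = _ := by rw [Real.exp_add, Real.exp_log hs0]; ring
  exact le_of_mul_le_mul_left h3 hs0

end LowerBound

/-! ### Reverse Hölder inequality for matrix weights. -/

section Main

variable {n m : ℕ} {pm P Cd Ci : ℝ} {p : RSpace n → ℝ} {pinf : ℝ}

theorem LogHolderClass.normRatio_eq (h : LogHolderClass pm P Cd Ci p pinf)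
    {f w : RSpace n → ℝ} (hfw : f =ᵐ[volume] w) {Q : Set (RSpace n)} {a : Fin n → ℝ} {l : ℝ}
    (hl : 0 < l) (hQ : Q =ᵐ[volume] box a l) :
    normRatio p Q f =
      varNorm p ((box a l).indicator w) / ENNReal.ofReal (indNorm p (box a l)) := by
  rw [normRatio, varNorm_indicator_congr hQ hfw,
    varNorm_indicator_congr hQ (Filter.EventuallyEq.refl _ _), (h.indNorm_spec a hl).1]

theorem normRatio_zero (hp : ∀ x, 0 < p x) (Q : Set (RSpace n)) :
    normRatio p Q (fun _ => 0) = 0 := by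
  have h0 : varNorm p (Q.indicator fun _ => (0 : ℝ)) = 0 := by
    refine le_antisymm (ENNReal.le_of_forall_pos_le_add fun ε hε _ => ?_) zero_le
    rw [zero_add, ← ENNReal.ofReal_coe_nnreal]
    refine varNorm_le_ofReal (by exact_mod_cast hε) ?_
    simp [modular, Real.zero_rpow (hp _).ne']
  rw [normRatio, h0, ENNReal.zero_div]

/-- The matrix reverse Hölder inequality for exponents of the class `LogHolderClass`. -/
theorem exists_matrix_reverse_holder (n : ℕ) (pm P Cd Ci : ℝ) :
    ∃ C C₁ : ℝ, 0 < C ∧ 0 < C₁ ∧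
      ∀ (p : RSpace n → ℝ) (pinf : ℝ), LogHolderClass pm P Cd Ci p pinf →
      ∀ (m : ℕ) (W : RSpace n → Matrix (Fin m) (Fin m) ℂ), IsMatrixApWeight p W →
      ∀ r : ℝ, 1 < r → r ≤ 1 + 1 / (C₁ * (matrixApConst p W).toReal ^ (4 * P) *
          (2 : ℝ) ^ (1 * (matrixApConst p W).toReal)) →
      ∀ Q : Set (RSpace n), IsCube Q → ∀ M : Matrix (Fin m) (Fin m) ℂ,
        normRatio (fun x => r * p x) Q (fun x => matNorm (W x * M)) ≤
          ENNReal.ofReal (C * (matrixApConst p W).toReal ^ (1 : ℝ)) *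
            normRatio p Q (fun x => matNorm (W x * M)) := by
  obtain ⟨Cs, δ, hCs, hδ, hδ1, hrev⟩ := exists_scalar_reverse_holder n pm P Cd Ci
  set b := Real.exp (modConst n pm P Cd / pm) with hb
  have hb0 : 0 < b := Real.exp_pos _
  -- The scalar result is applied with `K * b ≥ 1` in place of `K`. This puts `b ^ (4 * P)` into the
  -- range of `r`, and `b * K ≥ 1` is inserted in the final bound to give it the stated form.
  refine ⟨Cs * b, b ^ (4 * P) / δ, by positivity, by positivity, ?_⟩
  intro p pinf h m W hW r hr hrK Q hQ M
  set K := (matrixApConst p W).toReal with hKdef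
  have hK0 : 0 ≤ K := ENNReal.toReal_nonneg
  rcases eq_or_ne M 0 with rfl | hM
  · have h0 : (fun x => matNorm (W x * 0)) = fun _ => 0 := by
      funext x; rw [Matrix.mul_zero]; exact matNorm_eq_zero.2 rfl
    rw [h0, normRatio_zero fun x => mul_pos (by linarith) (h.pos x)]
    exact zero_le
  obtain ⟨w, hwm, hw0, hww, hbox⟩ := hW.exists_scalar h hM
  have hKb : 1 ≤ K * b := by
    obtain ⟨h1, h2, h3, h4⟩ := hbox 0 1 one_pos
    exact h.one_le_mul_exp hwm hw0 hK0 h1 h2 h3 h4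
  have hKpos : 0 < K := by
    by_contra hcon
    have : K * b ≤ 0 := mul_nonpos_of_nonpos_of_nonneg (not_lt.1 hcon) hb0.le
    linarith
  have hb1 : 1 ≤ b := Real.one_le_exp (div_nonneg (by linarith [h.one_le_modConst]) h.pm_pos.le)
  have hA : ScalarAinf p w (K * b) := by
    refine ⟨hwm, hw0, hKb, fun a l hl => (hbox a l hl).1, fun a l hl => (hbox a l hl).2.1,
      fun a l hl => (hbox a l hl).2.2.1, fun a l hl => (hbox a l hl).2.2.2.trans ?_⟩
    have := (h.indNorm_spec a hl).2
    gcongr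
    exact le_mul_of_one_le_right hK0 hb1
  have hKbP : 1 ≤ (K * b) ^ (4 * P) := Real.one_le_rpow hKb (by have := h.P_pos; positivity)
  have hrδ : r ≤ 1 + δ / (K * b) ^ (4 * P) := by
    refine hrK.trans ?_
    have h1 : (1 : ℝ) ≤ 2 ^ (1 * K) := Real.one_le_rpow (by norm_num) (by linarith)
    have h2 : (K * b) ^ (4 * P) / δ ≤ b ^ (4 * P) / δ * K ^ (4 * P) * 2 ^ (1 * K) := by
      calc (K * b) ^ (4 * P) / δ = b ^ (4 * P) / δ * K ^ (4 * P) * 1 := by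
            rw [Real.mul_rpow hK0 hb0.le]; ring
        _ ≤ _ := by gcongr
    have h3 := one_div_le_one_div_of_le (by positivity) h2
    rw [one_div_div] at h3
    linarith
  have hr2 : r ≤ 2 := by
    have : δ / (K * b) ^ (4 * P) ≤ 1 := by
      rw [div_le_one (by linarith)]; linarith
    linarith
  obtain ⟨a, l, hl, hQbox⟩ := hQ.ae_eq_box
  have h' := h.const_mul hr.le hr2
  have ht := (h.indNorm_spec a hl).2
  have ht' := (h'.indNorm_spec a hl).2
  rw [h'.normRatio_eq hww hl hQbox, h.normRatio_eq hww hl hQbox, (hbox a l hl).2.1,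
    ← ENNReal.ofReal_div_of_pos ht]
  have hN0 := (hbox a l hl).2.2.1
  refine ENNReal.div_le_of_le_mul' ?_
  rw [← ENNReal.ofReal_mul (by positivity), ← ENNReal.ofReal_mul ht'.le, Real.rpow_one]
  refine (hrev p pinf h w (K * b) hA r hr hrδ a l hl).trans (ENNReal.ofReal_le_ofReal ?_)
  have h1 : Cs * (setNorm p w (box a l) / indNorm p (box a l)) ≤
      Cs * b * K * (setNorm p w (box a l) / indNorm p (box a l)) := by
    refine mul_le_mul_of_nonneg_right ?_ (by positivity)
    nlinarith
  rw [mul_comm (indNorm _ _)]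
  exact mul_le_mul_of_nonneg_right h1 ht'.le

end Main

theorem theorem3p12 (n : ℕ) (hn : 0 < n) (pminus pplus pinf C₀ Cinf : ℝ) :
    ∃ C C₁ C₂ A A₁ : ℝ, 0 < C ∧ 0 < C₁ ∧ 0 < C₂ ∧ 0 < A ∧ 0 < A₁ ∧
      ∀ p : RSpace n → ℝ, IsExponent p → LocalLogHolder C₀ p → LogHolderAtInfty pinf Cinf p →
        essInf p volume = pminus → essSup p volume = pplus →
      ∀ m : ℕ, 0 < m → ∀ W : RSpace n → Matrix (Fin m) (Fin m) ℂ, IsMatrixApWeight p W →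
      ∀ r : ℝ, 1 < r →
        r ≤ 1 + 1 / (C₁ * (matrixApConst p W).toReal ^ A₁ *
          (2 : ℝ) ^ (C₂ * (matrixApConst p W).toReal)) →
      ∀ Q : Set (RSpace n), IsCube Q → ∀ M : Matrix (Fin m) (Fin m) ℂ,
        normRatio (fun x => r * p x) Q (fun x => matNorm (W x * M)) ≤
          ENNReal.ofReal (C * (matrixApConst p W).toReal ^ A) *
            normRatio p Q (fun x => matNorm (W x * M)) := by
  by_cases hpos : 0 < pinf ∧ 0 < Cinf
  · obtain ⟨C, C₁, hC, hC₁, h⟩ := exists_matrix_reverse_holder n (min pminus pinf) (pinf + Cinf)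
      (2 * C₀ + (pinf + Cinf) * Real.log (4 * n)) Cinf
    refine ⟨C, C₁, 1, 1, 4 * (pinf + Cinf), hC, hC₁, one_pos, one_pos, by linarith [hpos.1, hpos.2],
      ?_⟩
    rintro p hp hloc hinf rfl - m - W hW
    exact h p pinf (hp.logHolderClass hn hloc hinf) m W hW
  -- With a nonpositive parameter no exponent qualifies, so any positive constants serve.
  · exact ⟨1, 1, 1, 1, 1, one_pos, one_pos, one_pos, one_pos, one_pos,
      fun p _ _ hinf => absurd ⟨hinf.1, hinf.2.1⟩ hpos⟩
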